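/- **Conventions.** Let $\overline{\mathbb R}=[-\infty,+\infty]$, $\mathrm{dom}(f)=\{x\mid f(x)<+\infty\}$, $f^*(w)=\sup_x\{x^\top w-f(x)\}$ and $\delta^*_A(w)=\sup_{x\in A}x^\top w$. A function is *closed* if it is lower semicontinuous and is either nowhere $-\infty$ or identically $-\infty$; it is *proper* if it is nowhere $-\infty$ and not identically $+\infty$. For a proper, closed and convex $f$, $t f(x/t)$ denotes, for $t\ge 0$, the perspective that equals $t\cdot f(x/t)$ if $t>0$ and $\delta^*_{\mathrm{dom}(f^*)}(x)$ if $t=0$ (it is set to $+\infty$ for $t<0$); for $f$ with $-f$ proper, closed and convex, $tf(x/t):=-\,[\,t(-f)(x/t)\,]$. A point is *feasible* in a minimization (maximization) problem if it satisfies the constraints and has objective value $\neq+\infty$ ($\neq-\infty$). A point *solves* a problem if it is feasible and attains the optimal value, or if the problem has no feasible point; a problem is *solvable* if some point solves it. A *Slater point* of a problem with constraints $f_k\le 0$, $e_m=0$ and objective $f_0$ is a point that satisfies all constraints, lies in the relative interiors of the domains of all $f_k$, all $e_m$ and $f_0$ (of $-f_0$ for a maximization problem), and satisfies $f_k<0$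 for every $k$ for which $f_k$ is not linear (affine). Here sign constraints $\lambda\ge0$ count as linear constraints, and a function involving perspectives is linear if it coincides with a real-valued affine function wherever the sign-constrained variables are nonnegative. **Setting.** Let $\mathcal I=\{1,\dots,I\}$ with $I\ge 1$, and let $\mathcal J,\mathcal L$ be finite index sets. Let $-g_i$ ($i\in\mathcal I$), $h_j$ ($j\in\mathcal J$) and $c_\ell$ ($\ell\in\mathcal L$) be proper, closed and convex functions $\mathbb R^{d}\to\overline{\mathbb R}$, and let $\mu\in\mathbb R^{\mathcal J}$. Put $g=\max_{i}g_i$, $h=(h_j)_j$, $S=\{z\mid c_\ell(z)\le 0\ \forall \ell\}$, $$\bar S_i=\{z\in S\mid h_j(z)<+\infty\ \forall j,\ g_i(z)>-\infty\},\qquad \bar S=\bigcup_{i}\bar S_i,$$ $$U_i=\{(z,u,t)\in\mathbb R^d\times\mathbb R^{\mathcal J}\times\mathbb R\mid c_\ell(z)\le0\ \forall\ell,\ h(z)\le u,\ g_i(z)\ge t\},$$ and assume that $\bar S_i\ne\emptyset$ for every $i\in\mathcal I$. Let $\mathcal P$ be the set of Borel probability distributions $\mathbb P$ on $\mathbb R^d$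 with $\mathbb P(S)=1$ and $\mathbb E_{\mathbb P}[h_j]\le\mu_j$ for all $j$, where $\mathbb E_{\mathbb P}[h_j]:=+\infty$ and $\mathbb E_{\mathbb P}[g]:=-\infty$ if the expectations of the positive and the negative part are both infinite. Consider the following problems. - (P-UQ) $\ \sup_{\mathbb P\in\mathcal P}\mathbb E_{\mathbb P}[g]$. - (D-UQ) $\ \inf\{\alpha+\mu^\top\beta\mid \sup_{z\in\bar S}\{g(z)-\alpha-h(z)^\top\beta\}\le 0,\ \alpha\in\mathbb R,\ \beta\ge0\}$. - (FR) $\ \sup\{\sum_i\lambda_i g(z_i)\mid \sum_i\lambda_i=1,\ \sum_i\lambda_i h(z_i)\le\mu,\ z_i\in\bar S\ \forall i,\ \lambda\ge0\}$. - (AP-W) $\ \inf\{\alpha+\mu^\top\beta\mid \sup_{(z,u,t)\in U_i}\{t-\alpha-u^\top\beta\}\le0\ \forall i,\ \alpha\in\mathbb R,\ \beta\ge0\}$. - (AD-B) $\ \sup\{\sum_i\lambda_it_i\mid \sum_i\lambda_i=1,\ \sum_i\lambda_iu_i\le\mu,\ (z_i,u_i,t_i)\in U_i\ \forall i,\ \lambda\ge0\}$.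 - (AP-W$'$) $\ \inf\ \alpha+\mu^\top\beta$ over $\alpha\in\mathbb R$, $\beta\ge0$, $y^{(0)}_i,y^{(1)}_{ij},y^{(2)}_{i\ell}\in\mathbb R^d$, $\nu_{i\ell}\ge0$ subject to, for all $i\in\mathcal I$, $y_i^{(0)}+\sum_jy_{ij}^{(1)}+\sum_\ell y_{i\ell}^{(2)}=0$ and $$(-g_i)^*(y_i^{(0)})+\sum_j\beta_jh_j^*\big(y_{ij}^{(1)}/\beta_j\big)+\sum_\ell\nu_{i\ell}c_\ell^*\big(y^{(2)}_{i\ell}/\nu_{i\ell}\big)\le\alpha .$$ - (AD-B$'$) $\ \sup\ \sum_i\tau_i$ over $\tau\in\mathbb R^{\mathcal I}$, $\lambda\ge0$, $\omega_i\in\mathbb R^{\mathcal J}$, $\upsilon_i\in\mathbb R^d$ subject to $\sum_i\lambda_i=1$, $\sum_i\omega_i\le\mu$ and, for all $i\in\mathcal I$ and $\ell\in\mathcal L$, $\lambda_ic_\ell(\upsilon_i/\lambda_i)\le0$, $\lambda_ih(\upsilon_i/\lambda_i)\le\omega_i$, $\lambda_ig_i(\upsilon_i/\lambda_i)\ge\tau_i$.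 **Theorem (Strong Duality for (P-UQ) and (D-UQ)).** (i) If (AD-B$'$) admits a Slater point with $\lambda>0$, then (AP-W$'$), (AP-W), (D-UQ), (P-UQ), (FR), (AD-B) and (AD-B$'$) all have the same optimal value in $\overline{\mathbb R}$, and (AP-W$'$) is solvable. Moreover, if $(\alpha^\star,\beta^\star,\{y_i^{(0)\star}\}_i,\{y_{ij}^{(1)\star}\}_{ij},\{y_{i\ell}^{(2)\star},\nu_{i\ell}^\star\}_{i\ell})$ solves (AP-W$'$), then $(\alpha^\star,\beta^\star)$ solves (D-UQ). (ii) If (AP-W$'$) admits a Slater point and $S$ is bounded, then (AP-W$'$), (AP-W), (D-UQ), (P-UQ), (FR), (AD-B) and (AD-B$'$) all have the same optimal value in $\overline{\mathbb R}$, and (AD-B$'$) is solvable. Moreover, if $(\tau^\star,\lambda^\star,\{\omega_i^\star,\upsilon_i^\star\}_i)$ solves (AD-B$'$), then the discrete distribution $\sum_{i:\lambda_i^\star>0}\lambda_i^\star\,\delta_{\upsilon_i^\star/\lambda_i^\star}$ solves (P-UQ) (where $\delta_x$ is the unit mass at $x$). -/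

import Mathlib

open MeasureTheory

namespace UQ

/-! ### Convex analysis for extended real-valued functions -/

section ConvexAnalysis

/-- The effective domain of an extended real-valued function. -/
def dom {X : Type*} (f : X → EReal) : Set X := {x | f x < ⊤}

/-- The epigraph, a subset of `X × ℝ`. -/
def epigraph {X : Type*} (f : X → EReal) : Set (X × ℝ) := {p | f p.1 ≤ (p.2 : EReal)}

/-- `f` never takes the value `-∞` and is not identically `+∞`. -/
def IsProper {X : Type*} (f : X → EReal) : Prop := (∀ x, ⊥ < f x) ∧ ∃ x, f x < ⊤

/-- `f` is lower semicontinuous and either nowhere `-∞` or identically `-∞`. -/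
def IsClosedFun {X : Type*} [TopologicalSpace X] (f : X → EReal) : Prop :=
  LowerSemicontinuous f ∧ ((∀ x, ⊥ < f x) ∨ ∀ x, f x = ⊥)

/-- Convexity of an extended real-valued function: its epigraph is convex. -/
def IsConvexFun {X : Type*} [AddCommGroup X] [Module ℝ X] (f : X → EReal) : Prop :=
  Convex ℝ (epigraph f)

/-- Proper, closed and convex. -/
structure IsPCC {X : Type*} [TopologicalSpace X] [AddCommGroup X] [Module ℝ X]
    (f : X → EReal) : Prop where
  proper : IsProper f
  closed : IsClosedFun f
  convex : IsConvexFun f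

/-- The conjugate `f^*(w) = sup_x { xᵀw - f(x) }`. -/
noncomputable def conj {d : ℕ} (f : EuclideanSpace ℝ (Fin d) → EReal)
    (w : EuclideanSpace ℝ (Fin d)) : EReal :=
  ⨆ x, (((inner ℝ x w : ℝ) : EReal) - f x)

/-- The support function `w ↦ sup_{x ∈ A} xᵀw` of a set. -/
noncomputable def supportFun {d : ℕ} (A : Set (EuclideanSpace ℝ (Fin d)))
    (w : EuclideanSpace ℝ (Fin d)) : EReal :=
  ⨆ x ∈ A, ((inner ℝ x w : ℝ) : EReal)

/-- The convex perspective: `t f(x / t)` for `t > 0` and the support function of `dom f^*`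
for `t = 0`. It is only meaningful for `t ≥ 0` and is extended by `+∞` to `t < 0`. -/
noncomputable def persp {d : ℕ} (f : EuclideanSpace ℝ (Fin d) → EReal)
    (x : EuclideanSpace ℝ (Fin d)) (t : ℝ) : EReal :=
  if 0 < t then (t : EReal) * f (t⁻¹ • x)
  else if t = 0 then supportFun (dom (conj f)) x
  else ⊤

/-- The concave perspective: `t f(x / t)` for `t > 0` and minus the support function of
`dom (-f)^*` for `t = 0`; it is extended by `-∞` to `t < 0`. -/
noncomputable def concavePersp {d : ℕ} (f : EuclideanSpace ℝ (Fin d) → EReal)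
    (x : EuclideanSpace ℝ (Fin d)) (t : ℝ) : EReal :=
  -persp (fun z => -f z) x t

end ConvexAnalysis

/-! ### Optimization problems -/

section Optimization

/-- Optimal value of `inf { f x | x ∈ C }`. -/
noncomputable def minValue {X : Type*} (C : Set X) (f : X → EReal) : EReal := ⨅ x ∈ C, f x

/-- Optimal value of `sup { f x | x ∈ C }`. -/
noncomputable def maxValue {X : Type*} (C : Set X) (f : X → EReal) : EReal := ⨆ x ∈ C, f x

/-- `x` is feasible in `inf { f x | x ∈ C }`. -/
def FeasibleMin {X : Type*} (C : Set X) (f : X → EReal) (x : X) : Prop := x ∈ C ∧ f x ≠ ⊤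

/-- `x` is feasible in `sup { f x | x ∈ C }`. -/
def FeasibleMax {X : Type*} (C : Set X) (f : X → EReal) (x : X) : Prop := x ∈ C ∧ f x ≠ ⊥

/-- `x` solves `inf { f x | x ∈ C }`: if the problem is feasible, then `x` is feasible and attains
the optimal value; an infeasible problem is solved by every `x`. -/
def SolvesMin {X : Type*} (C : Set X) (f : X → EReal) (x : X) : Prop :=
  (∃ x', FeasibleMin C f x') → FeasibleMin C f x ∧ f x = minValue C f

/-- `x` solves `sup { f x | x ∈ C }`, with the same convention for infeasible problems. -/
def SolvesMax {X : Type*} (C : Set X) (f : X → EReal) (x : X) : Prop :=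
  (∃ x', FeasibleMax C f x') → FeasibleMax C f x ∧ f x = maxValue C f

/-- A representation of a set by inequalities `ineq k x ≤ 0` and equalities `eqn k x = 0`.
`ground` is the set of those `x` whose sign-constrained components are nonnegative: perspective
functions are only defined there. The sign constraints themselves are listed among the
inequalities. -/
structure Constraints (X : Type*) (K M : Type*) where
  ground : Set X
  ineq : K → X → EReal
  eqn : M → X → EReal

variable {X K M : Type*}

/-- The set represented by the constraints. -/
def Constraints.set (C : Constraints X K M) : Set X :=
  {x | (∀ k, C.ineq k x ≤ 0) ∧ ∀ m, C.eqn m x = 0}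

/-- `f` is linear (that is, real-valued and affine) on the set on which it is defined. -/
def IsLinearOn [AddCommGroup X] [Module ℝ X] (A : Set X) (f : X → EReal) : Prop :=
  ∃ a : X →ᵃ[ℝ] ℝ, ∀ x ∈ A, f x = ((a x : ℝ) : EReal)

/-- Slater point of a set represented by constraints. -/
structure Constraints.IsSlaterPoint [AddCommGroup X] [Module ℝ X] [TopologicalSpace X]
    (C : Constraints X K M) (x : X) : Prop where
  ri_ineq : ∀ k, x ∈ intrinsicInterior ℝ (dom (C.ineq k))
  ri_eqn : ∀ m, x ∈ intrinsicInterior ℝ (dom (C.eqn m))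
  mem : x ∈ C.set
  strict : ∀ k, ¬ IsLinearOn C.ground (C.ineq k) → C.ineq k x < 0

/-- Slater point of the minimization problem `inf { f x | x ∈ C }`. -/
def IsSlaterPointMin [AddCommGroup X] [Module ℝ X] [TopologicalSpace X]
    (C : Constraints X K M) (f : X → EReal) (x : X) : Prop :=
  C.IsSlaterPoint x ∧ x ∈ intrinsicInterior ℝ (dom f)

/-- Slater point of the maximization problem `sup { f x | x ∈ C }`. -/
def IsSlaterPointMax [AddCommGroup X] [Module ℝ X] [TopologicalSpace X]
    (C : Constraints X K M) (f : X → EReal) (x : X) : Prop :=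
  C.IsSlaterPoint x ∧ x ∈ intrinsicInterior ℝ (dom fun y => -f y)

end Optimization

/-! ### Expectations of extended real-valued functions -/

section Expectation

variable {Ω : Type*} [MeasurableSpace Ω]

/-- Expectation with value `-∞` if the positive and the negative part both have infinite
expectation. -/
noncomputable def expectBot (P : Measure Ω) (f : Ω → EReal) : EReal :=
  if (∫⁻ z, (f z).toENNReal ∂P) = ⊤ ∧ (∫⁻ z, (-f z).toENNReal ∂P) = ⊤ then ⊥
  else ((∫⁻ z, (f z).toENNReal ∂P : ENNReal) : EReal)
    - ((∫⁻ z, (-f z).toENNReal ∂P : ENNReal) : EReal)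

/-- Expectation with value `+∞` if the positive and the negative part both have infinite
expectation. -/
noncomputable def expectTop (P : Measure Ω) (f : Ω → EReal) : EReal :=
  if (∫⁻ z, (f z).toENNReal ∂P) = ⊤ ∧ (∫⁻ z, (-f z).toENNReal ∂P) = ⊤ then ⊤
  else ((∫⁻ z, (f z).toENNReal ∂P : ENNReal) : EReal)
    - ((∫⁻ z, (-f z).toENNReal ∂P : ENNReal) : EReal)

end Expectation

/-! ### The uncertainty quantification problems -/

/-- Data of an uncertainty quantification problem on `ℝ^d`: the pieces `g i` of the disutility
function, the moment functions `h j`, the functions `c l` that describe the support set, and the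
moment bounds `mu`. -/
structure Data (d : ℕ) (I J L : Type*) where
  g : I → EuclideanSpace ℝ (Fin d) → EReal
  h : J → EuclideanSpace ℝ (Fin d) → EReal
  c : L → EuclideanSpace ℝ (Fin d) → EReal
  mu : J → ℝ

namespace Data

variable {d : ℕ} {I J L : Type*} [Fintype I] [Fintype J] [Fintype L] (D : Data d I J L)

/-- The disutility function `g(z) = max_i g_i(z)`. -/
noncomputable def disutility (z : EuclideanSpace ℝ (Fin d)) : EReal := ⨆ i, D.g i z

/-- The support set `S`. -/
def support : Set (EuclideanSpace ℝ (Fin d)) := {z | ∀ l, D.c l z ≤ 0}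

/-- The set `S̄_i`. -/
def effSupportPiece (i : I) : Set (EuclideanSpace ℝ (Fin d)) :=
  {z | z ∈ D.support ∧ (∀ j, z ∈ dom (D.h j)) ∧ z ∈ dom (fun y => -D.g i y)}

/-- The effective support set `S̄ = ⋃ i, S̄_i`. -/
def effSupport : Set (EuclideanSpace ℝ (Fin d)) := ⋃ i, D.effSupportPiece i

/-- The ambiguity set: probability distributions supported on `S` that obey the moment bounds. -/
def ambiguitySet : Set (Measure (EuclideanSpace ℝ (Fin d))) :=
  {P | IsProbabilityMeasure P ∧ P D.supportᶜ = 0 ∧ ∀ j, expectTop P (D.h j) ≤ (D.mu j : EReal)}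

/-- Objective function of (P-UQ). -/
noncomputable def puqObj (P : Measure (EuclideanSpace ℝ (Fin d))) : EReal :=
  expectBot P D.disutility

/-- Constraints of (D-UQ) on `(α, β)`. -/
def duqSet : Set (ℝ × (J → ℝ)) :=
  {x | (⨆ z ∈ D.effSupport,
        (D.disutility z - (x.1 : EReal) - ∑ j, D.h j z * (x.2 j : EReal))) ≤ 0 ∧
      ∀ j, 0 ≤ x.2 j}

/-- Objective function `α + μᵀβ` of (D-UQ) and (AP-W). -/
noncomputable def duqObj (x : ℝ × (J → ℝ)) : EReal :=
  ((x.1 + ∑ j, D.mu j * x.2 j : ℝ) : EReal)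

/-- Constraints of (FR) on `(λ, z)`. -/
def frSet : Set ((I → ℝ) × (I → EuclideanSpace ℝ (Fin d))) :=
  {x | ∑ i, x.1 i = 1 ∧
      (∀ j, ∑ i, (x.1 i : EReal) * D.h j (x.2 i) ≤ (D.mu j : EReal)) ∧
      (∀ i, x.2 i ∈ D.effSupport) ∧ ∀ i, 0 ≤ x.1 i}

/-- Objective function of (FR). -/
noncomputable def frObj (x : (I → ℝ) × (I → EuclideanSpace ℝ (Fin d))) : EReal :=
  ∑ i, (x.1 i : EReal) * D.disutility (x.2 i)

/-- The augmented support set `U_i` of triples `(z, u, t)`. -/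
def augSupport (i : I) : Set (EuclideanSpace ℝ (Fin d) × (J → ℝ) × ℝ) :=
  {p | (∀ l, D.c l p.1 ≤ 0) ∧ (∀ j, D.h j p.1 ≤ (p.2.1 j : EReal)) ∧
      (p.2.2 : EReal) ≤ D.g i p.1}

/-- Constraints of (AP-W) on `(α, β)`. -/
def apwSet : Set (ℝ × (J → ℝ)) :=
  {x | (∀ i, (⨆ p ∈ D.augSupport i,
        ((p.2.2 - x.1 - ∑ j, p.2.1 j * x.2 j : ℝ) : EReal)) ≤ 0) ∧
      ∀ j, 0 ≤ x.2 j}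

/-- Constraints of (AD-B) on `(λ, {(z_i, u_i, t_i)}_i)`. -/
def adbSet : Set ((I → ℝ) × (I → EuclideanSpace ℝ (Fin d) × (J → ℝ) × ℝ)) :=
  {x | ∑ i, x.1 i = 1 ∧ (∀ j, ∑ i, x.1 i * (x.2 i).2.1 j ≤ D.mu j) ∧
      (∀ i, x.2 i ∈ D.augSupport i) ∧ ∀ i, 0 ≤ x.1 i}

/-- Objective function of (AD-B). -/
noncomputable def adbObj (_ : Data d I J L)
    (x : (I → ℝ) × (I → EuclideanSpace ℝ (Fin d) × (J → ℝ) × ℝ)) : EReal :=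
  ((∑ i, x.1 i * (x.2 i).2.2 : ℝ) : EReal)

end Data

/-! ### The finite convex program (AP-W') -/

/-- Decision variables `(α, β, y⁽⁰⁾, y⁽¹⁾, y⁽²⁾, ν)` of (AP-W'). -/
abbrev APWVar (d : ℕ) (I J L : Type*) :=
  ℝ × (J → ℝ) × (I → EuclideanSpace ℝ (Fin d)) × (I → J → EuclideanSpace ℝ (Fin d)) ×
    (I → L → EuclideanSpace ℝ (Fin d)) × (I → L → ℝ)

namespace APWVar

variable {d : ℕ} {I J L : Type*}

def alpha (x : APWVar d I J L) : ℝ := x.1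
def beta (x : APWVar d I J L) : J → ℝ := x.2.1
def y0 (x : APWVar d I J L) : I → EuclideanSpace ℝ (Fin d) := x.2.2.1
def y1 (x : APWVar d I J L) : I → J → EuclideanSpace ℝ (Fin d) := x.2.2.2.1
def y2 (x : APWVar d I J L) : I → L → EuclideanSpace ℝ (Fin d) := x.2.2.2.2.1
def nu (x : APWVar d I J L) : I → L → ℝ := x.2.2.2.2.2

end APWVar

/-- Names of the inequality constraints of (AP-W'). -/
inductive APWIneq (I J L : Type*)
  | piece (i : I)
  | betaSign (j : J)
  | nuSign (i : I) (l : L)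

/-! ### The finite convex program (AD-B') -/

/-- Decision variables `(τ, λ, ω, υ)` of (AD-B'). -/
abbrev ADBVar (d : ℕ) (I J : Type*) :=
  (I → ℝ) × (I → ℝ) × (I → J → ℝ) × (I → EuclideanSpace ℝ (Fin d))

namespace ADBVar

variable {d : ℕ} {I J : Type*}

def tau (x : ADBVar d I J) : I → ℝ := x.1
def lam (x : ADBVar d I J) : I → ℝ := x.2.1
def omega (x : ADBVar d I J) : I → J → ℝ := x.2.2.1
def ups (x : ADBVar d I J) : I → EuclideanSpace ℝ (Fin d) := x.2.2.2

end ADBVar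

/-- Names of the inequality constraints of (AD-B'). -/
inductive ADBIneq (I J L : Type*)
  | moment (j : J)
  | supp (i : I) (l : L)
  | momentPiece (i : I) (j : J)
  | disutilityPiece (i : I)
  | lamSign (i : I)

namespace Data

variable {d : ℕ} {I J L : Type*} [Fintype I] [Fintype J] [Fintype L] (D : Data d I J L)

/-- Inequality constraints of (AP-W'), each in the form `f(x) ≤ 0`. -/
noncomputable def apwIneq : APWIneq I J L → APWVar d I J L → EReal
  | .piece i, x =>
      conj (fun z => -D.g i z) (x.y0 i) + ∑ j, persp (conj (D.h j)) (x.y1 i j) (x.beta j)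
        + ∑ l, persp (conj (D.c l)) (x.y2 i l) (x.nu i l) - (x.alpha : EReal)
  | .betaSign j, x => ((-x.beta j : ℝ) : EReal)
  | .nuSign i l, x => ((-x.nu i l : ℝ) : EReal)

/-- Equality constraints of (AP-W'), one for every `i` and every coordinate `k` of `ℝ^d`. -/
noncomputable def apwEqn (_ : Data d I J L) (m : I × Fin d) (x : APWVar d I J L) : EReal :=
  (((x.y0 m.1 + ∑ j, x.y1 m.1 j + ∑ l, x.y2 m.1 l) m.2 : ℝ) : EReal)

/-- The constraints of (AP-W'). -/
noncomputable def apwConstraints : Constraints (APWVar d I J L) (APWIneq I J L) (I × Fin d) where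
  ground := {x | (∀ j, 0 ≤ x.beta j) ∧ ∀ i l, 0 ≤ x.nu i l}
  ineq := D.apwIneq
  eqn := D.apwEqn

/-- Objective function of (AP-W'). -/
noncomputable def apwCvxObj (x : APWVar d I J L) : EReal :=
  ((x.alpha + ∑ j, D.mu j * x.beta j : ℝ) : EReal)

/-- Inequality constraints of (AD-B'), each in the form `f(x) ≤ 0`. -/
noncomputable def adbIneq : ADBIneq I J L → ADBVar d I J → EReal
  | .moment j, x => ((∑ i, x.omega i j - D.mu j : ℝ) : EReal)
  | .supp i l, x => persp (D.c l) (x.ups i) (x.lam i)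
  | .momentPiece i j, x => persp (D.h j) (x.ups i) (x.lam i) - (x.omega i j : EReal)
  | .disutilityPiece i, x => (x.tau i : EReal) - concavePersp (D.g i) (x.ups i) (x.lam i)
  | .lamSign i, x => ((-x.lam i : ℝ) : EReal)

/-- The constraints of (AD-B'). -/
noncomputable def adbConstraints : Constraints (ADBVar d I J) (ADBIneq I J L) Unit where
  ground := {x | ∀ i, 0 ≤ x.lam i}
  ineq := D.adbIneq
  eqn := fun _ x => ((∑ i, x.lam i - 1 : ℝ) : EReal)

/-- Objective function of (AD-B'). -/
noncomputable def adbCvxObj (_ : Data d I J L) (x : ADBVar d I J) : EReal :=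
  ((∑ i, x.tau i : ℝ) : EReal)

/-- The discrete distribution that assigns probability `λ_i` to `υ_i / λ_i` for every `i` with
`λ_i > 0`. -/
noncomputable def discreteDist (_ : Data d I J L) (x : ADBVar d I J) :
    Measure (EuclideanSpace ℝ (Fin d)) :=
  ∑ i, if 0 < x.lam i then
    ENNReal.ofReal (x.lam i) • Measure.dirac ((x.lam i)⁻¹ • x.ups i) else 0

/-- The problems (AP-W'), (AP-W), (D-UQ), (P-UQ), (FR), (AD-B) and (AD-B') all have the same
optimal value. -/
def SameValues : Prop :=
  minValue D.apwConstraints.set D.apwCvxObj = minValue D.apwSet D.duqObj ∧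
  minValue D.apwSet D.duqObj = minValue D.duqSet D.duqObj ∧
  minValue D.duqSet D.duqObj = maxValue D.ambiguitySet D.puqObj ∧
  maxValue D.ambiguitySet D.puqObj = maxValue D.frSet D.frObj ∧
  maxValue D.frSet D.frObj = maxValue D.adbSet D.adbObj ∧
  maxValue D.adbSet D.adbObj = maxValue D.adbConstraints.set D.adbCvxObj

end Data

end UQ

/-! Weak duality holds without any Slater point. It gives the chain (AP-W') ≥ (AP-W) = (D-UQ) ≥
(P-UQ) ≥ (FR) ≥ (AD-B), together with (AD-B) ≤ (AD-B') ≤ (AP-W'). The ingredients are Fenchel's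
inequality for perspectives (`IsPCC.inner_le_of_persp_le`), monotonicity of the constraints in `u`
and `t`, integration of the dual constraint against a distribution (`Data.puqObj_le_duqObj`), and
the fact that a feasible point of (FR) is a finitely supported distribution. Hence all values agree
as soon as (AP-W') ≤ (AD-B), which is `Data.sameValues_of_le`.

This last inequality is Lagrangian duality between the two finite programs. The functions `-g_i`,
`h_j`, `c_ℓ` are treated alike, as blocks indexed by `i` and `Option (J ⊕ L)`. Every block receives
its own copy of the variables (vector, scale, level) in a convex set of perspective type, and linear
constraints glue the copies together. `exists_multipliers` asks only for a point of the algebraic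
relative interior of the convex set that satisfies the linear constraints, possibly with equality.
An affine block, for which Slater's condition gives no strict inequality, is modelled by the graph
of its perspective instead of the epigraph (`IsConicModel`).

The graph of a perspective is invariant under positive scaling. Testing the Lagrangian inequality on
it with an independent scale for each block therefore splits the inequality into one condition per
block, and that condition is exactly a bound on the perspective of the conjugate. So the multipliers
form an optimal point of the other program. For (i) this is `exists_conjugate_solution`; for (ii) it
is `exists_perspective_solution`, where the Fenchel–Moreau theorem leads from the conjugates back to
the original functions.

In (i) only points with positive scales enter, and these correspond directly to points of (AD-B). In
(ii) the solution of (AD-B') may have `λ_i = 0`. Then `υ_i` is a recession direction of `S`, so it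
vanishes when `S` is bounded; the piece contributes nothing, and the point descends to (AD-B), to
(FR) and to a discrete distribution. -/

namespace UQ

/-! ### Farkas' lemma and Lagrange multipliers for linear constraints on a convex set -/

section Multipliers

/-- **Farkas' lemma** for finitely many linear functionals on a real vector space. -/
theorem farkas {V κ : Type*} [AddCommGroup V] [Module ℝ V] (s : Finset κ) :
    ∀ (p : κ → V →ₗ[ℝ] ℝ) (l : V →ₗ[ℝ] ℝ), (∀ x, (∀ k ∈ s, p k x ≤ 0) → l x ≤ 0) →
      ∃ η : κ → ℝ, (∀ k, 0 ≤ η k) ∧ ∀ x, l x = ∑ k ∈ s, η k * p k x := by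
  classical
  induction s using Finset.induction_on with
  | empty =>
    intro p l h
    refine ⟨0, fun _ => le_rfl, fun x => ?_⟩
    have h1 := h x (by simp)
    have h2 := h (-x) (by simp)
    simp only [map_neg] at h2
    simp only [Finset.sum_empty]
    linarith
  | insert a s ha ih =>
    intro p l h
    by_cases hs : ∀ x, (∀ k ∈ s, p k x ≤ 0) → l x ≤ 0
    · obtain ⟨η, h0, hη⟩ := ih p l hs
      refine ⟨Function.update η a 0, fun k => ?_, fun x => ?_⟩
      · by_cases hk : k = a
        · subst hk; simp
        · simp [hk, h0]
      · rw [Finset.sum_insert ha, hη x]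
        simp only [Function.update_self, zero_mul, zero_add]
        refine Finset.sum_congr rfl fun k hk => ?_
        rw [Function.update_of_ne (ne_of_mem_of_not_mem hk ha)]
    · push Not at hs
      obtain ⟨x₁, hx₁, hl₁⟩ := hs
      have hp : 0 < p a x₁ := by
        by_contra hc
        exact absurd (h x₁ (by
          intro k hk
          rcases Finset.mem_insert.1 hk with rfl | hk
          · exact not_lt.1 hc
          · exact hx₁ k hk)) (not_le.2 hl₁)
      set x₀ := (p a x₁)⁻¹ • x₁ with hx₀
      have hpa : p a x₀ = 1 := by simp [hx₀, hp.ne']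
      have hl₀ : 0 < l x₀ := by simpa [hx₀] using mul_pos (inv_pos.2 hp) hl₁
      have hp₀ : ∀ k ∈ s, p k x₀ ≤ 0 := fun k hk => by
        simpa [hx₀] using mul_nonpos_of_nonneg_of_nonpos (inv_pos.2 hp).le (hx₁ k hk)
      -- These are the functionals composed with the projection `x ↦ x - p a x • x₀` onto the kernel
      -- of `p a`, where the constraint `a` holds with equality.
      obtain ⟨η, h0, hη⟩ := ih (fun k => p k - p k x₀ • p a) (l - l x₀ • p a) (fun x hx => by
        have := h (x - p a x • x₀) (by
          intro k hk
          rcases Finset.mem_insert.1 hk with rfl | hk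
          · simp [hpa]
          · have := hx k hk
            simp only [LinearMap.sub_apply, LinearMap.smul_apply, smul_eq_mul] at this
            simp only [map_sub, map_smul, smul_eq_mul]
            linarith)
        simp only [map_sub, map_smul, smul_eq_mul] at this
        simp only [LinearMap.sub_apply, LinearMap.smul_apply, smul_eq_mul]
        linarith)
      refine ⟨Function.update η a (l x₀ - ∑ k ∈ s, η k * p k x₀), fun k => ?_, fun x => ?_⟩
      · by_cases hk : k = a
        · subst hk
          simp only [Function.update_self]
          have : ∑ k ∈ s, η k * p k x₀ ≤ 0 :=
            Finset.sum_nonpos fun k hk => mul_nonpos_of_nonneg_of_nonpos (h0 k) (hp₀ k hk)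
          linarith
        · simp [hk, h0]
      · rw [Finset.sum_insert ha]
        have e : ∑ k ∈ s, Function.update η a (l x₀ - ∑ k ∈ s, η k * p k x₀) k * p k x
            = ∑ k ∈ s, η k * p k x := Finset.sum_congr rfl fun k hk => by
          rw [Function.update_of_ne (ne_of_mem_of_not_mem hk ha)]
        rw [e, Function.update_self]
        have := hη x
        simp only [LinearMap.sub_apply, LinearMap.smul_apply, smul_eq_mul, mul_sub,
          Finset.sum_sub_distrib] at this
        have e2 : ∑ k ∈ s, η k * (p k x₀ * p a x) = (∑ k ∈ s, η k * p k x₀) * p a x := by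
          rw [Finset.sum_mul]; exact Finset.sum_congr rfl fun _ _ => by ring
        rw [e2] at this
        linarith

/-- Affine form of Farkas' lemma for a consistent system of inequalities. -/
theorem farkas_affine {V κ : Type*} [AddCommGroup V] [Module ℝ V] [Fintype κ]
    (p : κ → V →ₗ[ℝ] ℝ) (a : κ → ℝ) (l : V →ₗ[ℝ] ℝ) (c : ℝ)
    (x₀ : V) (hx₀ : ∀ k, p k x₀ ≤ a k) (h : ∀ x, (∀ k, p k x ≤ a k) → l x ≤ c) :
    ∃ η : κ → ℝ, (∀ k, 0 ≤ η k) ∧ ∀ x, l x - c ≤ ∑ k, η k * (p k x - a k) := by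
  -- Homogenization: the extra variable `s` scales the constants, and the index `none` stands for `s
  -- ≥ 0`. Its multiplier is dropped at `s = 1`, so the conclusion is an inequality.
  let P : Option κ → (V × ℝ) →ₗ[ℝ] ℝ := fun o => o.elim (-LinearMap.snd ℝ V ℝ)
    (fun k => (p k).comp (LinearMap.fst ℝ V ℝ) - a k • LinearMap.snd ℝ V ℝ)
  obtain ⟨η, h0, hη⟩ := farkas Finset.univ P
    (l.comp (LinearMap.fst ℝ V ℝ) - c • LinearMap.snd ℝ V ℝ) (by
      rintro ⟨x, s⟩ hx
      have hs := hx none (Finset.mem_univ _)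
      have hk := fun k => hx (some k) (Finset.mem_univ _)
      simp only [Option.elim, LinearMap.neg_apply, LinearMap.snd_apply, LinearMap.sub_apply, P,
        LinearMap.comp_apply, LinearMap.fst_apply, LinearMap.smul_apply, smul_eq_mul] at hs hk ⊢
      rcases (show 0 ≤ s by linarith).eq_or_lt with h0 | h0
      -- At `s = 0` the vector `x` is a recession direction of the system; if `l` increased along
      -- it, a far point on the ray from `x₀` would violate the bound.
      · subst h0
        simp only [mul_zero, sub_zero] at hk ⊢
        by_contra hc
        push Not at hc
        obtain ⟨n, hn⟩ := exists_nat_gt ((c - l x₀) / l x)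
        rw [div_lt_iff₀ hc] at hn
        have := h (x₀ + (n : ℝ) • x) (fun k => by
          have := mul_nonneg (Nat.cast_nonneg (α := ℝ) n) (neg_nonneg.2 (hk k))
          simp only [map_add, map_smul, smul_eq_mul]
          linarith [hx₀ k])
        simp only [map_add, map_smul, smul_eq_mul] at this
        linarith
      · have := h (s⁻¹ • x) (fun k => by
          simp only [map_smul, smul_eq_mul]
          rw [inv_mul_le_iff₀ h0]
          linarith [hk k])
        simp only [map_smul, smul_eq_mul] at this
        rw [inv_mul_le_iff₀ h0] at this
        linarith)
  refine ⟨fun k => η (some k), fun k => h0 _, fun x => ?_⟩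
  have := hη (x, 1)
  simp only [Fintype.sum_option, Option.elim, LinearMap.neg_apply, LinearMap.snd_apply,
    LinearMap.sub_apply, P, LinearMap.comp_apply, LinearMap.fst_apply, LinearMap.smul_apply,
    smul_eq_mul, mul_one] at this
  have := h0 none
  linarith

/-- `x` lies in `C` and every segment from a point of `C` to `x` can be prolonged within `C`. -/
def IsCorePoint {V : Type*} [AddCommGroup V] [Module ℝ V] (C : Set V) (x : V) : Prop :=
  x ∈ C ∧ ∀ y ∈ C, ∃ ε : ℝ, 0 < ε ∧ x - ε • (y - x) ∈ C

variable {V : Type*} [NormedAddCommGroup V] [NormedSpace ℝ V]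

/-- A hyperplane separates the open region below the graph of `l - c` over the interior of `C` from
the polyhedron times `[0, ∞)`. The core point rules out a vertical hyperplane. On the polyhedral
side Farkas' lemma turns the bound into nonnegative multipliers, which is why the linear constraints
need not be strictly satisfied. -/
theorem exists_multipliers_of_interior_nonempty {κ : Type*} [Fintype κ] {C : Set V}
    (hC : Convex ℝ C) (hne : (interior C).Nonempty) (hcore : IsCorePoint C 0)
    (p : κ → V →ₗ[ℝ] ℝ) (a : κ → ℝ) (ha : ∀ k, 0 ≤ a k) (l : V →ₗ[ℝ] ℝ) (hl : Continuous l) (c : ℝ)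
    (h : ∀ x ∈ C, (∀ k, p k x ≤ a k) → l x ≤ c) :
    ∃ η : κ → ℝ, (∀ k, 0 ≤ η k) ∧ ∀ x ∈ C, l x - c ≤ ∑ k, η k * (p k x - a k) := by
  let s : Set (V × ℝ) := {q | q.1 ∈ interior C ∧ q.2 < l q.1 - c}
  let t : Set (V × ℝ) := {q | (∀ k, p k q.1 ≤ a k) ∧ 0 ≤ q.2}
  have hs₁ : Convex ℝ s := by
    rintro ⟨x, r⟩ ⟨hx, hr⟩ ⟨y, r'⟩ ⟨hy, hr'⟩ u v hu hv huv
    refine ⟨hC.interior hx hy hu hv huv, ?_⟩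
    simp only [Prod.fst_add, Prod.smul_fst, Prod.snd_add, Prod.smul_snd, map_add, map_smul,
      smul_eq_mul] at hr hr' ⊢
    have hc : c = u * c + v * c := by rw [← add_mul, huv, one_mul]
    rcases hu.eq_or_lt with h0 | h0
    · subst h0
      have : v = 1 := by linarith
      subst this; linarith
    · have h1 := mul_lt_mul_of_pos_left hr h0
      have h2 := mul_le_mul_of_nonneg_left hr'.le hv
      nlinarith
  have hs₂ : IsOpen s :=
    (isOpen_interior.preimage continuous_fst).inter
      (isOpen_lt continuous_snd ((hl.comp continuous_fst).sub continuous_const))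
  have ht : Convex ℝ t := by
    rintro ⟨x, r⟩ ⟨hx, hr⟩ ⟨y, r'⟩ ⟨hy, hr'⟩ u v hu hv huv
    refine ⟨fun k => ?_, ?_⟩
    · simp only [Prod.fst_add, Prod.smul_fst, map_add, map_smul, smul_eq_mul] at hx hy ⊢
      have h1 := mul_le_mul_of_nonneg_left (hx k) hu
      have h2 := mul_le_mul_of_nonneg_left (hy k) hv
      have : a k = u * a k + v * a k := by rw [← add_mul, huv, one_mul]
      linarith
    · simp only [Prod.snd_add, Prod.smul_snd, smul_eq_mul] at hr hr' ⊢
      positivity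
  have hst : Disjoint s t := by
    rw [Set.disjoint_left]
    rintro ⟨x, r⟩ ⟨hx, hr⟩ ⟨hk, h0⟩
    have := h x (interior_subset hx) hk
    simp only at hr h0
    linarith
  obtain ⟨f, u, hfs, hft⟩ := geometric_hahn_banach_open hs₁ hs₂ ht hst
  let g : V →ₗ[ℝ] ℝ := f.toLinearMap.comp (LinearMap.inl ℝ V ℝ)
  set b : ℝ := f (0, 1) with hb
  have hf : ∀ x r, f (x, r) = g x + b * r := fun x r => by
    have : ((x, r) : V × ℝ) = (x, 0) + r • ((0, 1) : V × ℝ) := by simp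
    rw [this, map_add, map_smul, smul_eq_mul, mul_comm]; rfl
  have hgc : Continuous g := f.continuous.comp (continuous_id.prodMk continuous_const)
  have hb0 : 0 ≤ b := by
    by_contra hc
    push Not at hc
    -- At this height `b` times the second coordinate equals `-|u| + b`, which is less than `u` if
    -- `b < 0`.
    have h1 := hft (0, |u| / (-b) + 1) ⟨by simpa using ha, by
      have : 0 ≤ |u| / (-b) := div_nonneg (abs_nonneg _) (by linarith)
      simp only; linarith⟩
    rw [hf] at h1
    simp only [map_zero, zero_add] at h1
    have : b * (|u| / (-b) + 1) = -|u| + b := by field_simp [hc.ne]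
    rw [this] at h1
    linarith [neg_abs_le u]
  have hint : ∀ x ∈ interior C, g x + b * (l x - c) ≤ u := fun x hx => by
    refine le_of_forall_pos_lt_add fun ε hε => ?_
    have h1 := hfs (x, l x - c - ε / (b + 1)) ⟨hx, by
      have : 0 < ε / (b + 1) := by positivity
      simp only; linarith⟩
    rw [hf, mul_sub] at h1
    have : b * (ε / (b + 1)) < ε := by
      rw [mul_div_assoc', div_lt_iff₀ (by linarith)]; nlinarith
    linarith
  have hall : ∀ x ∈ C, g x + b * (l x - c) ≤ u := fun x hx => by
    have : C ⊆ {x | g x + b * (l x - c) ≤ u} := by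
      refine subset_closure.trans ?_
      rw [← hC.closure_interior_eq_closure_of_nonempty_interior hne]
      exact closure_minimal hint (isClosed_le
        (hgc.add (continuous_const.mul (hl.sub continuous_const))) continuous_const)
    exact this hx
  have hg : ∀ x, (∀ k, p k x ≤ a k) → (-g) x ≤ -u := fun x hx => by
    have := hft (x, 0) ⟨hx, le_rfl⟩
    rw [hf] at this
    simp only [LinearMap.neg_apply]
    linarith
  have h0 : ∀ k, p k 0 ≤ a k := by simpa using ha
  rcases hb0.eq_or_lt with hb0 | hb0
  -- Vertical case: `g x < u ≤ 0` at an interior point `x`, but prolonging the segment from `x`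
  -- through `0` inside `C` reaches a point where `g` is positive.
  · exfalso
    obtain ⟨x, hx⟩ := hne
    have h1 := hfs (x, l x - c - 1) ⟨hx, by simp⟩
    rw [hf, ← hb0, zero_mul, add_zero] at h1
    have h2 := hg 0 h0
    simp only [map_zero] at h2
    obtain ⟨ε, hε, h3⟩ := hcore.2 x (interior_subset hx)
    have h4 := hall _ h3
    rw [← hb0] at h4
    simp only [sub_zero, zero_sub, map_neg, map_smul, smul_eq_mul, zero_mul, add_zero] at h4
    nlinarith
  · obtain ⟨η, hη0, hη⟩ := farkas_affine p a (-g) (-u) 0 h0 hg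
    refine ⟨fun k => b⁻¹ * η k, fun k => mul_nonneg (inv_pos.2 hb0).le (hη0 k), fun x hx => ?_⟩
    have h1 := hη x
    have h2 := hall x hx
    simp only [LinearMap.neg_apply] at h1
    simp only [mul_assoc]
    rw [← Finset.mul_sum, ← div_eq_inv_mul, le_div_iff₀ hb0]
    linarith

/-- Existence of Lagrange multipliers for finitely many linear constraints on a convex set that
are satisfied by some point of its relative interior. -/
theorem exists_multipliers [FiniteDimensional ℝ V] {κ : Type*} [Fintype κ] {C : Set V}
    (hC : Convex ℝ C) {x₀ : V} (hcore : IsCorePoint C x₀)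
    (p : κ → V →ₗ[ℝ] ℝ) (a : κ → ℝ) (ha : ∀ k, p k x₀ ≤ a k) (l : V →ₗ[ℝ] ℝ) (c : ℝ)
    (h : ∀ x ∈ C, (∀ k, p k x ≤ a k) → l x ≤ c) :
    ∃ η : κ → ℝ, (∀ k, 0 ≤ η k) ∧ ∀ x ∈ C, l x - c ≤ ∑ k, η k * (p k x - a k) := by
  -- Inside the span of `C - x₀` the translated set has nonempty interior.
  let W : Submodule ℝ V := Submodule.span ℝ ((fun x => x - x₀) '' C)
  let C' : Set W := {w | x₀ + w ∈ C}
  have hC' : Convex ℝ C' := by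
    intro x hx y hy u v hu hv huv
    have := hC hx hy hu hv huv
    have e : u • (x₀ + (x : V)) + v • (x₀ + (y : V)) = x₀ + ((u • x + v • y : W) : V) := by
      have : x₀ = u • x₀ + v • x₀ := by rw [← add_smul, huv, one_smul]
      simp only [Submodule.coe_add, Submodule.coe_smul, smul_add]
      nth_rewrite 3 [this]
      abel
    rw [e] at this
    exact this
  have h0 : (0 : W) ∈ C' := by simpa [C'] using hcore.1
  have himg : ((↑) : W → V) ⁻¹' ((fun x => x - x₀) '' C) = C' := by
    ext w
    constructor
    · rintro ⟨x, hx, hxw⟩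
      simp only at hxw
      simp only [C', Set.mem_ofPred_eq, ← hxw, add_sub_cancel]
      exact hx
    · intro hw
      exact ⟨_, hw, by simp⟩
  have hspan : Submodule.span ℝ C' = ⊤ := by
    rw [← himg]
    exact Submodule.span_span_coe_preimage
  have hne : (interior C').Nonempty := by
    rw [hC'.interior_nonempty_iff_affineSpan_eq_top,
      AffineSubspace.affineSpan_eq_top_iff_vectorSpan_eq_top_of_nonempty _ _ _ ⟨0, h0⟩,
      vectorSpan_eq_span_vsub_set_right ℝ h0]
    simpa using hspan
  obtain ⟨η, hη0, hη⟩ := exists_multipliers_of_interior_nonempty hC' hne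
    ⟨h0, fun w hw => by
      obtain ⟨ε, hε, h1⟩ := hcore.2 _ hw
      refine ⟨ε, hε, ?_⟩
      simpa [C', sub_eq_add_neg] using h1⟩
    (fun k => (p k).comp W.subtype) (fun k => a k - p k x₀) (fun k => by simpa using ha k)
    (l.comp W.subtype) (LinearMap.continuous_of_finiteDimensional _) (c - l x₀)
    (fun w hw hk => by
      have := h _ hw (fun k => by
        have := hk k
        simp only [LinearMap.comp_apply, Submodule.subtype_apply] at this
        rw [map_add]; linarith)
      rw [map_add] at this
      simp only [LinearMap.comp_apply, Submodule.subtype_apply]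
      linarith)
  refine ⟨η, hη0, fun x hx => ?_⟩
  have := hη ⟨x - x₀, Submodule.subset_span ⟨x, hx, rfl⟩⟩ (by simpa [C'] using hx)
  simp only [LinearMap.comp_apply, Submodule.subtype_apply, map_sub] at this
  convert this using 1
  · ring
  · exact Finset.sum_congr rfl fun k _ => by ring

/-- Existence of Lagrange multipliers for linear inequalities, scalar linear equations and
vector-valued linear equations on a convex set. -/
theorem exists_multipliers_eq [FiniteDimensional ℝ V] {κ κ' κ'' : Type*} [Fintype κ] [Fintype κ']
    [Fintype κ''] {d : ℕ} {C : Set V} (hC : Convex ℝ C) {x₀ : V} (hcore : IsCorePoint C x₀)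
    {p : κ → V → ℝ} (hp : ∀ k, IsLinearMap ℝ (p k)) {a : κ → ℝ} (ha : ∀ k, p k x₀ ≤ a k)
    {q : κ' → V → ℝ} (hq : ∀ k, IsLinearMap ℝ (q k)) {b : κ' → ℝ} (hb : ∀ k, q k x₀ = b k)
    {T : κ'' → V → EuclideanSpace ℝ (Fin d)} (hT : ∀ k, IsLinearMap ℝ (T k))
    (hT0 : ∀ k, T k x₀ = 0)
    {l : V → ℝ} (hl : IsLinearMap ℝ l) {c : ℝ}
    (h : ∀ x ∈ C, (∀ k, p k x ≤ a k) → (∀ k, q k x = b k) → (∀ k, T k x = 0) → l x ≤ c) :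
    ∃ (η : κ → ℝ) (θ : κ' → ℝ) (y : κ'' → EuclideanSpace ℝ (Fin d)), (∀ k, 0 ≤ η k) ∧
      ∀ x ∈ C, l x - c ≤ ∑ k, η k * (p k x - a k) + ∑ k, θ k * (q k x - b k)
        + ∑ k, inner ℝ (T k x) (y k) := by
  -- Equations become pairs of opposite inequalities, vector equations coordinatewise; differences
  -- of the two multipliers have free sign.
  let Tc : κ'' × Fin d → V →ₗ[ℝ] ℝ := fun m =>
    { toFun := fun x => T m.1 x m.2
      map_add' := fun x y => by rw [(hT _).map_add]; rfl
      map_smul' := fun r x => by rw [(hT _).map_smul]; rfl }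
  let P : κ ⊕ (κ' ⊕ κ') ⊕ ((κ'' × Fin d) ⊕ (κ'' × Fin d)) → V →ₗ[ℝ] ℝ :=
    Sum.elim (fun k => (hp k).mk') (Sum.elim
      (Sum.elim (fun k => (hq k).mk') (fun k => -(hq k).mk'))
      (Sum.elim Tc (fun k => -Tc k)))
  let A : κ ⊕ (κ' ⊕ κ') ⊕ ((κ'' × Fin d) ⊕ (κ'' × Fin d)) → ℝ :=
    Sum.elim a (Sum.elim (Sum.elim b (fun k => -b k)) (fun _ => 0))
  obtain ⟨η, hη0, hη⟩ := exists_multipliers hC hcore P A (by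
      rintro (k | (k | k) | (k | k))
      · exact ha k
      · exact (hb k).le
      · exact neg_le_neg (hb k).ge
      · simp [P, A, Tc, hT0]
      · simp [P, A, Tc, hT0]) hl.mk' c (fun x hx hk => by
        refine h x hx (fun k => hk (.inl k)) (fun k => le_antisymm (hk (.inr (.inl (.inl k)))) ?_)
          fun k => ?_
        · exact neg_le_neg_iff.1 (hk (.inr (.inl (.inr k))))
        · ext i
          have h1 := hk (.inr (.inr (.inl (k, i))))
          have h2 := hk (.inr (.inr (.inr (k, i))))
          simp only [P, A, Tc, Sum.elim_inr, Sum.elim_inl, LinearMap.coe_mk, AddHom.coe_mk,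
            LinearMap.neg_apply, Left.neg_nonpos_iff] at h1 h2
          exact le_antisymm h1 h2)
  refine ⟨fun k => η (.inl k), fun k => η (.inr (.inl (.inl k))) - η (.inr (.inl (.inr k))),
    fun k => WithLp.toLp 2 fun i => η (.inr (.inr (.inl (k, i)))) - η (.inr (.inr (.inr (k, i)))),
    fun k => hη0 _, fun x hx => (hη x hx).trans_eq ?_⟩
  simp only [Fintype.sum_sum_type, P, A, Tc, Sum.elim_inr, Sum.elim_inl, LinearMap.neg_apply,
    IsLinearMap.mk'_apply, LinearMap.coe_mk, AddHom.coe_mk, Fintype.sum_prod_type,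
    PiLp.inner_apply, sub_zero]
  have e₁ : ∀ (u v : κ' → ℝ) (w : κ' → ℝ), ∑ k, u k * w k + ∑ k, v k * -w k
      = ∑ k, (u k - v k) * w k := fun u v w => by
    rw [← Finset.sum_add_distrib]
    exact Finset.sum_congr rfl fun k _ => by ring
  have e₂ : ∀ (u v w : κ'' → Fin d → ℝ), ∑ k, ∑ i, u k i * w k i + ∑ k, ∑ i, v k i * -w k i
      = ∑ k, ∑ i, inner ℝ (w k i) (u k i - v k i) := fun u v w => by
    rw [← Finset.sum_add_distrib]
    refine Finset.sum_congr rfl fun k _ => ?_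
    rw [← Finset.sum_add_distrib]
    refine Finset.sum_congr rfl fun i _ => ?_
    simp only [RCLike.inner_apply, conj_trivial]
    ring
  rw [← e₁, ← e₂, ← add_assoc]
  simp only [neg_sub, mul_neg, neg_sub_neg, add_assoc]

end Multipliers

end UQ

namespace UQ

/-! ### Conjugates, the Fenchel–Moreau theorem and perspectives -/

section ConvexFunctions

variable {d : ℕ} {f : EuclideanSpace ℝ (Fin d) → EReal}

theorem IsProper.exists_real {X : Type*} {f : X → EReal} (hf : IsProper f) {x : X}
    (hx : x ∈ dom f) : ∃ r : ℝ, f x = r :=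
  ⟨(f x).toReal, (EReal.coe_toReal (ne_of_lt hx) (hf.1 x).ne').symm⟩

theorem IsConvexFun.le_combo {X : Type*} [AddCommGroup X] [Module ℝ X] {f : X → EReal}
    (hf : IsConvexFun f) {x y : X} {r s a b : ℝ} (hx : f x ≤ r) (hy : f y ≤ s) (ha : 0 ≤ a)
    (hb : 0 ≤ b) (hab : a + b = 1) : f (a • x + b • y) ≤ ((a * r + b * s : ℝ) : EReal) :=
  hf (x := (x, r)) hx (y := (y, s)) hy ha hb hab

theorem conj_le_coe_iff {w : EuclideanSpace ℝ (Fin d)} {r : ℝ} :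
    conj f w ≤ r ↔ ∀ x, ((inner ℝ x w - r : ℝ) : EReal) ≤ f x := by
  rw [conj, iSup_le_iff]
  refine forall_congr' fun x => ?_
  induction f x using EReal.rec with
  | bot => simp [-EReal.coe_sub]
  | top => simp
  | coe t => norm_cast; constructor <;> intro h <;> linarith

theorem inner_le_of_conj_le {w x : EuclideanSpace ℝ (Fin d)} {r s : ℝ} (hw : conj f w ≤ r)
    (hx : f x ≤ s) : inner ℝ x w ≤ r + s := by
  have := (conj_le_coe_iff.1 hw x).trans hx
  norm_cast at this
  linarith

/-- The real epigraph is closed and convex and misses `(x₀, r)`, so strict separation applies. The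
vertical coefficient `b` cannot be positive because the epigraph is unbounded upwards. -/
theorem IsPCC.exists_separation (hf : IsPCC f) {x₀ : EuclideanSpace ℝ (Fin d)} {r : ℝ}
    (h : (r : EReal) < f x₀) : ∃ (w : EuclideanSpace ℝ (Fin d)) (b u : ℝ), b ≤ 0 ∧
      (∀ x (s : ℝ), f x ≤ s → inner ℝ x w + b * s < u) ∧ u < inner ℝ x₀ w + b * r := by
  have hcl : IsClosed (epigraph f) := by
    have h1 := lowerSemicontinuous_iff_isClosed_epigraph.1 hf.closed.1
    exact h1.preimage (continuous_fst.prodMk (continuous_coe_real_ereal.comp continuous_snd))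
  obtain ⟨F, u, hF, hu⟩ := geometric_hahn_banach_closed_point (x := (x₀, r)) hf.convex hcl
    (not_le.2 h)
  set w := (InnerProductSpace.toDual ℝ _).symm (F.comp (ContinuousLinearMap.inl ℝ _ ℝ)) with hw
  have hFe : ∀ x s, F (x, s) = inner ℝ x w + F (0, 1) * s := fun x s => by
    have h1 : ((x, s) : EuclideanSpace ℝ (Fin d) × ℝ) = (x, 0) + s • (0, 1) := by simp
    rw [h1, map_add, map_smul, smul_eq_mul, mul_comm, real_inner_comm, hw,
      InnerProductSpace.toDual_symm_apply]
    rfl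
  have hF' : ∀ x (s : ℝ), f x ≤ s → inner ℝ x w + F (0, 1) * s < u := fun x s hx => by
    rw [← hFe]; exact hF (x, s) hx
  refine ⟨w, F (0, 1), u, ?_, hF', by rwa [← hFe]⟩
  by_contra hb
  push Not at hb
  obtain ⟨x₁, hx₁⟩ := hf.proper.2
  obtain ⟨s, hs⟩ := hf.proper.exists_real hx₁
  have h1 := hF' x₁ (s + |u - inner ℝ x₁ w - F (0, 1) * s| / F (0, 1)) (by
    rw [hs]; norm_cast
    have : 0 ≤ |u - inner ℝ x₁ w - F (0, 1) * s| / F (0, 1) := by positivity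
    linarith)
  rw [mul_add, mul_div_cancel₀ _ hb.ne'] at h1
  linarith [le_abs_self (u - inner ℝ x₁ w - F (0, 1) * s)]

/-- A non-vertical separating hyperplane, divided by `-b`, is the graph of an affine minorant of `f`
that exceeds `r` at `x₀`. -/
theorem exists_conj_le_of_separation {x₀ w : EuclideanSpace ℝ (Fin d)} {b u r : ℝ} (hb : b < 0)
    (hbot : ∀ x, ⊥ < f x) (h : ∀ x (s : ℝ), f x ≤ s → inner ℝ x w + b * s < u)
    (h₀ : u < inner ℝ x₀ w + b * r) :
    ∃ (w' : EuclideanSpace ℝ (Fin d)) (c : ℝ), conj f w' ≤ c ∧ r < inner ℝ x₀ w' - c := by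
  refine ⟨(-b)⁻¹ • w, (-b)⁻¹ * u, conj_le_coe_iff.2 fun x => ?_, ?_⟩
  · rw [inner_smul_right, ← mul_sub]
    induction hfx : f x using EReal.rec with
    | bot => exact absurd hfx (hbot x).ne'
    | top => exact le_top
    | coe s =>
      have := h x s hfx.le
      norm_cast
      rw [inv_mul_le_iff₀ (by linarith)]
      linarith
  · rw [inner_smul_right, ← mul_sub, lt_inv_mul_iff₀ (by linarith)]
    linarith

/-- Separating a point just below the graph at a point of the domain cannot use a vertical
hyperplane, so an affine minorant exists. -/
theorem IsPCC.exists_conj_le (hf : IsPCC f) :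
    ∃ (w : EuclideanSpace ℝ (Fin d)) (c : ℝ), conj f w ≤ c := by
  obtain ⟨x₁, hx₁⟩ := hf.proper.2
  obtain ⟨s, hs⟩ := hf.proper.exists_real hx₁
  obtain ⟨w, b, u, hb, h, h₀⟩ := hf.exists_separation (x₀ := x₁) (r := s - 1) (by
    rw [hs]; norm_cast; linarith)
  have h1 := h x₁ s hs.le
  obtain ⟨w', c, hw', -⟩ := exists_conj_le_of_separation (b := b) (by
    rcases hb.eq_or_lt with rfl | hb
    · linarith
    · exact hb) hf.proper.1 h h₀
  exact ⟨w', c, hw'⟩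

/-- If the separating hyperplane is vertical, a large multiple of it is added to any affine
minorant: this only lowers the minorant on the domain and raises it at `x₀`. -/
theorem IsPCC.exists_conj_le_of_lt (hf : IsPCC f) {x₀ : EuclideanSpace ℝ (Fin d)} {r : ℝ}
    (hr : (r : EReal) < f x₀) :
    ∃ (w : EuclideanSpace ℝ (Fin d)) (c : ℝ), conj f w ≤ c ∧ r < inner ℝ x₀ w - c := by
  obtain ⟨w, b, u, hb, h, h₀⟩ := hf.exists_separation hr
  rcases hb.eq_or_lt with rfl | hb
  · obtain ⟨w₁, c₁, h₁⟩ := hf.exists_conj_le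
    simp only [zero_mul, add_zero] at h h₀
    -- The multiple for which the gain at `x₀` exceeds by at least `1` what the minorant `(w₁, c₁)`
    -- lacks to reach `r` there.
    set t : ℝ := (|r - inner ℝ x₀ w₁ + c₁| + 1) / (inner ℝ x₀ w - u) with ht
    have hpos : 0 < inner ℝ x₀ w - u := by linarith
    have ht0 : 0 ≤ t := by positivity
    refine ⟨w₁ + t • w, c₁ + t * u, conj_le_coe_iff.2 fun x => ?_, ?_⟩
    · induction hfx : f x using EReal.rec with
      | bot => exact absurd hfx (hf.proper.1 x).ne'
      | top => exact le_top
      | coe s =>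
        have h2 := inner_le_of_conj_le h₁ hfx.le
        have h3 := h x s hfx.le
        norm_cast
        rw [inner_add_right, inner_smul_right]
        nlinarith
    · rw [inner_add_right, inner_smul_right]
      have : t * (inner ℝ x₀ w - u) = |r - inner ℝ x₀ w₁ + c₁| + 1 := div_mul_cancel₀ _ hpos.ne'
      have := le_abs_self (r - inner ℝ x₀ w₁ + c₁)
      linarith
  · exact exists_conj_le_of_separation hb hf.proper.1 h h₀

/-- **Fenchel–Moreau theorem**, in the direction that is not formal. -/
theorem IsPCC.le_of_conj_conj_le (hf : IsPCC f) {x : EuclideanSpace ℝ (Fin d)} {r : ℝ}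
    (h : conj (conj f) x ≤ r) : f x ≤ r := by
  by_contra hc
  push Not at hc
  obtain ⟨w, c, hw, hr⟩ := hf.exists_conj_le_of_lt hc
  have := inner_le_of_conj_le h hw
  rw [real_inner_comm] at this
  linarith

theorem conj_conj_le {x : EuclideanSpace ℝ (Fin d)} {r : ℝ} (h : f x ≤ r) :
    conj (conj f) x ≤ r := by
  rw [conj_le_coe_iff]
  intro w
  rw [real_inner_comm]
  refine le_trans ?_ (le_iSup (fun x => ((inner ℝ x w : ℝ) : EReal) - f x) x)
  rw [EReal.coe_sub]
  exact EReal.sub_le_sub le_rfl h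

theorem IsPCC.isProper_conj (hf : IsPCC f) : IsProper (conj f) := by
  refine ⟨fun w => ?_, ?_⟩
  · obtain ⟨x, hx⟩ := hf.proper.2
    obtain ⟨s, hs⟩ := hf.proper.exists_real hx
    refine lt_of_lt_of_le ?_ (le_iSup _ x)
    rw [hs, ← EReal.coe_sub]
    exact EReal.bot_lt_coe _
  · obtain ⟨w, c, h⟩ := hf.exists_conj_le
    exact ⟨w, h.trans_lt (EReal.coe_lt_top c)⟩

theorem isConvexFun_conj : IsConvexFun (conj f) := by
  rintro ⟨x, r⟩ hx ⟨y, s⟩ hy a b ha hb hab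
  refine conj_le_coe_iff.2 fun z => ?_
  have h1 := conj_le_coe_iff.1 hx z
  have h2 := conj_le_coe_iff.1 hy z
  induction hfz : f z using EReal.rec with
  | bot => rw [hfz] at h1; exact absurd h1 (not_le.2 (EReal.bot_lt_coe _))
  | top => exact le_top
  | coe t =>
    rw [hfz] at h1 h2
    norm_cast at h1 h2 ⊢
    simp only [Prod.fst_add, Prod.smul_fst, Prod.snd_add, Prod.smul_snd, inner_add_right,
      inner_smul_right, smul_eq_mul] at h1 h2 ⊢
    have h3 := mul_le_mul_of_nonneg_left h1 ha
    have h4 := mul_le_mul_of_nonneg_left h2 hb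
    have : t = a * t + b * t := by rw [← add_mul, hab, one_mul]
    linarith

theorem supportFun_le_coe_iff {A : Set (EuclideanSpace ℝ (Fin d))}
    {w : EuclideanSpace ℝ (Fin d)} {r : ℝ} :
    supportFun A w ≤ r ↔ ∀ x ∈ A, inner ℝ x w ≤ r := by
  simp [supportFun]

theorem coe_pos_mul_le_iff {t r : ℝ} (ht : 0 < t) {x : EReal} :
    (t : EReal) * x ≤ r ↔ x ≤ ((r / t : ℝ) : EReal) := by
  induction x using EReal.rec with
  | bot => simp [EReal.coe_mul_bot_of_pos ht]
  | top => simp only [EReal.coe_mul_top_of_pos ht, top_le_iff, EReal.coe_ne_top]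
  | coe s => norm_cast; rw [le_div_iff₀ ht, mul_comm]

theorem persp_le_iff_of_pos {x : EuclideanSpace ℝ (Fin d)} {t r : ℝ} (ht : 0 < t) :
    persp f x t ≤ r ↔ f (t⁻¹ • x) ≤ ((r / t : ℝ) : EReal) := by
  rw [persp, if_pos ht, coe_pos_mul_le_iff ht]

theorem persp_zero_le_iff {x : EuclideanSpace ℝ (Fin d)} {r : ℝ} :
    persp f x 0 ≤ r ↔ ∀ w ∈ dom (conj f), inner ℝ w x ≤ r := by
  rw [persp, if_neg (lt_irrefl _), if_pos rfl, supportFun_le_coe_iff]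

theorem persp_one (x : EuclideanSpace ℝ (Fin d)) : persp f x 1 = f x := by
  simp [persp]

theorem nonneg_of_persp_lt_top {x : EuclideanSpace ℝ (Fin d)} {t : ℝ} (h : persp f x t < ⊤) :
    0 ≤ t := by
  by_contra hc
  push Not at hc
  rw [persp, if_neg hc.le.not_gt, if_neg hc.ne] at h
  exact lt_irrefl _ h

theorem bot_lt_persp (hf : ∀ x, ⊥ < f x) (hd : (dom (conj f)).Nonempty)
    (x : EuclideanSpace ℝ (Fin d)) (t : ℝ) : ⊥ < persp f x t := by
  unfold persp
  split_ifs with h1 h2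
  · induction h : f (t⁻¹ • x) using EReal.rec with
    | bot => exact absurd h (hf _).ne'
    | top => simp [EReal.coe_mul_top_of_pos h1]
    | coe s => norm_cast; exact EReal.bot_lt_coe _
  · obtain ⟨w, hw⟩ := hd
    exact lt_of_lt_of_le (EReal.bot_lt_coe _) (le_iSup₂ (f := fun x₁ (_ : x₁ ∈ dom (conj f)) =>
      ((inner ℝ x₁ x : ℝ) : EReal)) w hw)
  · exact bot_lt_top

theorem IsPCC.nonempty_dom_conj_conj (hf : IsPCC f) : (dom (conj (conj f))).Nonempty := by
  obtain ⟨x, hx⟩ := hf.proper.2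
  obtain ⟨s, hs⟩ := hf.proper.exists_real hx
  exact ⟨x, (conj_conj_le hs.le).trans_lt (EReal.coe_lt_top _)⟩

theorem IsPCC.bot_lt_persp_conj (hf : IsPCC f) (x : EuclideanSpace ℝ (Fin d)) (t : ℝ) :
    ⊥ < persp (conj f) x t :=
  UQ.bot_lt_persp hf.isProper_conj.1 hf.nonempty_dom_conj_conj x t

/-- The perspective at scale `0` is the recession function: it bounds the slope along `v` of every
affine minorant, hence by Fenchel–Moreau the growth of `f` itself. -/
theorem IsPCC.le_add_smul (hf : IsPCC f) {z v : EuclideanSpace ℝ (Fin d)} {r s t : ℝ}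
    (hz : f z ≤ r) (hv : persp f v 0 ≤ s) (ht : 0 ≤ t) :
    f (z + t • v) ≤ ((r + t * s : ℝ) : EReal) := by
  refine hf.le_of_conj_conj_le (conj_le_coe_iff.2 fun w => ?_)
  induction hw : conj f w using EReal.rec with
  | bot => exact absurd hw (hf.isProper_conj.1 w).ne'
  | top => exact le_top
  | coe c =>
    have h1 := inner_le_of_conj_le hw.le hz
    have h2 := persp_zero_le_iff.1 hv w (by rw [dom, Set.mem_ofPred_eq, hw]; exact EReal.coe_lt_top c)
    norm_cast
    rw [inner_add_right, inner_smul_right, real_inner_comm w z] at *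
    nlinarith

/-- Fenchel's inequality for the perspectives of a function and of its conjugate. -/
theorem IsPCC.inner_le_of_persp_le (hf : IsPCC f) {v y : EuclideanSpace ℝ (Fin d)}
    {t s R ρ : ℝ} (h₁ : persp f v t ≤ R) (h₂ : persp (conj f) y s ≤ ρ) :
    inner ℝ v y ≤ s * R + t * ρ := by
  have ht := nonneg_of_persp_lt_top (h₁.trans_lt (EReal.coe_lt_top _))
  have hs := nonneg_of_persp_lt_top (h₂.trans_lt (EReal.coe_lt_top _))
  rcases ht.eq_or_lt with rfl | ht
  · rcases hs.eq_or_lt with rfl | hs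
    -- With both scales `0`, the points `z + n • v` stay in the domain of `f`, on which `y` is
    -- bounded by `ρ`; this forces `inner ℝ v y ≤ 0`.
    · rw [zero_mul, zero_mul, add_zero]
      obtain ⟨z, hz⟩ := hf.proper.2
      obtain ⟨r, hr⟩ := hf.proper.exists_real hz
      by_contra hc
      push Not at hc
      obtain ⟨n, hn⟩ := exists_nat_gt ((ρ - inner ℝ z y) / inner ℝ v y)
      rw [div_lt_iff₀ hc] at hn
      have h3 := conj_conj_le (hf.le_add_smul hr.le h₁ (Nat.cast_nonneg n))
      have h4 := persp_zero_le_iff.1 h₂ _ (h3.trans_lt (EReal.coe_lt_top _))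
      rw [inner_add_left, real_inner_smul_left] at h4
      linarith
    · rw [persp_le_iff_of_pos hs] at h₂
      have := persp_zero_le_iff.1 h₁ _ (h₂.trans_lt (EReal.coe_lt_top _))
      rw [real_inner_smul_left, inv_mul_le_iff₀ hs, real_inner_comm] at this
      linarith
  · rw [persp_le_iff_of_pos ht] at h₁
    rcases hs.eq_or_lt with rfl | hs
    · have := persp_zero_le_iff.1 h₂ _ ((conj_conj_le h₁).trans_lt (EReal.coe_lt_top _))
      rw [real_inner_smul_left, inv_mul_le_iff₀ ht] at this
      linarith
    · rw [persp_le_iff_of_pos hs] at h₂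
      have := inner_le_of_conj_le h₂ h₁
      rw [real_inner_smul_left, real_inner_smul_right, inv_mul_le_iff₀ ht, inv_mul_le_iff₀ hs] at this
      refine this.trans_eq ?_
      field_simp
      ring

/-- The line through `x` and `y` lies in the affine span of `C`, in which `C` is a neighbourhood of
`x`. This turns topological Slater points into algebraic core points. -/
theorem exists_pos_of_mem_intrinsicInterior {X : Type*} [NormedAddCommGroup X] [NormedSpace ℝ X]
    {C : Set X} {x y : X} (hx : x ∈ intrinsicInterior ℝ C) (hy : y ∈ C) :
    ∃ ε : ℝ, 0 < ε ∧ x - ε • (y - x) ∈ C := by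
  obtain ⟨⟨x', hx'⟩, hi, rfl⟩ := mem_intrinsicInterior.1 hx
  let γ : ℝ → affineSpan ℝ C := fun ε => ⟨AffineMap.lineMap x' y (-ε),
    AffineMap.lineMap_mem _ hx' (subset_affineSpan ℝ C hy)⟩
  have hγ : Continuous γ := by
    refine Continuous.subtype_mk ?_ _
    simp only [AffineMap.lineMap_apply]
    fun_prop
  have h0 : γ 0 = ⟨x', hx'⟩ := by simp [γ]
  have hmem : γ ⁻¹' ((↑) ⁻¹' C) ∈ nhds (0 : ℝ) :=
    hγ.continuousAt (by rw [h0]; exact mem_interior_iff_mem_nhds.1 hi)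
  obtain ⟨δ, hδ, hball⟩ := Metric.mem_nhds_iff.1 hmem
  refine ⟨δ / 2, by positivity, ?_⟩
  have : δ / 2 ∈ Metric.ball (0 : ℝ) δ := by
    rw [Metric.mem_ball, dist_zero_right, Real.norm_of_nonneg (by positivity)]
    linarith
  have := hball this
  simp only [γ, Set.mem_preimage, AffineMap.lineMap_apply, vsub_eq_sub, vadd_eq_add] at this
  convert this using 1
  simp only [neg_smul]
  abel

end ConvexFunctions

end UQ

namespace UQ

/-! ### Convex sets that model perspectives, and tests for bounds on perspectives -/

section ConicModels

variable {d : ℕ} {f : EuclideanSpace ℝ (Fin d) → EReal}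

/-- The points `(v, t, r)` with `t > 0` and `t f(v / t) = r`. -/
def perspGraph (f : EuclideanSpace ℝ (Fin d) → EReal) : Set (EuclideanSpace ℝ (Fin d) × ℝ × ℝ) :=
  {p | 0 < p.2.1 ∧ f (p.2.1⁻¹ • p.1) = ((p.2.2 / p.2.1 : ℝ) : EReal)}

/-- The points `(v, t, r)` with `t > 0` and `t f(v / t) ≤ r`. -/
def perspEpi (f : EuclideanSpace ℝ (Fin d) → EReal) : Set (EuclideanSpace ℝ (Fin d) × ℝ × ℝ) :=
  {p | 0 < p.2.1 ∧ f (p.2.1⁻¹ • p.1) ≤ ((p.2.2 / p.2.1 : ℝ) : EReal)}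

/-- A convex set between the graph and the epigraph of the perspective of `f`, with a point in its
algebraic relative interior. -/
structure IsConicModel (f : EuclideanSpace ℝ (Fin d) → EReal)
    (K : Set (EuclideanSpace ℝ (Fin d) × ℝ × ℝ)) (p : EuclideanSpace ℝ (Fin d) × ℝ × ℝ) :
    Prop where
  convex : Convex ℝ K
  graph_subset : perspGraph f ⊆ K
  subset_epi : K ⊆ perspEpi f
  core : IsCorePoint K p

/-- `f` is a real-valued affine function. -/
def IsAffineFun (f : EuclideanSpace ℝ (Fin d) → EReal) : Prop :=
  ∃ (y : EuclideanSpace ℝ (Fin d)) (b : ℝ), ∀ z, f z = ((inner ℝ z y + b : ℝ) : EReal)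

theorem smul_mem_perspGraph {z : EuclideanSpace ℝ (Fin d)} {r s : ℝ} (hz : f z = r) (hs : 0 < s) :
    (s • z, s, s * r) ∈ perspGraph f := by
  refine ⟨hs, ?_⟩
  simp only
  rw [inv_smul_smul₀ hs.ne', mul_div_cancel_left₀ _ hs.ne', hz]

theorem convex_perspEpi (hf : IsConvexFun f) : Convex ℝ (perspEpi f) := by
  rintro ⟨v, t, r⟩ ⟨ht, hv⟩ ⟨v', t', r'⟩ ⟨ht', hv'⟩ a b ha hb hab
  simp only at ht ht' hv hv'
  have hT : 0 < a * t + b * t' := by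
    rcases ha.eq_or_lt with rfl | ha
    · have : b = 1 := by linarith
      subst this; linarith
    · have := mul_pos ha ht
      have := mul_nonneg hb ht'.le
      linarith
  refine ⟨hT, ?_⟩
  simp only [Prod.fst_add, Prod.smul_fst, Prod.snd_add, Prod.smul_snd, smul_eq_mul]
  have := hf.le_combo hv hv' (a := a * t / (a * t + b * t')) (b := b * t' / (a * t + b * t'))
    (by positivity) (by positivity) (by field_simp)
  convert this using 2
  · rw [smul_add, smul_smul, smul_smul, smul_smul, smul_smul]
    congr 2 <;> field_simp
  · field_simp

/-- After division by its scale, the point shifted by a small step `ε` is a convex combination of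
`z₀` and of a point beyond `z₀` that is still in the domain. Convexity bounds `f` there, and the
strict inequality at `z₀` survives for small `ε` by continuity. -/
theorem isCorePoint_perspEpi (hf : IsProper f) (hc : IsConvexFun f)
    {z₀ : EuclideanSpace ℝ (Fin d)} (hz₀ : IsCorePoint (dom f) z₀) {t₀ r₀ : ℝ} (ht₀ : 0 < t₀)
    (hr₀ : f z₀ < ((r₀ / t₀ : ℝ) : EReal)) : IsCorePoint (perspEpi f) (t₀ • z₀, t₀, r₀) := by
  refine ⟨⟨ht₀, by simpa only [inv_smul_smul₀ ht₀.ne'] using hr₀.le⟩, ?_⟩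
  rintro ⟨v, t, r⟩ ⟨ht, hv⟩
  simp only at ht hv
  set z := t⁻¹ • v with hz
  obtain ⟨c₀, hc₀⟩ := hf.exists_real hz₀.1
  obtain ⟨δ, hδ, hδm⟩ := hz₀.2 z (hv.trans_lt (EReal.coe_lt_top _))
  obtain ⟨M, hM⟩ := hf.exists_real hδm
  rw [hc₀] at hr₀
  have hr₀' : c₀ < r₀ / t₀ := by exact_mod_cast hr₀
  -- `den` and `σ` are the scale and the relative step of the shifted point
  let den : ℝ → ℝ := fun ε => t₀ - ε * (t - t₀)
  let σ : ℝ → ℝ := fun ε => ε * t / den ε / δ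
  have hden : ContinuousAt den 0 := by fun_prop
  have hden0 : den 0 = t₀ := by simp [den]
  have hσ : ContinuousAt σ 0 := by
    have h0 : den 0 ≠ 0 := by rw [hden0]; exact ht₀.ne'
    fun_prop (disch := assumption)
  have hσ0 : σ 0 = 0 := by simp [σ]
  have h1 : ∀ᶠ ε in nhds (0 : ℝ), 0 < den ε :=
    hden.eventually (by rw [hden0]; exact lt_mem_nhds ht₀)
  have h2 : ∀ᶠ ε in nhds (0 : ℝ), σ ε < 1 :=
    hσ.eventually (by rw [hσ0]; exact gt_mem_nhds one_pos)
  have h3 : ∀ᶠ ε in nhds (0 : ℝ),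
      (1 - σ ε) * c₀ + σ ε * M - (r₀ - ε * (r - r₀)) / den ε < 0 := by
    have h0 : den 0 ≠ 0 := by rw [hden0]; exact ht₀.ne'
    have hcont : ContinuousAt (fun ε => (1 - σ ε) * c₀ + σ ε * M - (r₀ - ε * (r - r₀)) / den ε) 0 := by
      fun_prop (disch := assumption)
    refine hcont.eventually_lt_const ?_
    simp only [hσ0, hden0, sub_zero, one_mul, zero_mul, add_zero]
    linarith
  obtain ⟨ε, ⟨⟨h1, h2⟩, h3⟩, hε⟩ := ((((h1.and h2).and h3).filter_mono
    (nhdsWithin_le_nhds (s := Set.Ioi 0))).and self_mem_nhdsWithin).exists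
  have hε : 0 < ε := hε
  refine ⟨ε, hε, h1, ?_⟩
  have hσp : 0 ≤ σ ε := by positivity
  have h4 := hc.le_combo hc₀.le hM.le (a := 1 - σ ε) (b := σ ε) (by linarith) hσp (by ring)
  refine le_trans (le_of_eq ?_) (h4.trans ?_)
  · congr 1
    change (den ε)⁻¹ • (t₀ • z₀ - ε • (v - t₀ • z₀)) = _
    have hv' : v = t • z := by rw [hz, smul_inv_smul₀ ht.ne']
    have hs : σ ε * δ = ε * t / den ε := by simp only [σ]; field_simp
    have e1 : (1 - σ ε) • z₀ + σ ε • (z₀ - δ • (z - z₀))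
        = (1 + ε * t / den ε) • z₀ - (ε * t / den ε) • z := by
      rw [← hs]; module
    rw [e1, hv']
    have e2 : 1 + ε * t / den ε = (den ε)⁻¹ * ((1 + ε) * t₀) := by
      field_simp
      simp only [den]; ring
    rw [e2, div_eq_inv_mul]
    module
  · norm_cast
    change _ ≤ (r₀ - ε * (r - r₀)) / den ε
    linarith

/-- With strict inequality the whole epigraph serves. For an affine function the graph of the
perspective serves: it is the part of a linear subspace with positive scale, so each of its points
is a core point, and the level is lowered to the actual value. -/
theorem exists_isConicModel (hf : IsProper f) (hc : IsConvexFun f)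
    {z₀ : EuclideanSpace ℝ (Fin d)} (hz₀ : IsCorePoint (dom f) z₀) {t₀ r₀ : ℝ} (ht₀ : 0 < t₀)
    (hr₀ : f z₀ ≤ ((r₀ / t₀ : ℝ) : EReal))
    (h : f z₀ < ((r₀ / t₀ : ℝ) : EReal) ∨ IsAffineFun f) :
    ∃ K, ∃ r ≤ r₀, IsConicModel f K (t₀ • z₀, t₀, r) := by
  rcases h with h | ⟨y, b, h⟩
  · exact ⟨perspEpi f, r₀, le_rfl, convex_perspEpi hc, fun p hp => ⟨hp.1, hp.2.le⟩, subset_rfl,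
      isCorePoint_perspEpi hf hc hz₀ ht₀ h⟩
  · rw [h] at hr₀
    have hr₀' : inner ℝ z₀ y + b ≤ r₀ / t₀ := by exact_mod_cast hr₀
    rw [le_div_iff₀ ht₀] at hr₀'
    refine ⟨{p | 0 < p.2.1 ∧ p.2.2 = inner ℝ p.1 y + b * p.2.1}, t₀ * (inner ℝ z₀ y + b),
      by linarith, ⟨?_, ?_, ?_, ⟨ht₀, ?_⟩, ?_⟩⟩
    · rintro ⟨v, t, r⟩ ⟨ht, hv⟩ ⟨v', t', r'⟩ ⟨ht', hv'⟩ α β ha hb hab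
      refine ⟨(convex_Ioi (0 : ℝ)) ht ht' ha hb hab, ?_⟩
      simp only [Prod.fst_add, Prod.smul_fst, Prod.snd_add, Prod.smul_snd, smul_eq_mul,
        inner_add_left, real_inner_smul_left] at hv hv' ⊢
      rw [hv, hv']; ring
    · rintro ⟨v, t, r⟩ ⟨ht, hv⟩
      refine ⟨ht, ?_⟩
      simp only at ht hv ⊢
      rw [h, EReal.coe_eq_coe_iff, real_inner_smul_left, eq_div_iff ht.ne'] at hv
      rw [← hv]; field_simp
    · rintro ⟨v, t, r⟩ ⟨ht, hv⟩
      refine ⟨ht, ?_⟩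
      simp only at ht hv ⊢
      rw [h, EReal.coe_le_coe_iff, real_inner_smul_left, hv]
      exact le_of_eq (by field_simp)
    · simp only [real_inner_smul_left]; ring
    · rintro ⟨v, t, r⟩ ⟨ht, hv⟩
      simp only at ht hv
      -- This step leaves the scale at `t₀ * (1 + t₀) / (t + 1)`, which is positive.
      refine ⟨t₀ / (t + 1), by positivity, ?_, ?_⟩
      · simp only [Prod.snd_sub, Prod.smul_snd, Prod.fst_sub, Prod.smul_fst, smul_eq_mul]
        have : t₀ / (t + 1) * (t - t₀) = t₀ - t₀ * (1 + t₀) / (t + 1) := by field_simp; ring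
        rw [this]
        have : 0 < t₀ * (1 + t₀) / (t + 1) := by positivity
        linarith
      · simp only [Prod.snd_sub, Prod.smul_snd, Prod.fst_sub, Prod.smul_fst, smul_eq_mul,
          inner_sub_left, real_inner_smul_left, hv]
        ring

/-- The perspective of the conjugate is a supremum over points where `f` is finite. At scale `0` it
runs over the domain of the biconjugate, which by Fenchel–Moreau is contained in that of `f`. -/
theorem IsPCC.persp_conj_le (hf : IsPCC f) {y : EuclideanSpace ℝ (Fin d)} {s ρ : ℝ} (hs : 0 ≤ s)
    (h : ∀ z (r : ℝ), f z = r → inner ℝ z y - s * r ≤ ρ) : persp (conj f) y s ≤ ρ := by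
  rcases hs.eq_or_lt with rfl | hs
  · refine persp_zero_le_iff.2 fun z hz => ?_
    have hz' : z ∈ dom f := by
      have hbot : conj (conj f) z ≠ ⊥ := by
        obtain ⟨w, hw⟩ := hf.isProper_conj.2
        obtain ⟨c, hc⟩ := hf.isProper_conj.exists_real hw
        refine (lt_of_lt_of_le ?_ (le_iSup _ w)).ne'
        rw [hc, ← EReal.coe_sub]
        exact EReal.bot_lt_coe _
      have := hf.le_of_conj_conj_le (EReal.coe_toReal (ne_of_lt hz) hbot).ge
      exact this.trans_lt (EReal.coe_lt_top _)
    obtain ⟨r, hr⟩ := hf.proper.exists_real hz'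
    simpa using h z r hr
  · rw [persp_le_iff_of_pos hs, conj_le_coe_iff]
    intro z
    induction hz : f z using EReal.rec with
    | bot => exact absurd hz (hf.proper.1 z).ne'
    | top => exact le_top
    | coe r =>
      have := h z r hz
      norm_cast
      rw [inner_smul_right, ← div_eq_inv_mul, ← sub_div, div_le_iff₀ hs]
      linarith

/-- Counterpart of `IsPCC.persp_conj_le` with the roles exchanged; for positive scale it rests on
Fenchel–Moreau. -/
theorem IsPCC.persp_le_of_conj (hf : IsPCC f) {v : EuclideanSpace ℝ (Fin d)} {t R : ℝ} (ht : 0 ≤ t)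
    (h : ∀ w (c : ℝ), conj f w = c → inner ℝ w v - t * c ≤ R) : persp f v t ≤ R := by
  rcases ht.eq_or_lt with rfl | ht
  · refine persp_zero_le_iff.2 fun w hw => ?_
    obtain ⟨c, hc⟩ := hf.isProper_conj.exists_real hw
    simpa using h w c hc
  · rw [persp_le_iff_of_pos ht]
    refine hf.le_of_conj_conj_le (conj_le_coe_iff.2 fun w => ?_)
    induction hw : conj f w using EReal.rec with
    | bot => exact absurd hw (hf.isProper_conj.1 w).ne'
    | top => exact le_top
    | coe c =>
      have := h w c hw
      norm_cast
      rw [inner_smul_right, ← div_eq_inv_mul, ← sub_div, div_le_iff₀ ht]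
      linarith

end ConicModels

/-! ### Testing inequalities on scales, and sums of extended reals -/

section Auxiliary

/-- By continuity the bound extends to the closed orthant. The origin gives the constant, and
letting one coordinate grow gives each coefficient. This is what splits a Lagrangian inequality into
blocks. -/
theorem nonneg_of_forall_pos_smul {ι : Type*} [Fintype ι] {c : ℝ} {φ : ι → ℝ}
    (h : ∀ s : ι → ℝ, (∀ i, 0 < s i) → 0 ≤ c + ∑ i, s i * φ i) : 0 ≤ c ∧ ∀ i, 0 ≤ φ i := by
  classical
  have key : ∀ s : ι → ℝ, (∀ i, 0 ≤ s i) → 0 ≤ c + ∑ i, s i * φ i := fun s hs => by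
    have hcont : Continuous fun ε : ℝ => c + ∑ i, (s i + ε) * φ i := by fun_prop
    have h0 : c + ∑ i, s i * φ i = (fun ε : ℝ => c + ∑ i, (s i + ε) * φ i) 0 := by simp
    rw [h0]
    have ht : Filter.Tendsto (fun ε : ℝ => c + ∑ i, (s i + ε) * φ i)
        (nhdsWithin 0 (Set.Ioi 0)) (nhds _) := (hcont.tendsto 0).mono_left nhdsWithin_le_nhds
    refine ge_of_tendsto ht ?_
    filter_upwards [self_mem_nhdsWithin] with ε hε
    exact h _ fun i => add_pos_of_nonneg_of_pos (hs i) hε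
  refine ⟨by simpa using key 0 fun _ => le_rfl, fun i => ?_⟩
  by_contra hc
  push Not at hc
  -- At this value of the coordinate the expression equals `c - |c| - 1`, which is negative.
  have h1 := key (Pi.single i ((|c| + 1) / (-φ i))) fun k => by
    by_cases hk : k = i
    · subst hk
      rw [Pi.single_eq_same]
      exact div_nonneg (by positivity) (by linarith)
    · simp [hk]
  rw [Finset.sum_eq_single i (fun k _ hk => by simp [hk]) (by simp), Pi.single_eq_same,
    div_mul_eq_mul_div, div_neg, mul_div_cancel_right₀ _ hc.ne] at h1
  linarith [le_abs_self c]

theorem eq_zero_of_forall_nonneg {a b : ℝ} (h : ∀ t : ℝ, 0 ≤ a + t * b) : b = 0 := by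
  by_contra hb
  have := h (-(a + 1) / b)
  rw [div_mul_cancel₀ _ hb] at this
  linarith

theorem coe_sum_ereal {ι : Type*} (s : Finset ι) (ρ : ι → ℝ) :
    ((∑ i ∈ s, ρ i : ℝ) : EReal) = ∑ i ∈ s, (ρ i : EReal) := by
  classical
  induction s using Finset.induction_on with
  | empty => simp
  | insert k t hk ih => rw [Finset.sum_insert hk, Finset.sum_insert hk, EReal.coe_add, ih]

/-- Excluding `⊥` is essential: in `EReal` the sum `⊤ + ⊥` is `⊥`, which would hide infinite terms.
-/
theorem exists_real_of_sum_le {ι : Type*} (s : Finset ι) {e : ι → EReal} (he : ∀ i ∈ s, ⊥ < e i) :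
    ∀ {a : ℝ}, ∑ i ∈ s, e i ≤ a →
      ∃ ρ : ι → ℝ, (∀ i ∈ s, e i = ρ i) ∧ ∑ i ∈ s, ρ i ≤ a := by
  classical
  intro a h
  have hb : ∀ t ⊆ s, ⊥ < ∑ i ∈ t, e i := by
    intro t
    induction t using Finset.induction_on with
    | empty => intro _; simp
    | insert k t hk ih =>
      intro ht
      rw [Finset.sum_insert hk]
      exact EReal.bot_lt_add_iff.2 ⟨he k (ht (Finset.mem_insert_self _ _)),
        ih ((Finset.subset_insert _ _).trans ht)⟩
  have hr : ∀ i ∈ s, e i = (e i).toReal := fun i hi => by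
    refine (EReal.coe_toReal (fun hc => ?_) (he i hi).ne').symm
    rw [← Finset.add_sum_erase s e hi, hc,
      EReal.top_add_of_ne_bot (hb _ (Finset.erase_subset _ _)).ne'] at h
    exact absurd h (by simp)
  refine ⟨fun i => (e i).toReal, hr, ?_⟩
  rw [Finset.sum_congr rfl hr, ← coe_sum_ereal] at h
  exact_mod_cast h

end Auxiliary

end UQ

namespace UQ

/-! ### From multipliers of (AD-B') to a solution of (AP-W') -/

section BlockDuality

variable {d : ℕ} {I J L : Type*}

/-- The scaling factors `1`, `β_j` and `ν_{iℓ}` of the conjugates in (AP-W'). -/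
def weight (β : J → ℝ) (ν : I → L → ℝ) : I → Option (J ⊕ L) → ℝ
  | _, none => 1
  | _, some (.inl j) => β j
  | i, some (.inr l) => ν i l

/-- The bounds `-τ_i`, `ω_{ij}` and `0` on the perspectives in (AD-B'). -/
def level (L : Type*) (τ : I → ℝ) (ω : I → J → ℝ) : I → Option (J ⊕ L) → ℝ
  | i, none => -τ i
  | i, some (.inl j) => ω i j
  | _, some (.inr _) => 0

/-- The smallest of the finitely many steps works in every factor, since convexity allows a step to
be shortened. -/
theorem isCorePoint_pi {ι : Type*} [Finite ι] {V : ι → Type*} [∀ i, AddCommGroup (V i)]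
    [∀ i, Module ℝ (V i)] {C : ∀ i, Set (V i)} (hC : ∀ i, Convex ℝ (C i)) {x : ∀ i, V i}
    (hx : ∀ i, IsCorePoint (C i) (x i)) : IsCorePoint {p : ∀ i, V i | ∀ i, p i ∈ C i} x := by
  classical
  have := Fintype.ofFinite ι
  refine ⟨fun i => (hx i).1, fun y hy => ?_⟩
  choose ε hε hm using fun i => (hx i).2 (y i) (hy i)
  have key : ∀ s : Finset ι, ∃ δ : ℝ, 0 < δ ∧ ∀ i ∈ s, δ ≤ ε i := fun s => by
    induction s using Finset.induction_on with
    | empty => exact ⟨1, one_pos, by simp⟩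
    | insert k s _ ih =>
      obtain ⟨δ, hδ, h⟩ := ih
      refine ⟨min δ (ε k), lt_min hδ (hε k), fun i hi => ?_⟩
      rcases Finset.mem_insert.1 hi with rfl | hi
      · exact min_le_right _ _
      · exact (min_le_left _ _).trans (h i hi)
  obtain ⟨δ, hδ, h⟩ := key Finset.univ
  refine ⟨δ, hδ, fun i => ?_⟩
  have hle : δ / ε i ≤ 1 := (div_le_one (hε i)).2 (h i (Finset.mem_univ i))
  have := hC i (hx i).1 (hm i) (a := 1 - δ / ε i) (b := δ / ε i) (by linarith)
    (div_nonneg hδ.le (hε i).le) (by ring)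
  convert this using 1
  simp only [Pi.sub_apply, Pi.smul_apply]
  rw [smul_sub (δ / ε i), smul_smul (δ / ε i), div_mul_cancel₀ _ (hε i).ne']
  module

/-- Prescribes the test point of a single block while the others are arbitrary, so that the
condition of that block can be isolated. -/
theorem exists_selection {ι κ α : Type*} {P : ι → κ → α → Prop} (h : ∀ i b, ∃ x, P i b x) (i : ι)
    (b : κ) {x : α} (hx : P i b x) : ∃ s : ι → κ → α, (∀ i b, P i b (s i b)) ∧ s i b = x := by
  classical
  choose s hs using h
  refine ⟨fun i' b' => if i' = i ∧ b' = b then x else s i' b', fun i' b' => ?_, by simp⟩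
  simp only
  split_ifs with h
  · obtain ⟨rfl, rfl⟩ := h
    exact hx
  · exact hs _ _

variable [Fintype I] [Fintype J] [Fintype L]
  {f : I → Option (J ⊕ L) → EuclideanSpace ℝ (Fin d) → EReal}

/-- Strong duality in the abstract: the Lagrangian inequality is tested at scaled graph points `(σ
z, σ, σ c)`, with `σ > 0` free in each block. It is then affine in the scales, and its coefficients
are the bounds on the perspectives of the conjugates. -/
theorem exists_conjugate_solution (hf : ∀ i b, IsPCC (f i b)) {μ : J → ℝ} {V : ℝ}
    {K : I → Option (J ⊕ L) → Set (EuclideanSpace ℝ (Fin d) × ℝ × ℝ)}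
    {v : I → EuclideanSpace ℝ (Fin d)} {t : I → ℝ} {r : I → Option (J ⊕ L) → ℝ}
    (hK : ∀ i b, IsConicModel (f i b) (K i b) (v i, t i, r i b)) (ht : ∑ i, t i = 1)
    (hr : ∀ j, ∑ i, r i (some (.inl j)) ≤ μ j) (hr' : ∀ i l, r i (some (.inr l)) ≤ 0)
    (hV : ∀ (t : I → ℝ) (z : I → EuclideanSpace ℝ (Fin d)) (r : I → Option (J ⊕ L) → ℝ),
      (∀ i, 0 < t i) → ∑ i, t i = 1 → (∀ i b, f i b (z i) ≤ r i b) →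
      (∀ j, ∑ i, t i * r i (some (.inl j)) ≤ μ j) → (∀ i l, r i (some (.inr l)) ≤ 0) →
      -∑ i, t i * r i none ≤ V) :
    ∃ (α : ℝ) (β : J → ℝ) (ν : I → L → ℝ) (y : I → Option (J ⊕ L) → EuclideanSpace ℝ (Fin d))
      (ρ : I → Option (J ⊕ L) → ℝ), (∀ j, 0 ≤ β j) ∧ (∀ i l, 0 ≤ ν i l) ∧
      (∀ i, ∑ b, y i b = 0) ∧ (∀ i b, persp (conj (f i b)) (y i b) (weight β ν i b) ≤ ρ i b) ∧
      (∀ i, ∑ b, ρ i b ≤ α) ∧ α + ∑ j, μ j * β j ≤ V := by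
  classical
  let C : Set (I → Option (J ⊕ L) → EuclideanSpace ℝ (Fin d) × ℝ × ℝ) := {p | ∀ i, p i ∈ {q | ∀ b, q b ∈ K i b}}
  have hCi : ∀ i, Convex ℝ {q : Option (J ⊕ L) → EuclideanSpace ℝ (Fin d) × ℝ × ℝ |
      ∀ b, q b ∈ K i b} := fun i x hx y hy u w hu hw huw b => (hK i b).convex (hx b) (hy b) hu hw huw
  have hC : Convex ℝ C := fun x hx y hy u w hu hw huw i => hCi i (hx i) (hy i) hu hw huw
  have hcore : IsCorePoint C (fun i b => (v i, t i, r i b)) :=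
    isCorePoint_pi hCi fun i => isCorePoint_pi (fun b => (hK i b).convex) fun b => (hK i b).core
  -- The moment and support inequalities yield `β` and `ν`, the normalization of the scales yields
  -- `α`, and the equations that identify the copies of scale and vector within a piece yield the
  -- levels `s` and the vectors `y`.
  obtain ⟨η, θ, w, hη, h⟩ := exists_multipliers_eq hC hcore
    (p := Sum.elim (fun (j : J) (p : I → Option (J ⊕ L) → EuclideanSpace ℝ (Fin d) × ℝ × ℝ) => ∑ i, (p i (some (.inl j))).2.2)
      (fun (m : I × L) (p : I → Option (J ⊕ L) → EuclideanSpace ℝ (Fin d) × ℝ × ℝ) => (p m.1 (some (.inr m.2))).2.2))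
    (a := Sum.elim μ fun _ => 0)
    (q := fun (o : Option (I × (J ⊕ L))) (p : I → Option (J ⊕ L) → EuclideanSpace ℝ (Fin d) × ℝ × ℝ) => o.elim (∑ i, (p i none).2.1)
      fun m => (p m.1 (some m.2)).2.1 - (p m.1 none).2.1)
    (b := fun o => o.elim 1 fun _ => 0)
    (T := fun (m : I × (J ⊕ L)) (p : I → Option (J ⊕ L) → EuclideanSpace ℝ (Fin d) × ℝ × ℝ) => (p m.1 (some m.2)).1 - (p m.1 none).1)
    (l := fun p : I → Option (J ⊕ L) → EuclideanSpace ℝ (Fin d) × ℝ × ℝ => -∑ i, (p i none).2.2) (c := V)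
    (by
      rintro (j | m)
      · exact ⟨fun x y => by simp [Finset.sum_add_distrib], fun c x => by simp [Finset.mul_sum]⟩
      · exact ⟨fun x y => by simp, fun c x => by simp⟩)
    (by
      rintro (j | m)
      · exact hr j
      · exact hr' _ _)
    (by
      rintro (_ | m)
      · exact ⟨fun x y => by simp [Finset.sum_add_distrib], fun c x => by simp [Finset.mul_sum]⟩
      · exact ⟨fun x y => by simp; ring, fun c x => by simp; ring⟩)
    (by
      rintro (_ | m)
      · exact ht
      · simp)
    (fun m => ⟨fun x y => by simp; abel, fun c x => by simp [smul_sub]⟩)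
    (fun m => by simp)
    ⟨fun x y => by simp [Finset.sum_add_distrib]; ring, fun c x => by simp [Finset.mul_sum]⟩
    (by
      intro p hp h₁ h₂ h₃
      have hpos : ∀ i b, 0 < (p i b).2.1 := fun i b => ((hK i b).subset_epi (hp i b)).1
      have e₁ : ∀ i b, (p i b).2.1 = (p i none).2.1 := by
        rintro i (_ | b)
        · rfl
        · exact sub_eq_zero.1 (h₂ (some (i, b)))
      have e₂ : ∀ i b, (p i b).1 = (p i none).1 := by
        rintro i (_ | b)
        · rfl
        · exact sub_eq_zero.1 (h₃ (i, b))
      have e₃ : ∀ i b, (p i none).2.1 * ((p i b).2.2 / (p i none).2.1) = (p i b).2.2 :=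
        fun i b => mul_div_cancel₀ _ (hpos i none).ne'
      have := hV (fun i => (p i none).2.1) (fun i => (p i none).2.1⁻¹ • (p i none).1)
        (fun i b => (p i b).2.2 / (p i none).2.1) (fun i => hpos i none) (h₂ none)
        (fun i b => by
          have := ((hK i b).subset_epi (hp i b)).2
          rwa [e₁, e₂] at this)
        (fun j => by simp only [e₃]; exact h₁ (.inl j))
        (fun i l => div_nonpos_of_nonpos_of_nonneg (h₁ (.inr (i, l))) (hpos i none).le)
      simpa only [e₃] using this)
  set β : J → ℝ := fun j => η (.inl j)
  set ν : I → L → ℝ := fun i l => η (.inr (i, l))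
  set α : ℝ := θ none
  let s : I → J ⊕ L → ℝ := fun i b => θ (some (i, b))
  let y : I → J ⊕ L → EuclideanSpace ℝ (Fin d) := fun i b => -w (i, b)
  -- Coefficient of the scale `σ` of a block in the Lagrangian. The block `none`, to which all
  -- others are tied, collects the sums of `s` and `y`.
  let φ : (I → Option (J ⊕ L) → EuclideanSpace ℝ (Fin d)) → (I → Option (J ⊕ L) → ℝ) →
    I × Option (J ⊕ L) → ℝ := fun z c m => m.2.elim
      (c m.1 none + α - ∑ b, s m.1 b + inner ℝ (z m.1 none) (∑ b, y m.1 b))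
      (fun b => weight β ν m.1 (some b) * c m.1 (some b) + s m.1 b
        - inner ℝ (z m.1 (some b)) (y m.1 b))
  have key : ∀ z (c : I → Option (J ⊕ L) → ℝ), (∀ i b, f i b (z i b) = c i b) →
      0 ≤ V - ∑ j, μ j * β j - α ∧ ∀ m, 0 ≤ φ z c m := by
    intro z c hz
    refine nonneg_of_forall_pos_smul fun σ hσ => ?_
    have := h (fun i b => (σ (i, b) • z i b, σ (i, b), σ (i, b) * c i b)) fun i b =>
      (hK i b).graph_subset (smul_mem_perspGraph (hz i b) (hσ _))
    simp only [Fintype.sum_sum_type, Sum.elim_inl, Sum.elim_inr, Fintype.sum_option, Option.elim,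
      Fintype.sum_prod_type, inner_sub_left, real_inner_smul_left, mul_sub,
      Finset.sum_sub_distrib, Finset.mul_sum, Finset.sum_add_distrib] at this
    simp only [φ, Fintype.sum_prod_type, Fintype.sum_option, Option.elim, weight, y, s,
      Fintype.sum_sum_type, mul_sub, mul_add, inner_neg_right, Finset.mul_sum,
      Finset.sum_sub_distrib, Finset.sum_add_distrib, Finset.sum_neg_distrib, mul_neg] at this ⊢
    rw [Finset.sum_comm (s := (Finset.univ : Finset J)) (t := (Finset.univ : Finset I))] at this
    simp only [β, ν, α, inner_add_right, inner_sum, mul_add, Finset.mul_sum,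
      Finset.sum_add_distrib, mul_comm, mul_left_comm, mul_assoc, zero_mul,
      one_mul,
      Finset.sum_const_zero] at this ⊢
    linarith
  have hex : ∀ i b, ∃ q : EuclideanSpace ℝ (Fin d) × ℝ, f i b q.1 = q.2 := fun i b => by
    obtain ⟨x, hx⟩ := (hf i b).proper.2
    obtain ⟨r, hr⟩ := (hf i b).proper.exists_real hx
    exact ⟨(x, r), hr⟩
  have hφ : ∀ i b z c, f i b z = ((c : ℝ) : EReal) →
      0 ≤ φ (fun _ _ => z) (fun _ _ => c) (i, b) := fun i b z c hz => by
    obtain ⟨q, hq, hqe⟩ := exists_selection hex i b (x := (z, c)) hz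
    have := (key _ _ hq).2 (i, b)
    rcases b with _ | b <;> simpa only [φ, Option.elim, hqe] using this
  obtain ⟨q, hq⟩ : ∃ q : I → Option (J ⊕ L) → EuclideanSpace ℝ (Fin d) × ℝ,
      ∀ i b, f i b (q i b).1 = (q i b).2 := ⟨fun i b => (hex i b).choose, fun i b =>
    (hex i b).choose_spec⟩
  refine ⟨α, β, ν, fun i b => b.elim (-∑ b, y i b) (y i), fun i b => b.elim (α - ∑ b, s i b) (s i),
    fun j => hη _, fun i l => hη _, fun i => ?_, fun i b => ?_, fun i => ?_, ?_⟩
  · simp only [Fintype.sum_option, Option.elim, neg_add_cancel]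
  · have hw : 0 ≤ weight β ν i b := by
      rcases b with _ | j | l
      · exact zero_le_one
      · exact hη _
      · exact hη _
    refine (hf i b).persp_conj_le hw fun z c hz => ?_
    have := hφ i b z c hz
    rcases b with _ | b
    · simp only [φ, Option.elim, weight, inner_neg_right, one_mul] at this ⊢
      linarith
    · simp only [φ, Option.elim] at this ⊢
      linarith
  · simp only [Fintype.sum_option, Option.elim, sub_add_cancel, le_refl]
  · linarith [(key _ _ hq).1]

end BlockDuality

end UQ

namespace UQ

/-! ### From multipliers of (AP-W') to a solution of (AD-B') -/

section PrimalBlockDuality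

variable {d : ℕ} {I J L : Type*} [Fintype I] [Fintype J] [Fintype L]
  {f : I → Option (J ⊕ L) → EuclideanSpace ℝ (Fin d) → EReal}

/-- Mirror image of `exists_conjugate_solution`, with models of the conjugates. Here `α` and `β` are
additional unconstrained coordinates; the scales of the support blocks are the `ν` themselves and
need no gluing. -/
theorem exists_perspective_solution (hf : ∀ i b, IsPCC (f i b)) {μ : J → ℝ} {W : ℝ}
    {K : I → Option (J ⊕ L) → Set (EuclideanSpace ℝ (Fin d) × ℝ × ℝ)}
    {y : I → Option (J ⊕ L) → EuclideanSpace ℝ (Fin d)} {ρ : I → Option (J ⊕ L) → ℝ}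
    {α : ℝ} {β : J → ℝ} {ν : I → L → ℝ}
    (hK : ∀ i b, IsConicModel (conj (f i b)) (K i b) (y i b, weight β ν i b, ρ i b))
    (hy : ∀ i, ∑ b, y i b = 0) (hρ : ∀ i, ∑ b, ρ i b ≤ α)
    (hW : ∀ (α : ℝ) (β : J → ℝ) (ν : I → L → ℝ)
      (y : I → Option (J ⊕ L) → EuclideanSpace ℝ (Fin d)) (ρ : I → Option (J ⊕ L) → ℝ),
      (∀ i b, 0 < weight β ν i b) → (∀ i, ∑ b, y i b = 0) →
      (∀ i b, persp (conj (f i b)) (y i b) (weight β ν i b) ≤ ρ i b) →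
      (∀ i, ∑ b, ρ i b ≤ α) → W ≤ α + ∑ j, μ j * β j) :
    ∃ (τ t : I → ℝ) (ω : I → J → ℝ) (v : I → EuclideanSpace ℝ (Fin d)), (∀ i, 0 ≤ t i) ∧
      ∑ i, t i = 1 ∧ (∀ j, ∑ i, ω i j ≤ μ j) ∧
      (∀ i b, persp (f i b) (v i) (t i) ≤ level L τ ω i b) ∧ W ≤ ∑ i, τ i := by
  classical
  let C₁ : Set (I → Option (J ⊕ L) → EuclideanSpace ℝ (Fin d) × ℝ × ℝ) :=
    {p | ∀ i, p i ∈ {q | ∀ b, q b ∈ K i b}}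
  have hCi : ∀ i, Convex ℝ {q : Option (J ⊕ L) → EuclideanSpace ℝ (Fin d) × ℝ × ℝ |
      ∀ b, q b ∈ K i b} := fun i x hx y hy u w hu hw huw b => (hK i b).convex (hx b) (hy b) hu hw huw
  have hC₁ : Convex ℝ C₁ := fun x hx y hy u w hu hw huw i => hCi i (hx i) (hy i) hu hw huw
  have hcore₁ : IsCorePoint C₁ (fun i b => (y i b, weight β ν i b, ρ i b)) :=
    isCorePoint_pi hCi fun i => isCorePoint_pi (fun b => (hK i b).convex) fun b => (hK i b).core
  let C : Set ((I → Option (J ⊕ L) → EuclideanSpace ℝ (Fin d) × ℝ × ℝ) × ℝ × (J → ℝ)) := {x | x.1 ∈ C₁}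
  have hC : Convex ℝ C := fun x hx y hy u w hu hw huw => hC₁ hx hy hu hw huw
  have hcore : IsCorePoint C (fun i b => (y i b, weight β ν i b, ρ i b), α, β) :=
    ⟨hcore₁.1, fun x hx => hcore₁.2 x.1 hx⟩
  -- The multiplier of the constraint of a piece is `λ_i`; those of the equations scale `= 1` and
  -- scale `= β_j` are `-τ_i` and `ω_ij`; that of the vanishing vector sum is `-υ_i`.
  obtain ⟨t, θ, w, ht, h⟩ := exists_multipliers_eq hC hcore
    (p := fun (i : I) (x : (I → Option (J ⊕ L) → EuclideanSpace ℝ (Fin d) × ℝ × ℝ) × ℝ × (J → ℝ)) => ∑ b, (x.1 i b).2.2 - x.2.1) (a := fun _ => 0)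
    (q := Sum.elim (fun (i : I) (x : (I → Option (J ⊕ L) → EuclideanSpace ℝ (Fin d) × ℝ × ℝ) × ℝ × (J → ℝ)) => (x.1 i none).2.1)
      (fun (m : I × J) (x : (I → Option (J ⊕ L) → EuclideanSpace ℝ (Fin d) × ℝ × ℝ) × ℝ × (J → ℝ)) => (x.1 m.1 (some (.inl m.2))).2.1 - x.2.2 m.2))
    (b := Sum.elim (fun _ => 1) fun _ => 0)
    (T := fun (i : I) (x : (I → Option (J ⊕ L) → EuclideanSpace ℝ (Fin d) × ℝ × ℝ) × ℝ × (J → ℝ)) => ∑ b, (x.1 i b).1)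
    (l := fun x : (I → Option (J ⊕ L) → EuclideanSpace ℝ (Fin d) × ℝ × ℝ) × ℝ × (J → ℝ) => -x.2.1 - ∑ j, μ j * x.2.2 j) (c := -W)
    (fun i => ⟨fun x y => by simp [Finset.sum_add_distrib]; ring,
      fun c x => by simp [Finset.mul_sum, mul_sub, mul_add]⟩)
    (fun i => by simpa using hρ i)
    (by
      rintro (i | m)
      · exact ⟨fun x y => by simp, fun c x => by simp⟩
      · exact ⟨fun x y => by simp; ring, fun c x => by simp; ring⟩)
    (by
      rintro (i | m)
      · rfl
      · simp [weight])
    (fun i => ⟨fun x y => by simp [Finset.sum_add_distrib],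
      fun c x => by simp [Finset.smul_sum]⟩)
    (fun i => hy i)
    ⟨fun x y => by simp [Finset.sum_add_distrib, mul_add]; ring,
      fun c x => by simp [Finset.mul_sum, mul_sub, mul_left_comm]⟩
    (by
      intro x hx h₁ h₂ h₃
      have hpos : ∀ i b, 0 < (x.1 i b).2.1 := fun i b => ((hK i b).subset_epi (hx i b)).1
      have e : ∀ i b, weight x.2.2 (fun i l => (x.1 i (some (.inr l))).2.1) i b = (x.1 i b).2.1 := by
        rintro i (_ | j | l)
        · exact (h₂ (.inl i)).symm
        · exact (sub_eq_zero.1 (h₂ (.inr (i, j)))).symm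
        · rfl
      have := hW x.2.1 x.2.2 (fun i l => (x.1 i (some (.inr l))).2.1) (fun i b => (x.1 i b).1)
        (fun i b => (x.1 i b).2.2) (fun i b => by rw [e]; exact hpos i b) h₃
        (fun i b => by
          rw [e, persp_le_iff_of_pos (hpos i b)]
          exact ((hK i b).subset_epi (hx i b)).2)
        (fun i => by simpa using h₁ i)
      linarith)
  let τ : I → ℝ := fun i => -θ (.inl i)
  let ω : I → J → ℝ := fun i j => θ (.inr (i, j))
  let v : I → EuclideanSpace ℝ (Fin d) := fun i => -w i
  let φ : (I → Option (J ⊕ L) → EuclideanSpace ℝ (Fin d)) → (I → Option (J ⊕ L) → ℝ) →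
    I × Option (J ⊕ L) → ℝ := fun z c m =>
      t m.1 * c m.1 m.2 + level L τ ω m.1 m.2 - inner ℝ (z m.1 m.2) (v m.1)
  have key : ∀ z (c : I → Option (J ⊕ L) → ℝ), (∀ i b, conj (f i b) (z i b) = c i b) →
      ∀ (α : ℝ) (β : J → ℝ) (σ : I × Option (J ⊕ L) → ℝ), (∀ m, 0 < σ m) →
      0 ≤ (∑ i, τ i - W) + ∑ m, σ m * φ z c m + α * (1 - ∑ i, t i)
        + ∑ j, β j * (μ j - ∑ i, ω i j) := by
    intro z c hz α β σ hσ
    have := h (fun i b => (σ (i, b) • z i b, σ (i, b), σ (i, b) * c i b), α, β) fun i b =>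
      (hK i b).graph_subset (smul_mem_perspGraph (hz i b) (hσ _))
    simp only [Fintype.sum_sum_type, Sum.elim_inl, Sum.elim_inr, Fintype.sum_option,
      Fintype.sum_prod_type, inner_add_left, sum_inner, real_inner_smul_left, mul_sub,
      Finset.sum_sub_distrib, Finset.mul_sum, Finset.sum_add_distrib, mul_add] at this
    simp only [φ, Fintype.sum_prod_type, Fintype.sum_option, level, v, τ, ω,
      Fintype.sum_sum_type, mul_sub, mul_add, inner_neg_right, Finset.mul_sum,
      Finset.sum_sub_distrib, Finset.sum_add_distrib, Finset.sum_neg_distrib, mul_neg] at this ⊢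
    rw [Finset.sum_comm (s := (Finset.univ : Finset J)) (t := (Finset.univ : Finset I))]
    simp only [mul_comm, mul_assoc, mul_zero, zero_mul, one_mul,
      Finset.sum_const_zero] at this ⊢
    linarith
  have hex : ∀ i b, ∃ q : EuclideanSpace ℝ (Fin d) × ℝ, conj (f i b) q.1 = q.2 := fun i b => by
    obtain ⟨x, hx⟩ := (hf i b).isProper_conj.2
    obtain ⟨r, hr⟩ := (hf i b).isProper_conj.exists_real hx
    exact ⟨(x, r), hr⟩
  obtain ⟨q, hq⟩ : ∃ q : I → Option (J ⊕ L) → EuclideanSpace ℝ (Fin d) × ℝ,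
      ∀ i b, conj (f i b) (q i b).1 = (q i b).2 := ⟨fun i b => (hex i b).choose, fun i b =>
    (hex i b).choose_spec⟩
  have key₀ : ∀ z (c : I → Option (J ⊕ L) → ℝ), (∀ i b, conj (f i b) (z i b) = c i b) →
      0 ≤ ∑ i, τ i - W ∧ ∀ m, 0 ≤ φ z c m := fun z c hz =>
    nonneg_of_forall_pos_smul fun σ hσ => by simpa using key z c hz 0 0 σ hσ
  have hφ : ∀ i b z c, conj (f i b) z = ((c : ℝ) : EReal) →
      0 ≤ φ (fun _ _ => z) (fun _ _ => c) (i, b) := fun i b z c hz => by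
    obtain ⟨q, hq, hqe⟩ := exists_selection hex i b (x := (z, c)) hz
    have := (key₀ _ _ hq).2 (i, b)
    simpa only [φ, hqe] using this
  refine ⟨τ, t, ω, v, ht, ?_, fun j => ?_, fun i b => (hf i b).persp_le_of_conj (ht i)
    fun w c hw => ?_, ?_⟩
  -- The Lagrangian is affine in the unconstrained `α` and `β_j`, so their coefficients vanish; the
  -- moment constraints even hold with equality.
  · have := eq_zero_of_forall_nonneg fun s => by
      simpa using key _ _ hq s 0 (fun _ => 1) fun _ => one_pos
    linarith
  · have := eq_zero_of_forall_nonneg (b := μ j - ∑ i, ω i j) fun s => by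
      have := key _ _ hq 0 (Pi.single j s) (fun _ => 1) fun _ => one_pos
      rwa [Finset.sum_eq_single j (fun k _ hk => by simp [hk]) (by simp), Pi.single_eq_same] at this
    linarith
  · have := hφ i b w c hw
    simp only [φ] at this
    linarith
  · linarith [(key₀ _ _ hq).1]

end PrimalBlockDuality

end UQ

namespace UQ

set_option linter.unusedSectionVars false

/-! ### Arithmetic in the extended reals -/

section EReal

theorem ereal_sub_coe_nonpos_iff {a : EReal} {r : ℝ} : a - r ≤ 0 ↔ a ≤ r := by
  induction a using EReal.rec with
  | bot => simp
  | top => simp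
  | coe s => norm_cast; simp

theorem ereal_sub_coe_neg_iff {a : EReal} {r : ℝ} : a - r < 0 ↔ a < r := by
  induction a using EReal.rec with
  | bot => simp
  | top => simp
  | coe s => norm_cast; simp

theorem ereal_sub_coe_lt_top_iff {a : EReal} {r : ℝ} : a - r < ⊤ ↔ a < ⊤ := by
  induction a using EReal.rec with
  | bot => simp
  | top => simp
  | coe s =>
    refine iff_of_true ?_ (EReal.coe_lt_top _)
    rw [← EReal.coe_sub]
    exact EReal.coe_lt_top _

theorem ereal_coe_pos_mul_lt_top_iff {a : EReal} {r : ℝ} (hr : 0 < r) : r * a < ⊤ ↔ a < ⊤ := by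
  induction a using EReal.rec with
  | bot => simp [EReal.coe_mul_bot_of_pos hr]
  | top => simp [EReal.coe_mul_top_of_pos hr]
  | coe s =>
    refine iff_of_true ?_ (EReal.coe_lt_top _)
    rw [← EReal.coe_mul]
    exact EReal.coe_lt_top _

theorem eq_coe_add_of_sub_coe_eq {a : EReal} {r s : ℝ} (h : a - r = s) : a = ((s + r : ℝ) : EReal) := by
  induction a using EReal.rec with
  | bot => simp at h
  | top => simp at h
  | coe t => norm_cast at h ⊢; linarith

end EReal

/-- Restricts an affine map of the decision variables to the variable of one block; the Riesz
representation supplies the gradient. -/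
theorem isAffineFun_of_affineMap {d : ℕ} {f : EuclideanSpace ℝ (Fin d) → EReal} {X : Type*}
    [AddCommGroup X] [Module ℝ X] (a : X →ᵃ[ℝ] ℝ) {ι : EuclideanSpace ℝ (Fin d) → X}
    (hι : IsLinearMap ℝ ι) (x₀ : X) (c : ℝ) (h : ∀ z, f z = ((a (ι z + x₀) + c : ℝ) : EReal)) :
    IsAffineFun f := by
  refine ⟨(InnerProductSpace.toDual ℝ _).symm
    (LinearMap.toContinuousLinearMap (a.linear.comp hι.mk')), a x₀ + c, fun z => ?_⟩
  rw [h, real_inner_comm, InnerProductSpace.toDual_symm_apply]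
  have := a.map_vadd x₀ (ι z)
  simp only [vadd_eq_add] at this
  rw [this, add_assoc]
  rfl

/-! ### Block form of the constraints, and what Slater points provide for each block -/

namespace Data

variable {d : ℕ} {I J L : Type*} (D : Data d I J L)

/-- The functions `-g_i`, `h_j` and `c_ℓ` that are paired with the scaling factor `λ_i`. -/
noncomputable def block : I → Option (J ⊕ L) → EuclideanSpace ℝ (Fin d) → EReal
  | i, none => fun z => -D.g i z
  | _, some (.inl j) => D.h j
  | _, some (.inr l) => D.c l

theorem isPCC_block (hG : ∀ i, IsPCC (fun z => -D.g i z)) (hH : ∀ j, IsPCC (D.h j))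
    (hC : ∀ l, IsPCC (D.c l)) : ∀ i b, IsPCC (D.block i b)
  | i, none => hG i
  | _, some (.inl j) => hH j
  | _, some (.inr l) => hC l

/-- The name of the constraint on the perspective of a block function in (AD-B'). -/
def adbIneqName : I → Option (J ⊕ L) → ADBIneq I J L
  | i, none => .disutilityPiece i
  | i, some (.inl j) => .momentPiece i j
  | i, some (.inr l) => .supp i l

/-- The vectors `y⁽⁰⁾`, `y⁽¹⁾` and `y⁽²⁾` of (AP-W') as one family. -/
def dualVec (x : APWVar d I J L) : I → Option (J ⊕ L) → EuclideanSpace ℝ (Fin d)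
  | i, none => x.y0 i
  | i, some (.inl j) => x.y1 i j
  | i, some (.inr l) => x.y2 i l

/-- A change of the vectors and scaling factors that occur in the constraint of a piece. -/
def pieceShift [DecidableEq I] (i : I) (y : Option (J ⊕ L) → EuclideanSpace ℝ (Fin d))
    (s : J ⊕ L → ℝ) : APWVar d I J L :=
  (0, fun j => s (.inl j), Pi.single i (y none), Pi.single i fun j => y (some (.inl j)),
    Pi.single i fun l => y (some (.inr l)), Pi.single i fun l => s (.inr l))

theorem dualVec_add_pieceShift [DecidableEq I] (x : APWVar d I J L) (c : ℝ) (i : I)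
    (y : Option (J ⊕ L) → EuclideanSpace ℝ (Fin d)) (s : J ⊕ L → ℝ) (b : Option (J ⊕ L)) :
    dualVec (x + c • pieceShift i y s) i b = dualVec x i b + c • y b := by
  rcases b with _ | j | l <;>
    simp [dualVec, pieceShift, APWVar.y0, APWVar.y1, APWVar.y2]

theorem weight_add_pieceShift [DecidableEq I] (x : APWVar d I J L) (c : ℝ) (i : I)
    (y : Option (J ⊕ L) → EuclideanSpace ℝ (Fin d)) (s : J ⊕ L → ℝ) (b : J ⊕ L) :
    weight (x + c • pieceShift i y s).beta (x + c • pieceShift i y s).nu i (some b)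
      = weight x.beta x.nu i (some b) + c * s b := by
  rcases b with j | l <;> simp [weight, pieceShift, APWVar.beta, APWVar.nu]

theorem isLinearMap_pieceShift [DecidableEq I] (i : I) :
    IsLinearMap ℝ fun y : Option (J ⊕ L) → EuclideanSpace ℝ (Fin d) =>
      pieceShift i y (0 : J ⊕ L → ℝ) := by
  constructor
  · intro y y'
    ext <;> simp [pieceShift, Pi.single_apply] <;> split_ifs <;> simp
  · intro c y
    ext <;> simp [pieceShift, Pi.single_apply] <;> split_ifs <;> simp

variable [Fintype J] [Fintype L]

theorem apwIneq_piece (i : I) (x : APWVar d I J L) :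
    D.apwIneq (.piece i) x
      = ∑ b, persp (conj (D.block i b)) (dualVec x i b) (weight x.beta x.nu i b)
        - (x.alpha : EReal) := by
  simp only [apwIneq, Fintype.sum_option, Fintype.sum_sum_type, block, dualVec, weight, persp_one,
    add_assoc]

variable [Fintype I]

theorem adbIneq_adbIneqName (i : I) (b : Option (J ⊕ L)) (x : ADBVar d I J) :
    D.adbIneq (adbIneqName i b) x
      = persp (D.block i b) (x.ups i) (x.lam i) - (level L x.tau x.omega i b : EReal) := by
  rcases b with _ | j | l
  · simp only [adbIneqName, adbIneq, block, level, concavePersp, EReal.coe_neg]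
    rw [sub_eq_add_neg, sub_eq_add_neg, neg_neg, neg_neg, add_comm]
  · rfl
  · simp [adbIneqName, adbIneq, block, level]

variable {D}

theorem mem_adbConstraints_iff {x : ADBVar d I J} :
    x ∈ D.adbConstraints.set ↔ ∑ i, x.lam i = 1 ∧ (∀ j, ∑ i, x.omega i j ≤ D.mu j) ∧
      (∀ i, 0 ≤ x.lam i) ∧
      ∀ i b, persp (D.block i b) (x.ups i) (x.lam i) ≤ level L x.tau x.omega i b := by
  have key : ∀ i b, D.adbIneq (adbIneqName i b) x ≤ 0 ↔
      persp (D.block i b) (x.ups i) (x.lam i) ≤ level L x.tau x.omega i b := fun i b => by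
    rw [adbIneq_adbIneqName, ereal_sub_coe_nonpos_iff]
  constructor
  · rintro ⟨h₁, h₂⟩
    refine ⟨?_, fun j => ?_, fun i => ?_, fun i b => (key i b).1 (h₁ _)⟩
    · have : ((∑ i, x.lam i - 1 : ℝ) : EReal) = 0 := h₂ ()
      norm_cast at this
      linarith
    · have : ((∑ i, x.omega i j - D.mu j : ℝ) : EReal) ≤ 0 := h₁ (.moment j)
      norm_cast at this
      linarith
    · have : ((-x.lam i : ℝ) : EReal) ≤ 0 := h₁ (.lamSign i)
      norm_cast at this
      linarith
  · rintro ⟨h₁, h₂, h₃, h₄⟩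
    refine ⟨?_, fun _ => ?_⟩
    · rintro (j | ⟨i, l⟩ | ⟨i, j⟩ | i | i)
      · change ((∑ i, x.omega i j - D.mu j : ℝ) : EReal) ≤ 0
        have := h₂ j
        norm_cast
        linarith
      · exact (key i (some (.inr l))).2 (h₄ _ _)
      · exact (key i (some (.inl j))).2 (h₄ _ _)
      · exact (key i none).2 (h₄ _ _)
      · change ((-x.lam i : ℝ) : EReal) ≤ 0
        have := h₃ i
        norm_cast
        linarith
    · change ((∑ i, x.lam i - 1 : ℝ) : EReal) = 0
      norm_cast
      linarith

theorem mem_apwConstraints_iff (hf : ∀ i b, IsPCC (D.block i b)) {x : APWVar d I J L} :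
    x ∈ D.apwConstraints.set ↔ (∀ j, 0 ≤ x.beta j) ∧ (∀ i l, 0 ≤ x.nu i l) ∧
      (∀ i, ∑ b, dualVec x i b = 0) ∧ ∀ i, ∃ ρ : Option (J ⊕ L) → ℝ,
        (∀ b, persp (conj (D.block i b)) (dualVec x i b) (weight x.beta x.nu i b) ≤ ρ b) ∧
        ∑ b, ρ b ≤ x.alpha := by
  have hsum : ∀ i, ∑ b, dualVec x i b = x.y0 i + ∑ j, x.y1 i j + ∑ l, x.y2 i l := fun i => by
    simp only [Fintype.sum_option, Fintype.sum_sum_type, dualVec, add_assoc]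
  constructor
  · rintro ⟨h₁, h₂⟩
    refine ⟨fun j => ?_, fun i l => ?_, fun i => ?_, fun i => ?_⟩
    · have : ((-x.beta j : ℝ) : EReal) ≤ 0 := h₁ (.betaSign j)
      norm_cast at this
      linarith
    · have : ((-x.nu i l : ℝ) : EReal) ≤ 0 := h₁ (.nuSign i l)
      norm_cast at this
      linarith
    · rw [hsum]
      ext k
      have : (((x.y0 i + ∑ j, x.y1 i j + ∑ l, x.y2 i l) k : ℝ) : EReal) = 0 := h₂ (i, k)
      exact EReal.coe_eq_zero.1 this
    · have : D.apwIneq (.piece i) x ≤ 0 := h₁ (.piece i)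
      rw [apwIneq_piece, ereal_sub_coe_nonpos_iff] at this
      obtain ⟨ρ, hρ, h⟩ := exists_real_of_sum_le _ (fun b _ => (hf i b).bot_lt_persp_conj _ _) this
      exact ⟨ρ, fun b => (hρ b (Finset.mem_univ b)).le, h⟩
  · rintro ⟨h₁, h₂, h₃, h₄⟩
    refine ⟨?_, fun m => ?_⟩
    · rintro (i | j | ⟨i, l⟩)
      · change D.apwIneq (.piece i) x ≤ 0
        obtain ⟨ρ, hρ, h⟩ := h₄ i
        rw [apwIneq_piece, ereal_sub_coe_nonpos_iff]
        refine (Finset.sum_le_sum fun b _ => hρ b).trans ?_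
        rw [← coe_sum_ereal]
        exact_mod_cast h
      · change ((-x.beta j : ℝ) : EReal) ≤ 0
        have := h₁ j
        norm_cast
        linarith
      · change ((-x.nu i l : ℝ) : EReal) ≤ 0
        have := h₂ i l
        norm_cast
        linarith
    · change (((x.y0 m.1 + ∑ j, x.y1 m.1 j + ∑ l, x.y2 m.1 l) m.2 : ℝ) : EReal) = 0
      rw [← hsum, h₃]
      simp

/-- With all variables but `υ_i` fixed, the domain of the constraint is a scaled copy of the domain
of the block. -/
theorem isCorePoint_of_isSlaterPoint_adb {x : ADBVar d I J} (hx : D.adbConstraints.IsSlaterPoint x)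
    {i : I} (hlam : 0 < x.lam i) (b : Option (J ⊕ L)) :
    IsCorePoint (dom (D.block i b)) ((x.lam i)⁻¹ • x.ups i) := by
  classical
  have hdom : ∀ y : ADBVar d I J, y.lam i = x.lam i →
      (y ∈ dom (D.adbIneq (adbIneqName i b)) ↔ (x.lam i)⁻¹ • y.ups i ∈ dom (D.block i b)) := by
    intro y hy
    rw [dom, Set.mem_ofPred_eq, adbIneq_adbIneqName, ereal_sub_coe_lt_top_iff, hy, persp,
      if_pos hlam, dom, Set.mem_ofPred_eq, ereal_coe_pos_mul_lt_top_iff hlam]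
  have hri := hx.ri_ineq (adbIneqName i b)
  refine ⟨(hdom x rfl).1 (intrinsicInterior_subset hri), fun z hz => ?_⟩
  let y : ADBVar d I J := (x.tau, x.lam, x.omega, Function.update x.ups i (x.lam i • z))
  have hy : y ∈ dom (D.adbIneq (adbIneqName i b)) := by
    refine (hdom y rfl).2 ?_
    simpa [y, ADBVar.ups, inv_smul_smul₀ hlam.ne'] using hz
  obtain ⟨ε, hε, h⟩ := exists_pos_of_mem_intrinsicInterior hri hy
  refine ⟨ε, hε, ?_⟩
  have h' := (hdom _ (by simp [y, ADBVar.lam])).1 h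
  convert h' using 1
  have : (x - ε • (y - x)).ups i = x.ups i - ε • (x.lam i • z - x.ups i) := by
    simp [y, ADBVar.ups]
  have hz' : (x.lam i)⁻¹ • x.lam i • z = z := inv_smul_smul₀ hlam.ne' z
  rw [this]
  nth_rewrite 1 [← hz']
  module

/-- On the slice `λ = 1` the perspective is the function itself. Thus constraints exempt from
strictness come only from affine blocks. -/
theorem isAffineFun_of_isLinearOn_adb {i : I} {b : Option (J ⊕ L)}
    (h : IsLinearOn D.adbConstraints.ground (D.adbIneq (adbIneqName i b))) :
    IsAffineFun (D.block i b) := by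
  classical
  obtain ⟨a, ha⟩ := h
  refine isAffineFun_of_affineMap a (ι := fun z => ((0, 0, 0, Pi.single i z) : ADBVar d I J))
    ⟨fun x y => by simp [Pi.single_add], fun c x => by simp [Pi.single_smul]⟩
    (0, 1, 0, 0) (level L (0 : I → ℝ) (0 : I → J → ℝ) i b) fun z => ?_
  have := ha (0, 1, 0, Pi.single i z) fun i => by
    change (0 : ℝ) ≤ 1
    exact zero_le_one
  rw [adbIneq_adbIneqName] at this
  have h1 := eq_coe_add_of_sub_coe_eq this
  simp only [ADBVar.ups, ADBVar.lam, Pi.single_eq_same, Pi.one_apply, persp_one] at h1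
  rw [h1]
  simp [ADBVar.tau, ADBVar.omega]

theorem mem_dom_apwIneq_piece_iff (hf : ∀ i b, IsPCC (D.block i b)) {i : I} {x : APWVar d I J L} :
    x ∈ dom (D.apwIneq (.piece i)) ↔
      ∀ b, persp (conj (D.block i b)) (dualVec x i b) (weight x.beta x.nu i b) < ⊤ := by
  rw [dom, Set.mem_ofPred_eq, apwIneq_piece, ereal_sub_coe_lt_top_iff]
  have hbot := fun b => (hf i b).bot_lt_persp_conj (dualVec x i b) (weight x.beta x.nu i b)
  constructor
  · intro h b
    obtain ⟨r, hr, -⟩ := EReal.lt_iff_exists_real_btwn.1 h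
    obtain ⟨ρ, hρ, -⟩ := exists_real_of_sum_le _ (fun b _ => hbot b) hr.le
    rw [hρ b (Finset.mem_univ b)]
    exact EReal.coe_lt_top _
  · intro h
    rw [Finset.sum_congr rfl fun b _ => (EReal.coe_toReal (h b).ne (hbot b).ne').symm,
      ← coe_sum_ereal]
    exact EReal.coe_lt_top _

/-- Raising the scale by `1` can be done within the domain. Prolonging the segment backwards lowers
it by some `ε > 0`, and the result is still nonnegative because perspectives are `+∞` at negative
scales. -/
theorem weight_pos_of_isSlaterPoint_apw (hf : ∀ i b, IsPCC (D.block i b)) {x : APWVar d I J L}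
    (hx : D.apwConstraints.IsSlaterPoint x) (i : I) (b : Option (J ⊕ L)) :
    0 < weight x.beta x.nu i b := by
  classical
  rcases b with _ | b
  · exact zero_lt_one
  have hri := hx.ri_ineq (.piece i)
  have hmem := (mem_dom_apwIneq_piece_iff hf).1 (intrinsicInterior_subset hri)
  have h0 := nonneg_of_persp_lt_top (hmem (some b))
  obtain ⟨w, hw⟩ := (hf i (some b)).isProper_conj.2
  let s := weight x.beta x.nu i (some b)
  -- Moves the chosen block to scale `s + 1` and to the vector `(s + 1) • w`, with `w` in the domain
  -- of its conjugate.
  let S := pieceShift i (Pi.single (some b) ((s + 1) • w - dualVec x i (some b))) (Pi.single b 1)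
  have hy : x + (1 : ℝ) • S ∈ dom (D.apwIneq (.piece i)) := by
    refine (mem_dom_apwIneq_piece_iff hf).2 fun b' => ?_
    rw [dualVec_add_pieceShift]
    by_cases hb : b' = some b
    · subst hb
      rw [weight_add_pieceShift, Pi.single_eq_same, Pi.single_eq_same, one_smul,
        add_sub_cancel, mul_one, persp, if_pos (by positivity),
        inv_smul_smul₀ (by positivity)]
      obtain ⟨r, hr⟩ := (hf i (some b)).isProper_conj.exists_real hw
      rw [hr, ← EReal.coe_mul]
      exact EReal.coe_lt_top _
    · rw [Pi.single_eq_of_ne hb, smul_zero, add_zero]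
      rcases b' with _ | b'
      · exact hmem none
      · rw [weight_add_pieceShift, Pi.single_eq_of_ne (fun h => hb (by rw [h])), mul_zero, add_zero]
        exact hmem (some b')
  obtain ⟨ε, hε, h⟩ := exists_pos_of_mem_intrinsicInterior hri hy
  have e : x - ε • (x + (1 : ℝ) • S - x) = x + (-ε) • S := by module
  rw [e] at h
  have := nonneg_of_persp_lt_top ((mem_dom_apwIneq_piece_iff hf).1 h (some b))
  rw [weight_add_pieceShift, Pi.single_eq_same] at this
  linarith

/-- Only the vector of the block `b` is moved, at fixed scales; the other summands of the piece stay
finite. -/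
theorem isCorePoint_of_isSlaterPoint_apw (hf : ∀ i b, IsPCC (D.block i b)) {x : APWVar d I J L}
    (hx : D.apwConstraints.IsSlaterPoint x) (i : I) (b : Option (J ⊕ L)) :
    IsCorePoint (dom (conj (D.block i b))) ((weight x.beta x.nu i b)⁻¹ • dualVec x i b) := by
  classical
  have hpos := weight_pos_of_isSlaterPoint_apw hf hx i b
  set s := weight x.beta x.nu i b with hs
  have hri := hx.ri_ineq (.piece i)
  have hmem := (mem_dom_apwIneq_piece_iff hf).1 (intrinsicInterior_subset hri)
  have hdom : ∀ v, persp (conj (D.block i b)) v s < ⊤ ↔ s⁻¹ • v ∈ dom (conj (D.block i b)) := by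
    intro v
    rw [persp, if_pos hpos, dom, Set.mem_ofPred_eq, ereal_coe_pos_mul_lt_top_iff hpos]
  have hw0 : ∀ (c : ℝ) y b', weight (x + c • pieceShift i y (0 : J ⊕ L → ℝ)).beta
      (x + c • pieceShift i y (0 : J ⊕ L → ℝ)).nu i b' = weight x.beta x.nu i b' := by
    rintro c y (_ | b')
    · rfl
    · rw [weight_add_pieceShift, Pi.zero_apply, mul_zero, add_zero]
  refine ⟨(hdom _).1 (hmem b), fun w hw => ?_⟩
  let S : APWVar d I J L := pieceShift i (Pi.single b (s • w - dualVec x i b)) (0 : J ⊕ L → ℝ)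
  have hy : x + (1 : ℝ) • S ∈ dom (D.apwIneq (.piece i)) := by
    refine (mem_dom_apwIneq_piece_iff hf).2 fun b' => ?_
    rw [dualVec_add_pieceShift, hw0]
    by_cases hb : b' = b
    · subst hb
      rw [← hs, hdom, Pi.single_eq_same, one_smul, add_sub_cancel, inv_smul_smul₀ hpos.ne']
      exact hw
    · rw [Pi.single_eq_of_ne hb, smul_zero, add_zero]
      exact hmem b'
  obtain ⟨ε, hε, h⟩ := exists_pos_of_mem_intrinsicInterior hri hy
  have e : x - ε • (x + (1 : ℝ) • S - x) = x + (-ε) • S := by module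
  rw [e] at h
  have := (mem_dom_apwIneq_piece_iff hf).1 h b
  rw [dualVec_add_pieceShift, hw0, ← hs, hdom, Pi.single_eq_same] at this
  refine ⟨ε, hε, ?_⟩
  convert this using 1
  rw [smul_add, smul_smul _ (-ε), mul_comm, mul_smul, smul_sub s⁻¹, inv_smul_smul₀ hpos.ne']
  module

/-- When all scales are `1` the constraint is a sum of conjugates in separate variables. If the sum
is affine, then so is each summand, the others being constant when only one vector varies. -/
theorem isAffineFun_of_isLinearOn_apw (hf : ∀ i b, IsPCC (D.block i b)) {i : I}
    (h : IsLinearOn D.apwConstraints.ground (D.apwIneq (.piece i))) (b : Option (J ⊕ L)) :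
    IsAffineFun (conj (D.block i b)) := by
  classical
  obtain ⟨a, ha⟩ := h
  let x₀ : APWVar d I J L := (0, 1, 0, 0, 0, 1)
  have hw : ∀ (b' : Option (J ⊕ L)), weight (1 : J → ℝ) (1 : I → L → ℝ) i b' = 1 := by
    rintro (_ | _ | _) <;> rfl
  have key : ∀ z, ∃ ρ : Option (J ⊕ L) → ℝ,
      (∀ b', conj (D.block i b') (Pi.single (M := fun _ => EuclideanSpace ℝ (Fin d)) b z b') = ρ b') ∧
      ∑ b', ρ b' = a (pieceShift i (Pi.single b z) 0 + x₀) := by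
    intro z
    have h1 := ha (pieceShift i (Pi.single b z) 0 + x₀) (by
      constructor
      · intro j; simp [APWVar.beta, pieceShift, x₀]
      · intro i' l
        rcases eq_or_ne i' i with rfl | hi <;> simp [APWVar.nu, pieceShift, x₀, *])
    change D.apwIneq (.piece i) _ = _ at h1
    rw [apwIneq_piece] at h1
    have e1 : ∀ b', dualVec (pieceShift i (Pi.single b z) (0 : J ⊕ L → ℝ) + x₀) i b'
        = Pi.single (M := fun _ => EuclideanSpace ℝ (Fin d)) b z b' := fun b' => by
      rw [add_comm, ← one_smul ℝ (pieceShift _ _ _), dualVec_add_pieceShift, one_smul]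
      rcases b' with _ | _ | _ <;> simp [dualVec, x₀, APWVar.y0, APWVar.y1, APWVar.y2]
    have e2 : (pieceShift i (Pi.single b z) (0 : J ⊕ L → ℝ) + x₀).beta = 1 := by
      ext j; simp [APWVar.beta, pieceShift, x₀]
    have e3 : (pieceShift i (Pi.single b z) (0 : J ⊕ L → ℝ) + x₀).nu = 1 := by
      ext i' l
      rcases eq_or_ne i' i with rfl | hi <;> simp [APWVar.nu, pieceShift, x₀, *]
    have e4 : (pieceShift i (Pi.single b z) (0 : J ⊕ L → ℝ) + x₀).alpha = 0 := by
      simp [APWVar.alpha, pieceShift, x₀]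
    simp only [e1, e2, e3, e4, hw, persp_one, EReal.coe_zero, sub_zero] at h1
    obtain ⟨ρ, hρ, -⟩ := exists_real_of_sum_le _
      (fun b' _ => (hf i b').isProper_conj.1 _) h1.le
    refine ⟨ρ, fun b' => hρ b' (Finset.mem_univ b'), ?_⟩
    rw [Finset.sum_congr rfl hρ, ← coe_sum_ereal] at h1
    exact_mod_cast h1
  obtain ⟨ρ₀, hρ₀, -⟩ := key 0
  refine isAffineFun_of_affineMap a
    (ι := fun z => pieceShift i (Pi.single b z) (0 : J ⊕ L → ℝ))
    ⟨fun x y => by rw [Pi.single_add, (isLinearMap_pieceShift i).map_add],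
      fun c x => by rw [Pi.single_smul, (isLinearMap_pieceShift i).map_smul]⟩
    x₀ (-∑ b' ∈ Finset.univ.erase b, ρ₀ b') fun z => ?_
  · obtain ⟨ρ, hρ, hs⟩ := key z
    have hb := hρ b
    rw [Pi.single_eq_same] at hb
    rw [hb, ← hs, ← Finset.add_sum_erase _ _ (Finset.mem_univ b)]
    have : ∑ b' ∈ Finset.univ.erase b, ρ b' = ∑ b' ∈ Finset.univ.erase b, ρ₀ b' := by
      refine Finset.sum_congr rfl fun b' hb' => ?_
      have h1 := hρ b'
      have h2 := hρ₀ b'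
      rw [Pi.single_eq_of_ne (Finset.ne_of_mem_erase hb')] at h1 h2
      rw [h1] at h2
      exact_mod_cast h2
    rw [this, add_neg_cancel_right]

end Data

end UQ

namespace UQ

set_option linter.unusedSectionVars false

/-! ### Weak duality and the comparison of (AP-W), (D-UQ), (AD-B) and (FR) -/

namespace Data

variable {d : ℕ} {I J L : Type*} [Fintype I] [Fintype J] [Fintype L] {D : Data d I J L}

/-- The primal block of (AD-B') at scaling factor `1`. -/
theorem mem_augSupport_iff {i : I} {p : EuclideanSpace ℝ (Fin d) × (J → ℝ) × ℝ} :
    p ∈ D.augSupport i ↔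
      ∀ b, D.block i b p.1 ≤ level L (fun _ : I => p.2.2) (fun _ => p.2.1) i b := by
  constructor
  · rintro ⟨h₁, h₂, h₃⟩ (_ | j | l)
    · simp only [block, level, EReal.coe_neg, EReal.neg_le_neg_iff]; exact h₃
    · exact h₂ j
    · exact h₁ l
  · intro h
    refine ⟨fun l => h (some (.inr l)), fun j => h (some (.inl j)), ?_⟩
    have := h none
    simpa only [block, level, EReal.coe_neg, EReal.neg_le_neg_iff] using this

/-- Weak duality between the pieces of (AD-B') and (AP-W'). -/
theorem weak_duality_piece (hf : ∀ i b, IsPCC (D.block i b)) {i : I}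
    {v : EuclideanSpace ℝ (Fin d)} {t : ℝ} {τ : I → ℝ} {ω : I → J → ℝ}
    {y : Option (J ⊕ L) → EuclideanSpace ℝ (Fin d)} {ρ : Option (J ⊕ L) → ℝ} {α : ℝ} {β : J → ℝ}
    {ν : I → L → ℝ} (ht : 0 ≤ t) (h₁ : ∀ b, persp (D.block i b) v t ≤ level L τ ω i b)
    (h₂ : ∀ b, persp (conj (D.block i b)) (y b) (weight β ν i b) ≤ ρ b)
    (hy : ∑ b, y b = 0) (hρ : ∑ b, ρ b ≤ α) : τ i ≤ ∑ j, ω i j * β j + t * α := by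
  have h := Finset.sum_le_sum fun b (_ : b ∈ Finset.univ) =>
    (hf i b).inner_le_of_persp_le (h₁ b) (h₂ b)
  rw [← inner_sum, hy, inner_zero_right, Finset.sum_add_distrib, ← Finset.mul_sum,
    Fintype.sum_option, Fintype.sum_sum_type] at h
  simp only [weight, level, mul_zero, Finset.sum_const_zero, add_zero, one_mul] at h
  have := mul_le_mul_of_nonneg_left hρ ht
  have e : ∑ j, ω i j * β j = ∑ j, β j * ω i j := Finset.sum_congr rfl fun _ _ => mul_comm _ _
  linarith

theorem mem_apwSet_of_mem_apwConstraints (hf : ∀ i b, IsPCC (D.block i b)) {x : APWVar d I J L}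
    (hx : x ∈ D.apwConstraints.set) : (x.alpha, x.beta) ∈ D.apwSet := by
  obtain ⟨hβ, hν, hy, h⟩ := (mem_apwConstraints_iff hf).1 hx
  refine ⟨fun i => iSup₂_le fun p hp => ?_, hβ⟩
  obtain ⟨ρ, hρ, hα⟩ := h i
  have := weak_duality_piece hf zero_le_one
    (fun b => by rw [persp_one]; exact mem_augSupport_iff.1 hp b) hρ (hy i) hα
  norm_cast
  simp only at this ⊢
  linarith

theorem adb_le_apw (hf : ∀ i b, IsPCC (D.block i b)) {x : ADBVar d I J} {y : APWVar d I J L}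
    (hx : x ∈ D.adbConstraints.set) (hy : y ∈ D.apwConstraints.set) :
    ∑ i, x.tau i ≤ y.alpha + ∑ j, D.mu j * y.beta j := by
  obtain ⟨hlam, hmu, hlam0, h₁⟩ := mem_adbConstraints_iff.1 hx
  obtain ⟨hβ, hν, hy, h⟩ := (mem_apwConstraints_iff hf).1 hy
  have key : ∀ i, x.tau i ≤ ∑ j, x.omega i j * y.beta j + x.lam i * y.alpha := fun i => by
    obtain ⟨ρ, hρ, hα⟩ := h i
    exact weak_duality_piece hf (hlam0 i) (h₁ i) hρ (hy i) hα
  calc ∑ i, x.tau i ≤ ∑ i, (∑ j, x.omega i j * y.beta j + x.lam i * y.alpha) :=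
        Finset.sum_le_sum fun i _ => key i
    _ = y.alpha + ∑ j, (∑ i, x.omega i j) * y.beta j := by
        rw [Finset.sum_add_distrib, ← Finset.sum_mul, hlam, one_mul, Finset.sum_comm, add_comm]
        simp only [Finset.sum_mul]
    _ ≤ _ := by
        gcongr with j
        · exact hβ j
        · exact hmu j

theorem disutility_lt_top [Nonempty I] (hf : ∀ i b, IsPCC (D.block i b))
    (z : EuclideanSpace ℝ (Fin d)) : D.disutility z < ⊤ := by
  obtain ⟨i, hi⟩ := exists_eq_ciSup_of_finite (f := fun i => D.g i z)
  rw [disutility, ← hi, ← EReal.neg_bot, EReal.lt_neg_comm]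
  exact (hf i none).proper.1 z

theorem exists_real_of_mem_effSupport [Nonempty I] (hf : ∀ i b, IsPCC (D.block i b))
    {z : EuclideanSpace ℝ (Fin d)} (hz : z ∈ D.effSupport) :
    (∃ r : ℝ, D.disutility z = r) ∧ ∃ u : J → ℝ, ∀ j, D.h j z = u j := by
  obtain ⟨i, hzi⟩ := Set.mem_iUnion.1 hz
  obtain ⟨-, hh, hg⟩ := hzi
  constructor
  · have h1 : ⊥ < D.g i z := by
      have : -D.g i z < ⊤ := hg
      rwa [EReal.neg_lt_comm, EReal.neg_top] at this
    have h2 : ⊥ < D.disutility z := h1.trans_le (le_iSup (fun i => D.g i z) i)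
    exact ⟨_, (EReal.coe_toReal (disutility_lt_top hf z).ne h2.ne').symm⟩
  · choose u hu using fun j => (hf i (some (.inl j))).proper.exists_real (hh j)
    exact ⟨u, hu⟩

theorem mem_effSupport_of_mem_augSupport {i : I} {p : EuclideanSpace ℝ (Fin d) × (J → ℝ) × ℝ}
    (hp : p ∈ D.augSupport i) : p.1 ∈ D.effSupport := by
  refine Set.mem_iUnion.2 ⟨i, hp.1, fun j => (hp.2.1 j).trans_lt (EReal.coe_lt_top _), ?_⟩
  change -D.g i p.1 < ⊤
  rw [EReal.neg_lt_comm, EReal.neg_top]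
  exact (EReal.bot_lt_coe _).trans_le hp.2.2

theorem exists_mem_augSupport [Nonempty I] {z : EuclideanSpace ℝ (Fin d)} (hz : z ∈ D.support)
    {u : J → ℝ} (hu : ∀ j, D.h j z ≤ u j) {r : ℝ} (hr : D.disutility z = r) :
    ∃ i, (z, u, r) ∈ D.augSupport i := by
  obtain ⟨i, hi⟩ := exists_eq_ciSup_of_finite (f := fun i => D.g i z)
  exact ⟨i, hz, hu, by rw [← hr, disutility, ← hi]⟩

theorem support_of_mem_effSupport {z : EuclideanSpace ℝ (Fin d)} (hz : z ∈ D.effSupport) :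
    z ∈ D.support := by
  obtain ⟨i, hzi⟩ := Set.mem_iUnion.1 hz
  exact hzi.1

theorem mem_duqSet_iff [Nonempty I] (hf : ∀ i b, IsPCC (D.block i b)) {x : ℝ × (J → ℝ)} :
    x ∈ D.duqSet ↔ (∀ z ∈ D.effSupport, ∀ (r : ℝ) (u : J → ℝ), D.disutility z = r →
      (∀ j, D.h j z = u j) → r ≤ x.1 + ∑ j, u j * x.2 j) ∧ ∀ j, 0 ≤ x.2 j := by
  have key : ∀ (z : EuclideanSpace ℝ (Fin d)) (r : ℝ) (u : J → ℝ), D.disutility z = r →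
      (∀ j, D.h j z = u j) → D.disutility z - (x.1 : EReal) - ∑ j, D.h j z * (x.2 j : EReal)
        = ((r - x.1 - ∑ j, u j * x.2 j : ℝ) : EReal) := fun z r u hr hu => by
    simp only [hr, hu, ← EReal.coe_mul, ← coe_sum_ereal, EReal.coe_sub]
  refine and_congr_left fun _ => ?_
  rw [iSup₂_le_iff]
  refine forall₂_congr fun z hz => ?_
  obtain ⟨⟨r, hr⟩, u, hu⟩ := exists_real_of_mem_effSupport hf hz
  rw [key z r u hr hu]
  norm_cast
  constructor
  · intro h r' u' hr' hu'
    rw [hr] at hr'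
    norm_cast at hr'
    have : u = u' := funext fun j => by
      have := hu' j
      rw [hu] at this
      exact_mod_cast this
    subst hr' this
    linarith
  · intro h
    linarith [h r u hr hu]

/-- Since `β ≥ 0`, the constraint over `U_i` is tightest at `u = h z` and `t = g_i z`, and a maximal
`g_i z` is `g z`. -/
theorem apwSet_eq_duqSet [Nonempty I] (hf : ∀ i b, IsPCC (D.block i b)) : D.apwSet = D.duqSet := by
  ext x
  rw [mem_duqSet_iff hf]
  refine and_congr_left fun hβ => ?_
  constructor
  · intro h z hz r u hr hu
    obtain ⟨i, hi⟩ := exists_mem_augSupport (support_of_mem_effSupport hz)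
      (fun j => (hu j).le) hr
    have := iSup₂_le_iff.1 (h i) _ hi
    norm_cast at this
    simp only at this
    linarith
  · intro h i
    refine iSup₂_le fun p hp => ?_
    have hz := mem_effSupport_of_mem_augSupport hp
    obtain ⟨⟨r, hr⟩, u, hu⟩ := exists_real_of_mem_effSupport hf hz
    have h1 := h _ hz r u hr hu
    have h2 : p.2.2 ≤ r := by
      have : (p.2.2 : EReal) ≤ r := by
        rw [← hr]
        exact hp.2.2.trans (le_iSup (fun i => D.g i p.1) i)
      exact_mod_cast this
    have h3 : ∑ j, u j * x.2 j ≤ ∑ j, p.2.1 j * x.2 j := Finset.sum_le_sum fun j _ => by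
      have := hp.2.1 j
      rw [hu] at this
      norm_cast at this
      exact mul_le_mul_of_nonneg_right this (hβ j)
    norm_cast
    linarith

theorem adbObj_le_frValue [Nonempty I] (hf : ∀ i b, IsPCC (D.block i b))
    {x : (I → ℝ) × (I → EuclideanSpace ℝ (Fin d) × (J → ℝ) × ℝ)} (hx : x ∈ D.adbSet) :
    (x.1, fun i => (x.2 i).1) ∈ D.frSet ∧
      D.adbObj x ≤ D.frObj (x.1, fun i => (x.2 i).1) := by
  obtain ⟨h₁, h₂, h₃, h₄⟩ := hx
  have hz := fun i => mem_effSupport_of_mem_augSupport (h₃ i)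
  choose r hr using fun i => (exists_real_of_mem_effSupport hf (hz i)).1
  choose u hu using fun i => (exists_real_of_mem_effSupport hf (hz i)).2
  refine ⟨⟨h₁, fun j => ?_, hz, h₄⟩, ?_⟩
  · simp only [hu, ← EReal.coe_mul, ← coe_sum_ereal]
    norm_cast
    refine le_trans (Finset.sum_le_sum fun i _ => mul_le_mul_of_nonneg_left ?_ (h₄ i)) (h₂ j)
    have := (h₃ i).2.1 j
    rw [hu] at this
    exact_mod_cast this
  · simp only [adbObj, frObj, hr, ← EReal.coe_mul, ← coe_sum_ereal]
    norm_cast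
    refine Finset.sum_le_sum fun i _ => mul_le_mul_of_nonneg_left ?_ (h₄ i)
    have : ((x.2 i).2.2 : EReal) ≤ r i := by
      rw [← hr]
      exact (h₃ i).2.2.trans (le_iSup (fun i' => D.g i' (x.2 i).1) i)
    exact_mod_cast this

theorem exists_adbCvxObj_eq
    {x : (I → ℝ) × (I → EuclideanSpace ℝ (Fin d) × (J → ℝ) × ℝ)} (hx : x ∈ D.adbSet) :
    ∃ y ∈ D.adbConstraints.set, D.adbObj x = D.adbCvxObj y := by
  obtain ⟨h₁, h₂, h₃, h₄⟩ := hx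
  refine ⟨(fun i => x.1 i * (x.2 i).2.2, x.1, fun i j => x.1 i * (x.2 i).2.1 j,
    fun i => x.1 i • (x.2 i).1), mem_adbConstraints_iff.2 ⟨h₁, h₂, h₄, fun i b => ?_⟩, rfl⟩
  have hlev : level L (fun i => x.1 i * (x.2 i).2.2) (fun i j => x.1 i * (x.2 i).2.1 j) i b
      = x.1 i * level L (fun _ : I => (x.2 i).2.2) (fun _ => (x.2 i).2.1) i b := by
    rcases b with _ | _ | _ <;> simp [level]
  change persp (D.block i b) (x.1 i • (x.2 i).1) (x.1 i) ≤ _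
  have := mem_augSupport_iff.1 (h₃ i) b
  rcases (h₄ i).eq_or_lt with h0 | h0
  -- At `λ_i = 0` the scaled vector is `0`, where a support function is at most `0`.
  · refine le_trans ?_ (EReal.coe_le_coe_iff.2 hlev.ge)
    rw [← h0, zero_smul, zero_mul, persp_zero_le_iff]
    simp
  · rw [persp_le_iff_of_pos h0, inv_smul_smul₀ h0.ne']
    refine this.trans_eq ?_
    rw [EReal.coe_eq_coe_iff, eq_div_iff h0.ne', mul_comm]
    exact hlev.symm

end Data
end UQ

namespace UQ

set_option linter.unusedSectionVars false

/-! ### Expectations of functions that are almost everywhere finite -/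

section Expectation

variable {Ω : Type*} [MeasurableSpace Ω] {P : Measure Ω}

theorem lintegral_toENNReal_of_integrable {f : Ω → EReal} {r : Ω → ℝ} (h : ∀ᵐ z ∂P, f z = r z)
    (hr : Integrable r P) :
    ∫⁻ z, (f z).toENNReal ∂P ≠ ⊤ ∧ ∫⁻ z, (-f z).toENNReal ∂P ≠ ⊤ ∧
      ((∫⁻ z, (f z).toENNReal ∂P : ENNReal) : EReal)
        - ((∫⁻ z, (-f z).toENNReal ∂P : ENNReal) : EReal) = ((∫ z, r z ∂P : ℝ) : EReal) := by
  have h1 : ∫⁻ z, (f z).toENNReal ∂P = ∫⁻ z, ENNReal.ofReal (r z) ∂P :=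
    lintegral_congr_ae (h.mono fun z hz => by
      simp only [hz]
      rw [EReal.toENNReal_of_ne_top (EReal.coe_ne_top _), EReal.toReal_coe])
  have h2 : ∫⁻ z, (-f z).toENNReal ∂P = ∫⁻ z, ENNReal.ofReal (-r z) ∂P :=
    lintegral_congr_ae (h.mono fun z hz => by
      simp only [hz, ← EReal.coe_neg]
      rw [EReal.toENNReal_of_ne_top (EReal.coe_ne_top _), EReal.toReal_coe])
  have h3 : ∫⁻ z, ENNReal.ofReal (r z) ∂P ≠ ⊤ := hr.lintegral_lt_top.ne
  have h4 : ∫⁻ z, ENNReal.ofReal (-r z) ∂P ≠ ⊤ := hr.neg.lintegral_lt_top.ne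
  refine ⟨h1 ▸ h3, h2 ▸ h4, ?_⟩
  rw [h1, h2, integral_eq_lintegral_pos_part_sub_lintegral_neg_part hr, EReal.coe_sub,
    EReal.coe_ennreal_toReal h3, EReal.coe_ennreal_toReal h4]

theorem expectBot_eq_integral {f : Ω → EReal} {r : Ω → ℝ} (h : ∀ᵐ z ∂P, f z = r z)
    (hr : Integrable r P) : expectBot P f = ((∫ z, r z ∂P : ℝ) : EReal) := by
  obtain ⟨h1, -, h3⟩ := lintegral_toENNReal_of_integrable h hr
  rw [expectBot, if_neg fun hc => h1 hc.1, h3]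

theorem expectTop_eq_integral {f : Ω → EReal} {r : Ω → ℝ} (h : ∀ᵐ z ∂P, f z = r z)
    (hr : Integrable r P) : expectTop P f = ((∫ z, r z ∂P : ℝ) : EReal) := by
  obtain ⟨h1, -, h3⟩ := lintegral_toENNReal_of_integrable h hr
  rw [expectTop, if_neg fun hc => h1 hc.1, h3]

theorem lintegral_pos_ne_top_of_expectTop_le {f : Ω → EReal} {a : ℝ} (h : expectTop P f ≤ a) :
    ∫⁻ z, (f z).toENNReal ∂P ≠ ⊤ := by
  intro hc
  unfold expectTop at h
  split_ifs at h with h1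
  · simp at h
  · have h2 : ∫⁻ z, (-f z).toENNReal ∂P ≠ ⊤ := fun h2 => h1 ⟨hc, h2⟩
    rw [hc, ← EReal.coe_ennreal_toReal h2, EReal.coe_ennreal_top, EReal.top_sub_coe] at h
    simp at h

theorem lintegral_neg_ne_top_of_expectBot_ne {f : Ω → EReal} (h : expectBot P f ≠ ⊥) :
    ∫⁻ z, (-f z).toENNReal ∂P ≠ ⊤ := by
  intro hc
  unfold expectBot at h
  split_ifs at h with h1
  · exact h rfl
  · rw [hc, EReal.coe_ennreal_top, EReal.sub_top] at h
    exact h rfl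

end Expectation

/-! ### Weak duality for (P-UQ), and discrete distributions -/

namespace Data

variable {d : ℕ} {I J L : Type*} [Fintype I] [Fintype J] [Fintype L] {D : Data d I J L}

theorem measurable_block (hf : ∀ i b, IsPCC (D.block i b)) (i : I) (b : Option (J ⊕ L)) :
    Measurable (D.block i b) :=
  (hf i b).closed.1.measurable

theorem measurable_disutility (hf : ∀ i b, IsPCC (D.block i b)) : Measurable D.disutility := by
  refine Measurable.iSup fun i => ?_
  have h : Measurable fun z => -(-D.g i z) :=
    continuous_neg.measurable.comp (measurable_block hf i none)
  simpa only [neg_neg] using h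

/-- The constraint of (D-UQ) is integrated. Unless the objective is `-∞`, the negative part of `g`
is integrable; the moment bounds make the positive parts of the `h_j` integrable. Hence almost every
point lies in `S̄`, and the constraint bounds `g` from above and then each `h_j β_j` from below by
integrable functions. -/
theorem puqObj_le_duqObj [Nonempty I] (hf : ∀ i b, IsPCC (D.block i b))
    {P : Measure (EuclideanSpace ℝ (Fin d))} (hP : P ∈ D.ambiguitySet) {x : ℝ × (J → ℝ)}
    (hx : x ∈ D.duqSet) : D.puqObj P ≤ D.duqObj x := by
  obtain ⟨hprob, hsupp, hmom⟩ := hP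
  obtain ⟨hx, hβ⟩ := (mem_duqSet_iff hf).1 hx
  by_cases hbot : expectBot P D.disutility = ⊥
  · rw [puqObj, hbot]
    exact bot_le
  obtain ⟨i₀⟩ := ‹Nonempty I›
  have hmg := measurable_disutility hf
  have hmh : ∀ j, Measurable (D.h j) := fun j => measurable_block hf i₀ (some (.inl j))
  have hn := lintegral_neg_ne_top_of_expectBot_ne hbot
  have hp := fun j => lintegral_pos_ne_top_of_expectTop_le (hmom j)
  have hmn : Measurable fun z => (-D.disutility z).toENNReal :=
    (continuous_neg.measurable.comp hmg).ereal_toENNReal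
  have hin : Integrable (fun z => (-D.disutility z).toENNReal.toReal) P :=
    integrable_toReal_of_lintegral_ne_top hmn.aemeasurable hn
  have hip : ∀ j, Integrable (fun z => (D.h j z).toENNReal.toReal) P := fun j =>
    integrable_toReal_of_lintegral_ne_top (hmh j).ereal_toENNReal.aemeasurable (hp j)
  have hg : ∀ᵐ z ∂P, -D.disutility z ≠ ⊤ := (ae_lt_top hmn hn).mono fun z hz =>
    EReal.toENNReal_ne_top_iff.1 hz.ne
  have hh : ∀ᵐ z ∂P, ∀ j, D.h j z ≠ ⊤ := ae_all_iff.2 fun j =>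
    (ae_lt_top (hmh j).ereal_toENNReal (hp j)).mono fun z hz => EReal.toENNReal_ne_top_iff.1 hz.ne
  have hs : ∀ᵐ z ∂P, z ∈ D.support := hsupp
  have heff : ∀ᵐ z ∂P, z ∈ D.effSupport := by
    filter_upwards [hg, hh, hs] with z h1 h2 h3
    obtain ⟨i, hi⟩ := exists_eq_ciSup_of_finite (f := fun i => D.g i z)
    refine Set.mem_iUnion.2 ⟨i, h3, fun j => lt_top_iff_ne_top.2 (h2 j), ?_⟩
    change -D.g i z < ⊤
    rw [lt_top_iff_ne_top, hi]
    exact h1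
  let G : EuclideanSpace ℝ (Fin d) → ℝ := fun z => (D.disutility z).toReal
  let H : J → EuclideanSpace ℝ (Fin d) → ℝ := fun j z => (D.h j z).toReal
  have hGe : ∀ᵐ z ∂P, D.disutility z = G z := heff.mono fun z hz => by
    obtain ⟨⟨r, hr⟩, -⟩ := exists_real_of_mem_effSupport hf hz
    simp [G, hr]
  have hHe : ∀ᵐ z ∂P, ∀ j, D.h j z = H j z := heff.mono fun z hz j => by
    obtain ⟨-, u, hu⟩ := exists_real_of_mem_effSupport hf hz
    simp [H, hu]
  have hle : ∀ᵐ z ∂P, G z ≤ x.1 + ∑ j, H j z * x.2 j := by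
    filter_upwards [heff, hGe, hHe] with z h1 h2 h3
    exact hx z h1 _ _ h2 h3
  have hHp : ∀ᵐ z ∂P, ∀ j, H j z ≤ (D.h j z).toENNReal.toReal := hHe.mono fun z hz j => by
    rw [hz, EReal.toENNReal_of_ne_top (EReal.coe_ne_top _), EReal.toReal_coe, ENNReal.toReal_ofReal']
    exact le_max_left _ _
  have hGn : ∀ᵐ z ∂P, -(-D.disutility z).toENNReal.toReal ≤ G z := hGe.mono fun z hz => by
    rw [hz, ← EReal.coe_neg, EReal.toENNReal_of_ne_top (EReal.coe_ne_top _), EReal.toReal_coe,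
      ENNReal.toReal_ofReal']
    linarith [le_max_left (-G z) 0]
  have hsum : Integrable (fun z => ∑ j, (D.h j z).toENNReal.toReal * x.2 j) P :=
    integrable_finsetSum _ fun j _ => (hip j).mul_const _
  have hGi : Integrable G P := by
    refine integrable_of_le_of_le hmg.ereal_toReal.aestronglyMeasurable hGn ?_ hin.neg
      ((integrable_const x.1).add hsum)
    filter_upwards [hle, hHp] with z h1 h2
    refine h1.trans (add_le_add le_rfl (Finset.sum_le_sum fun j _ => ?_))
    exact mul_le_mul_of_nonneg_right (h2 j) (hβ j)
  -- Only the products are claimed integrable: when `β_j = 0` nothing controls the negative part of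
  -- `h_j`.
  have hHi : ∀ j, Integrable (fun z => H j z * x.2 j) P := fun j => by
    classical
    refine integrable_of_le_of_le (g₁ := fun z => G z - x.1 -
        ∑ j, (D.h j z).toENNReal.toReal * x.2 j) (g₂ := fun z => (D.h j z).toENNReal.toReal * x.2 j)
      ((hmh j).ereal_toReal.mul_const _).aestronglyMeasurable ?_ ?_
      ((hGi.sub (integrable_const x.1)).sub hsum) ((hip j).mul_const _)
    · filter_upwards [hle, hHp] with z h1 h2
      rw [← Finset.add_sum_erase _ _ (Finset.mem_univ j)] at h1 ⊢
      have h3 : ∑ k ∈ Finset.univ.erase j, H k z * x.2 k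
          ≤ ∑ k ∈ Finset.univ.erase j, (D.h k z).toENNReal.toReal * x.2 k :=
        Finset.sum_le_sum fun k _ => mul_le_mul_of_nonneg_right (h2 k) (hβ k)
      have h4 : 0 ≤ (D.h j z).toENNReal.toReal * x.2 j :=
        mul_nonneg ENNReal.toReal_nonneg (hβ j)
      linarith
    · filter_upwards [hHp] with z h2
      exact mul_le_mul_of_nonneg_right (h2 j) (hβ j)
  have hbound : ∀ j, ∫ z, H j z * x.2 j ∂P ≤ D.mu j * x.2 j := fun j => by
    rcases (hβ j).eq_or_lt with h0 | h0
    · simp [← h0]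
    · have hHj : Integrable (H j) P := by
        have := (hHi j).mul_const (x.2 j)⁻¹
        simpa only [mul_inv_cancel_right₀ h0.ne'] using this
      have := hmom j
      rw [expectTop_eq_integral (hHe.mono fun z hz => hz j) hHj] at this
      rw [integral_mul_const]
      exact mul_le_mul_of_nonneg_right (by exact_mod_cast this) (hβ j)
  rw [puqObj, expectBot_eq_integral hGe hGi, duqObj, EReal.coe_le_coe_iff]
  calc ∫ z, G z ∂P ≤ ∫ z, (x.1 + ∑ j, H j z * x.2 j) ∂P :=
        integral_mono_ae hGi ((integrable_const _).add (integrable_finsetSum _ fun j _ => hHi j)) hle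
    _ = x.1 + ∑ j, ∫ z, H j z * x.2 j ∂P := by
        rw [integral_add (integrable_const _) (integrable_finsetSum _ fun j _ => hHi j),
          integral_finsetSum _ fun j _ => hHi j]
        simp
    _ ≤ _ := add_le_add le_rfl (Finset.sum_le_sum fun j _ => hbound j)

theorem mem_ambiguitySet_of_mem_frSet [Nonempty I] (hf : ∀ i b, IsPCC (D.block i b))
    {x : (I → ℝ) × (I → EuclideanSpace ℝ (Fin d))} (hx : x ∈ D.frSet) :
    ∑ i, ENNReal.ofReal (x.1 i) • Measure.dirac (x.2 i) ∈ D.ambiguitySet ∧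
      D.puqObj (∑ i, ENNReal.ofReal (x.1 i) • Measure.dirac (x.2 i)) = D.frObj x := by
  obtain ⟨h₁, h₂, h₃, h₄⟩ := hx
  set P : Measure (EuclideanSpace ℝ (Fin d)) :=
    ∑ i, ENNReal.ofReal (x.1 i) • Measure.dirac (x.2 i) with hP
  have hae : ∀ {p : EuclideanSpace ℝ (Fin d) → Prop}, (∀ i, p (x.2 i)) → ∀ᵐ z ∂P, p z := by
    intro p hp
    rw [ae_iff, hP, Measure.finsetSum_apply]
    refine Finset.sum_eq_zero fun i _ => ?_
    rw [Measure.smul_apply, Measure.dirac_apply]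
    simp [hp i]
  have hint : ∀ r : EuclideanSpace ℝ (Fin d) → ℝ, Integrable r P ∧
      ∫ z, r z ∂P = ∑ i, x.1 i * r (x.2 i) := by
    intro r
    have h : ∀ i ∈ Finset.univ,
        Integrable r (ENNReal.ofReal (x.1 i) • Measure.dirac (x.2 i)) := fun i _ =>
      (integrable_dirac (by simp)).smul_measure ENNReal.ofReal_ne_top
    refine ⟨integrable_finsetSum_measure.2 h, ?_⟩
    rw [hP, integral_finsetSum_measure h]
    refine Finset.sum_congr rfl fun i _ => ?_
    rw [integral_smul_measure, integral_dirac, ENNReal.toReal_ofReal (h₄ i), smul_eq_mul]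
  choose r hr using fun i => (exists_real_of_mem_effSupport hf (h₃ i)).1
  choose u hu using fun i => (exists_real_of_mem_effSupport hf (h₃ i)).2
  refine ⟨⟨⟨?_⟩, ?_, fun j => ?_⟩, ?_⟩
  · rw [hP, Measure.finsetSum_apply]
    simp only [Measure.smul_apply, measure_univ, smul_eq_mul, mul_one]
    rw [← ENNReal.ofReal_sum_of_nonneg fun i _ => h₄ i, h₁, ENNReal.ofReal_one]
  · exact hae (p := fun z => z ∈ D.support) fun i => support_of_mem_effSupport (h₃ i)
  · rw [expectTop_eq_integral (r := fun z => (D.h j z).toReal)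
      (hae fun i => by rw [hu, EReal.toReal_coe]) (hint _).1, (hint _).2]
    refine le_trans (le_of_eq ?_) (h₂ j)
    simp only [hu, EReal.toReal_coe, ← EReal.coe_mul, ← coe_sum_ereal]
  · rw [puqObj, expectBot_eq_integral (r := fun z => (D.disutility z).toReal)
      (hae fun i => by rw [hr, EReal.toReal_coe]) (hint _).1, (hint _).2]
    simp only [frObj, hr, EReal.toReal_coe, ← EReal.coe_mul, ← coe_sum_ereal]

end Data
end UQ

namespace UQ

set_option linter.unusedSectionVars false

theorem coe_pos_mul_lt_iff {t r : ℝ} (ht : 0 < t) {x : EReal} :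
    (t : EReal) * x < r ↔ x < ((r / t : ℝ) : EReal) := by
  induction x using EReal.rec with
  | bot => simp only [EReal.coe_mul_bot_of_pos ht, EReal.bot_lt_coe]
  | top => simp only [EReal.coe_mul_top_of_pos ht, not_top_lt]
  | coe s => norm_cast; rw [lt_div_iff₀ ht, mul_comm]

theorem persp_lt_iff_of_pos {d : ℕ} {f : EuclideanSpace ℝ (Fin d) → EReal}
    {x : EuclideanSpace ℝ (Fin d)} {t r : ℝ} (ht : 0 < t) :
    persp f x t < r ↔ f (t⁻¹ • x) < ((r / t : ℝ) : EReal) := by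
  rw [persp, if_pos ht, coe_pos_mul_lt_iff ht]

/-! ### Strong duality and attainment -/

namespace Data

variable {d : ℕ} {I J L : Type*} [Fintype I] [Fintype J] [Fintype L] {D : Data d I J L}

/-- A constraint that is not linear is strict at the Slater point, any other one comes from an
affine block; either way each block has a conic model. Only points with positive scales must be
compared, and dividing by the scale places them in (AD-B). -/
theorem exists_apw_of_isSlaterPoint (hf : ∀ i b, IsPCC (D.block i b)) {x : ADBVar d I J}
    (hx : D.adbConstraints.IsSlaterPoint x) (hpos : ∀ i, 0 < x.lam i) {V : ℝ}
    (hV : ∀ y ∈ D.adbSet, D.adbObj y ≤ V) :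
    ∃ y ∈ D.apwConstraints.set, y.alpha + ∑ j, D.mu j * y.beta j ≤ V := by
  obtain ⟨hlam, hmu, -, hle⟩ := mem_adbConstraints_iff.1 hx.mem
  have hmodel : ∀ i b, ∃ K, ∃ r ≤ level L x.tau x.omega i b,
      IsConicModel (D.block i b) K (x.ups i, x.lam i, r) := fun i b => by
    have := exists_isConicModel (hf i b).proper (hf i b).convex
      (isCorePoint_of_isSlaterPoint_adb hx (hpos i) b) (hpos i)
      ((persp_le_iff_of_pos (hpos i)).1 (hle i b)) (by
        by_cases hlin : IsLinearOn D.adbConstraints.ground (D.adbIneq (adbIneqName i b))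
        · exact .inr (isAffineFun_of_isLinearOn_adb hlin)
        · left
          have : D.adbIneq (adbIneqName i b) x < 0 := hx.strict _ hlin
          rw [adbIneq_adbIneqName, ereal_sub_coe_neg_iff] at this
          exact (persp_lt_iff_of_pos (hpos i)).1 this)
    rwa [smul_inv_smul₀ (hpos i).ne'] at this
  choose K r hr hK using hmodel
  obtain ⟨α, β, ν, y, ρ, hβ, hν, hy, hyρ, hρ, hα⟩ := exists_conjugate_solution (μ := D.mu) (V := V)
    hf hK hlam (fun j => (Finset.sum_le_sum fun i _ => hr i (some (.inl j))).trans (hmu j))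
    (fun i l => hr i (some (.inr l))) (fun t z r ht ht1 hz hr hr' => by
      have := hV (t, fun i => (z i, fun j => r i (some (.inl j)), -r i none))
        ⟨ht1, hr, fun i => mem_augSupport_iff.2 fun b => (hz i b).trans ?_, fun i => (ht i).le⟩
      · simp only [adbObj, mul_neg, Finset.sum_neg_distrib] at this
        exact_mod_cast this
      · rw [EReal.coe_le_coe_iff]
        rcases b with _ | j | l
        · simp [level]
        · simp [level]
        · exact hr' i l)
  have hvec : ∀ i b, dualVec ((α, β, fun i => y i none, fun i j => y i (some (.inl j)),
      fun i l => y i (some (.inr l)), ν) : APWVar d I J L) i b = y i b := by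
    rintro i (_ | _ | _) <;> rfl
  refine ⟨(α, β, fun i => y i none, fun i j => y i (some (.inl j)),
    fun i l => y i (some (.inr l)), ν), (mem_apwConstraints_iff hf).2 ⟨hβ, hν, fun i => ?_,
    fun i => ⟨ρ i, fun b => ?_, hρ i⟩⟩, hα⟩
  · simp only [hvec]; exact hy i
  · rw [hvec]; exact hyρ i b

theorem exists_adb_of_isSlaterPoint [Nonempty I] (hf : ∀ i b, IsPCC (D.block i b)) {x : APWVar d I J L}
    (hx : D.apwConstraints.IsSlaterPoint x) {W : ℝ}
    (hW : ∀ y ∈ D.apwConstraints.set, W ≤ y.alpha + ∑ j, D.mu j * y.beta j) :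
    ∃ y ∈ D.adbConstraints.set, W ≤ ∑ i, y.tau i := by
  have hpos := weight_pos_of_isSlaterPoint_apw hf hx
  obtain ⟨-, -, hy, -⟩ := (mem_apwConstraints_iff hf).1 hx.mem
  let e : I → Option (J ⊕ L) → EReal := fun i b =>
    persp (conj (D.block i b)) (dualVec x i b) (weight x.beta x.nu i b)
  have hbound : ∀ i, ∃ ρ : Option (J ⊕ L) → ℝ, (∀ b, e i b ≤ ρ b) ∧ ∑ b, ρ b ≤ x.alpha ∧
      ∀ b, e i b < ρ b ∨ IsAffineFun (conj (D.block i b)) := fun i => by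
    have h0 : D.apwIneq (.piece i) x ≤ 0 := hx.mem.1 (.piece i)
    rw [apwIneq_piece, ereal_sub_coe_nonpos_iff] at h0
    obtain ⟨ρ, hρ, hρα⟩ := exists_real_of_sum_le _ (fun b _ => (hf i b).bot_lt_persp_conj _ _) h0
    by_cases hlin : IsLinearOn D.apwConstraints.ground (D.apwIneq (.piece i))
    · exact ⟨ρ, fun b => (hρ b (Finset.mem_univ b)).le, hρα,
        fun b => .inr (isAffineFun_of_isLinearOn_apw hf hlin b)⟩
    · have h1 : D.apwIneq (.piece i) x < 0 := hx.strict (.piece i) hlin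
      rw [apwIneq_piece, ereal_sub_coe_neg_iff, Finset.sum_congr rfl hρ, ← coe_sum_ereal,
        EReal.coe_lt_coe_iff] at h1
      have hcard : 0 < (Fintype.card (Option (J ⊕ L)) : ℝ) := Nat.cast_pos.2 Fintype.card_pos
      -- The slack of the single constraint of a piece is shared equally, so that every block gets a
      -- strict bound.
      have hδ : 0 < (x.alpha - ∑ b, ρ b) / Fintype.card (Option (J ⊕ L)) :=
        div_pos (by linarith) hcard
      have hlt : ∀ b, e i b < ((ρ b + (x.alpha - ∑ b, ρ b) / Fintype.card (Option (J ⊕ L)) : ℝ) :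
          EReal) := fun b => by
        simp only [e, hρ b (Finset.mem_univ b)]
        rw [EReal.coe_lt_coe_iff]
        linarith
      refine ⟨_, fun b => (hlt b).le, ?_, fun b => .inl (hlt b)⟩
      rw [Finset.sum_add_distrib, Finset.sum_const, Finset.card_univ, nsmul_eq_mul,
        mul_div_cancel₀ _ hcard.ne']
      linarith
  choose ρ hρ hρα hstrict using hbound
  have hmodel : ∀ i b, ∃ K, ∃ r ≤ ρ i b, IsConicModel (conj (D.block i b)) K
      (dualVec x i b, weight x.beta x.nu i b, r) := fun i b => by
    have := exists_isConicModel (hf i b).isProper_conj isConvexFun_conj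
      (isCorePoint_of_isSlaterPoint_apw hf hx i b) (hpos i b)
      ((persp_le_iff_of_pos (hpos i b)).1 (hρ i b))
      ((hstrict i b).imp_left (persp_lt_iff_of_pos (hpos i b)).1)
    rwa [smul_inv_smul₀ (hpos i b).ne'] at this
  choose K r hr hK using hmodel
  obtain ⟨τ, t, ω, v, ht, ht1, hω, hv, hτ⟩ := exists_perspective_solution (μ := D.mu) (W := W) hf hK
    hy (fun i => (Finset.sum_le_sum fun b _ => hr i b).trans (hρα i))
    (fun α β ν y ρ hw hy hyρ hρ => by
      have hvec : ∀ i b, dualVec ((α, β, fun i => y i none, fun i j => y i (some (.inl j)),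
          fun i l => y i (some (.inr l)), fun i l => ν i l) : APWVar d I J L) i b = y i b := by
        rintro i (_ | _ | _) <;> rfl
      obtain ⟨i₀⟩ := ‹Nonempty I›
      refine hW (α, β, fun i => y i none, fun i j => y i (some (.inl j)),
        fun i l => y i (some (.inr l)), ν) ((mem_apwConstraints_iff hf).2
        ⟨fun j => (hw i₀ (some (.inl j))).le, fun i l => (hw i (some (.inr l))).le, fun i => ?_,
        fun i => ⟨ρ i, fun b => ?_, hρ i⟩⟩)
      · simp only [hvec]; exact hy i
      · rw [hvec]; exact hyρ i b)
  exact ⟨(τ, t, ω, v), mem_adbConstraints_iff.2 ⟨ht1, hω, ht, hv⟩, hτ⟩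

theorem exists_mem_augSupport_of_mem_effSupportPiece (hf : ∀ i b, IsPCC (D.block i b)) {i : I}
    {z : EuclideanSpace ℝ (Fin d)} (hz : z ∈ D.effSupportPiece i) : ∃ p, p ∈ D.augSupport i := by
  obtain ⟨hs, hh, hg⟩ := hz
  choose u hu using fun j => (hf i (some (.inl j))).proper.exists_real (hh j)
  obtain ⟨r, hr⟩ := (hf i none).proper.exists_real hg
  refine ⟨(z, u, -r), hs, fun j => (hu j).le, ?_⟩
  simp only [EReal.coe_neg]
  rw [← hr]
  simp [block]

/-- A feasible point of (AD-B') whose vectors `υ_i` vanish together with `λ_i` gives a feasible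
point of (AD-B). -/
theorem exists_mem_adbSet (hf : ∀ i b, IsPCC (D.block i b))
    (hS : ∀ i, (D.effSupportPiece i).Nonempty) {x : ADBVar d I J} (hx : x ∈ D.adbConstraints.set)
    (h0 : ∀ i, x.lam i = 0 → x.ups i = 0) :
    ∃ y ∈ D.adbSet, D.adbCvxObj x ≤ D.adbObj y ∧ y.1 = x.lam ∧
      ∀ i, 0 < x.lam i → (y.2 i).1 = (x.lam i)⁻¹ • x.ups i := by
  obtain ⟨h₁, h₂, h₃, h₄⟩ := mem_adbConstraints_iff.1 hx
  have key : ∀ i, ∃ p ∈ D.augSupport i, x.tau i ≤ x.lam i * p.2.2 ∧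
      (∀ j, x.lam i * p.2.1 j ≤ x.omega i j) ∧ (0 < x.lam i → p.1 = (x.lam i)⁻¹ • x.ups i) := by
    intro i
    rcases (h₃ i).eq_or_lt with hi | hi
    · obtain ⟨p, hp⟩ := exists_mem_augSupport_of_mem_effSupportPiece hf (hS i).some_mem
      have hlev : ∀ b, 0 ≤ level L x.tau x.omega i b := fun b => by
        have := h₄ i b
        rw [← hi, h0 i hi.symm, persp_zero_le_iff] at this
        obtain ⟨w, hw⟩ := (hf i b).isProper_conj.2
        simpa using this w hw
      refine ⟨p, hp, ?_, fun j => ?_, fun h => absurd hi h.ne⟩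
      · have := hlev none
        simp only [level] at this
        rw [← hi, zero_mul]
        linarith
      · rw [← hi, zero_mul]
        exact hlev (some (.inl j))
    · refine ⟨((x.lam i)⁻¹ • x.ups i, fun j => x.omega i j / x.lam i, x.tau i / x.lam i),
        mem_augSupport_iff.2 fun b => ?_, (mul_div_cancel₀ _ hi.ne').ge,
        fun j => (mul_div_cancel₀ _ hi.ne').le, fun _ => rfl⟩
      refine ((persp_le_iff_of_pos hi).1 (h₄ i b)).trans_eq ?_
      rcases b with _ | _ | _ <;> simp [level, neg_div]
  choose p hp hτ hω hz using key
  refine ⟨(x.lam, p), ⟨h₁, fun j => (Finset.sum_le_sum fun i _ => hω i j).trans (h₂ j), hp, h₃⟩, ?_,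
    rfl, hz⟩
  rw [adbCvxObj, adbObj, EReal.coe_le_coe_iff]
  exact Finset.sum_le_sum fun i _ => hτ i

/-- At `λ_i = 0` the support constraints say that `υ_i` is a recession direction of `S`, so a ray in
this direction would lie in a bounded set. -/
theorem ups_eq_zero_of_lam_eq_zero (hf : ∀ i b, IsPCC (D.block i b))
    (hS : ∀ i, (D.effSupportPiece i).Nonempty) (hb : Bornology.IsBounded D.support)
    {x : ADBVar d I J} (hx : x ∈ D.adbConstraints.set) {i : I} (h0 : x.lam i = 0) :
    x.ups i = 0 := by
  obtain ⟨-, -, -, h₄⟩ := mem_adbConstraints_iff.1 hx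
  obtain ⟨z, hz, -⟩ := hS i
  have hmem : ∀ n : ℕ, z + (n : ℝ) • x.ups i ∈ D.support := fun n l => by
    have h1 := h₄ i (some (.inr l))
    rw [h0] at h1
    have := (hf i (some (.inr l))).le_add_smul (r := 0) (hz l) h1 n.cast_nonneg
    simpa [level, block] using this
  obtain ⟨R, hR⟩ := hb.exists_norm_le
  by_contra hne
  have hpos : 0 < ‖x.ups i‖ := norm_pos_iff.2 hne
  obtain ⟨n, hn⟩ := exists_nat_gt ((R + ‖z‖) / ‖x.ups i‖)
  rw [div_lt_iff₀ hpos] at hn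
  have h1 := hR _ (hmem n)
  have h2 : ‖(n : ℝ) • x.ups i‖ ≤ ‖z + (n : ℝ) • x.ups i‖ + ‖z‖ := by
    have := norm_sub_le (z + (n : ℝ) • x.ups i) z
    rwa [add_sub_cancel_left] at this
  rw [norm_smul, Real.norm_of_nonneg n.cast_nonneg] at h2
  linarith

theorem discreteDist_eq {x : ADBVar d I J} {z : I → EuclideanSpace ℝ (Fin d)}
    (h : ∀ i, 0 < x.lam i → z i = (x.lam i)⁻¹ • x.ups i) :
    D.discreteDist x = ∑ i, ENNReal.ofReal (x.lam i) • Measure.dirac (z i) := by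
  refine Finset.sum_congr rfl fun i _ => ?_
  split_ifs with hi
  · rw [h i hi]
  · rw [ENNReal.ofReal_of_nonpos (not_lt.1 hi), zero_smul]

/-- The weak inequalities form a cycle once this one is added. -/
theorem sameValues_of_le [Nonempty I] (hf : ∀ i b, IsPCC (D.block i b))
    (h : minValue D.apwConstraints.set D.apwCvxObj ≤ maxValue D.adbSet D.adbObj) :
    D.SameValues := by
  have h1 : minValue D.apwSet D.duqObj ≤ minValue D.apwConstraints.set D.apwCvxObj :=
    le_iInf₂ fun x hx => iInf₂_le_of_le _ (mem_apwSet_of_mem_apwConstraints hf hx) le_rfl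
  have h2 : minValue D.apwSet D.duqObj = minValue D.duqSet D.duqObj := by rw [apwSet_eq_duqSet hf]
  have h3 : maxValue D.ambiguitySet D.puqObj ≤ minValue D.duqSet D.duqObj :=
    iSup₂_le fun P hP => le_iInf₂ fun x hx => puqObj_le_duqObj hf hP hx
  have h4 : maxValue D.frSet D.frObj ≤ maxValue D.ambiguitySet D.puqObj :=
    iSup₂_le fun x hx => by
      obtain ⟨hm, he⟩ := mem_ambiguitySet_of_mem_frSet hf hx
      exact le_iSup₂_of_le _ hm he.ge
  have h5 : maxValue D.adbSet D.adbObj ≤ maxValue D.frSet D.frObj :=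
    iSup₂_le fun x hx => by
      obtain ⟨hm, he⟩ := adbObj_le_frValue hf hx
      exact le_iSup₂_of_le _ hm he
  have h6 : maxValue D.adbSet D.adbObj ≤ maxValue D.adbConstraints.set D.adbCvxObj :=
    iSup₂_le fun x hx => by
      obtain ⟨y, hy, he⟩ := exists_adbCvxObj_eq hx
      exact le_iSup₂_of_le y hy he.le
  have h7 : maxValue D.adbConstraints.set D.adbCvxObj
      ≤ minValue D.apwConstraints.set D.apwCvxObj :=
    iSup₂_le fun x hx => le_iInf₂ fun y hy => EReal.coe_le_coe_iff.2 (adb_le_apw hf hx hy)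
  rw [SameValues]
  have e1 := le_antisymm (h.trans (h5.trans (h4.trans (h3.trans h2.ge)))) h1
  have e3 := le_antisymm ((h2.ge.trans h1).trans (h.trans (h5.trans h4))) h3
  have e4 := le_antisymm ((h3.trans (h2.ge.trans h1)).trans (h.trans h5)) h4
  have e5 := le_antisymm ((h4.trans (h3.trans (h2.ge.trans h1))).trans h) h5
  have e6 := le_antisymm h6 (h7.trans h)
  exact ⟨e1, h2, e3, e4, e5, e6⟩

theorem strong_duality_of_isSlaterPoint_adb [Nonempty I] (hf : ∀ i b, IsPCC (D.block i b))
    (hS : ∀ i, (D.effSupportPiece i).Nonempty) {x : ADBVar d I J}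
    (hx : D.adbConstraints.IsSlaterPoint x) (hpos : ∀ i, 0 < x.lam i) :
    D.SameValues ∧ ∃ y, SolvesMin D.apwConstraints.set D.apwCvxObj y := by
  by_cases htop : maxValue D.adbSet D.adbObj = ⊤
  · have hsame := sameValues_of_le hf (htop ▸ le_top)
    -- With value `+∞`, (AP-W') has no feasible point, so by convention any point solves it; `0` is
    -- arbitrary.
    refine ⟨hsame, 0, fun ⟨y, hy⟩ => ?_⟩
    obtain ⟨e1, e2, e3, e4, e5, -⟩ := hsame
    have h1 : minValue D.apwConstraints.set D.apwCvxObj ≤ D.apwCvxObj y := iInf₂_le y hy.1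
    rw [e1, e2, e3, e4, e5, htop] at h1
    exact absurd (top_le_iff.1 h1) hy.2
  · obtain ⟨y₀, hy₀, -⟩ := exists_mem_adbSet hf hS hx.mem
      fun i h => absurd h (hpos i).ne'
    have hbot : maxValue D.adbSet D.adbObj ≠ ⊥ := by
      have : D.adbObj y₀ ≤ maxValue D.adbSet D.adbObj := le_iSup₂ (f := fun y _ => D.adbObj y) y₀ hy₀
      exact ((EReal.bot_lt_coe _).trans_le this).ne'
    have hV := EReal.coe_toReal htop hbot
    obtain ⟨y, hy, hle⟩ := exists_apw_of_isSlaterPoint hf hx hpos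
      (V := (maxValue D.adbSet D.adbObj).toReal) fun y hy => by
        rw [hV]
        exact le_iSup₂ (f := fun y _ => D.adbObj y) y hy
    have hobj : D.apwCvxObj y ≤ maxValue D.adbSet D.adbObj := by
      rw [← hV, apwCvxObj, EReal.coe_le_coe_iff]
      exact hle
    have hmin : minValue D.apwConstraints.set D.apwCvxObj ≤ D.apwCvxObj y := iInf₂_le y hy
    have hsame := sameValues_of_le hf (hmin.trans hobj)
    refine ⟨hsame, y, fun _ => ⟨⟨hy, EReal.coe_ne_top _⟩, le_antisymm ?_ hmin⟩⟩
    obtain ⟨e1, e2, e3, e4, e5, -⟩ := hsame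
    rw [e1, e2, e3, e4, e5]
    exact hobj

/-- If (D-UQ) is feasible, the common value is below `+∞`; then (AP-W') is feasible as well and its
solution attains that value. -/
theorem solvesMin_duq_of_solvesMin_apw [Nonempty I] (hf : ∀ i b, IsPCC (D.block i b))
    (hsame : D.SameValues) {x : APWVar d I J L}
    (hx : SolvesMin D.apwConstraints.set D.apwCvxObj x) :
    SolvesMin D.duqSet D.duqObj (x.alpha, x.beta) := by
  rintro ⟨w, hw⟩
  obtain ⟨e1, e2, -⟩ := hsame
  have hlt : minValue D.apwConstraints.set D.apwCvxObj < ⊤ := by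
    rw [e1, e2]
    exact (iInf₂_le w hw.1).trans_lt (EReal.coe_lt_top _)
  obtain ⟨y, hy⟩ := iInf_lt_iff.1 hlt
  obtain ⟨hy, -⟩ := iInf_lt_iff.1 hy
  obtain ⟨hxm, hxv⟩ := hx ⟨y, hy, EReal.coe_ne_top _⟩
  refine ⟨⟨?_, EReal.coe_ne_top _⟩, ?_⟩
  · rw [← apwSet_eq_duqSet hf]
    exact mem_apwSet_of_mem_apwConstraints hf hxm.1
  · rw [← e2, ← e1, ← hxv]
    rfl

theorem strong_duality_of_isSlaterPoint_apw [Nonempty I] (hf : ∀ i b, IsPCC (D.block i b))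
    (hS : ∀ i, (D.effSupportPiece i).Nonempty) (hb : Bornology.IsBounded D.support)
    {x : APWVar d I J L} (hx : D.apwConstraints.IsSlaterPoint x) :
    D.SameValues ∧ ∃ y, SolvesMax D.adbConstraints.set D.adbCvxObj y := by
  by_cases hbot : minValue D.apwConstraints.set D.apwCvxObj = ⊥
  · have hsame := sameValues_of_le hf (hbot ▸ bot_le)
    -- With value `-∞`, (AD-B') has no feasible point, and again any point solves it.
    refine ⟨hsame, 0, fun ⟨y, hy⟩ => ?_⟩
    obtain ⟨e1, e2, e3, e4, e5, e6⟩ := hsame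
    have h1 : D.adbCvxObj y ≤ maxValue D.adbConstraints.set D.adbCvxObj :=
      le_iSup₂ (f := fun y _ => D.adbCvxObj y) y hy.1
    rw [← e6, ← e5, ← e4, ← e3, ← e2, ← e1, hbot] at h1
    exact absurd (le_bot_iff.1 h1) hy.2
  · have htop : minValue D.apwConstraints.set D.apwCvxObj ≠ ⊤ :=
      ((iInf₂_le x hx.mem).trans_lt (EReal.coe_lt_top _)).ne
    have hW := EReal.coe_toReal htop hbot
    obtain ⟨y, hy, hle⟩ := exists_adb_of_isSlaterPoint hf hx
      (W := (minValue D.apwConstraints.set D.apwCvxObj).toReal) fun y hy => by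
        rw [← EReal.coe_le_coe_iff, hW]
        exact iInf₂_le y hy
    have hobj : minValue D.apwConstraints.set D.apwCvxObj ≤ D.adbCvxObj y := by
      rw [← hW, adbCvxObj, EReal.coe_le_coe_iff]
      exact hle
    obtain ⟨w, hw, hyw, -⟩ := exists_mem_adbSet hf hS hy
      fun i => ups_eq_zero_of_lam_eq_zero hf hS hb hy
    have hsame := sameValues_of_le hf (hobj.trans (hyw.trans
      (le_iSup₂ (f := fun y _ => D.adbObj y) w hw)))
    refine ⟨hsame, y, fun _ => ⟨⟨hy, EReal.coe_ne_bot _⟩, le_antisymm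
      (le_iSup₂ (f := fun y _ => D.adbCvxObj y) y hy) ?_⟩⟩
    obtain ⟨e1, e2, e3, e4, e5, e6⟩ := hsame
    rw [← e6, ← e5, ← e4, ← e3, ← e2, ← e1]
    exact hobj

/-- A solution of (AD-B') descends to (AD-B) and (FR) without loss of objective value. The points
chosen for pieces with `λ_i = 0` are atoms of weight zero and leave the distribution unchanged. -/
theorem solvesMax_puq_of_solvesMax_adb [Nonempty I] (hf : ∀ i b, IsPCC (D.block i b))
    (hS : ∀ i, (D.effSupportPiece i).Nonempty) (hb : Bornology.IsBounded D.support)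
    (hsame : D.SameValues) {x : ADBVar d I J}
    (hx : SolvesMax D.adbConstraints.set D.adbCvxObj x) :
    SolvesMax D.ambiguitySet D.puqObj (D.discreteDist x) := by
  rintro ⟨P, hP⟩
  obtain ⟨-, -, -, e4, e5, e6⟩ := hsame
  have hlt : ⊥ < maxValue D.adbConstraints.set D.adbCvxObj := by
    rw [← e6, ← e5, ← e4]
    exact (bot_lt_iff_ne_bot.2 hP.2).trans_le (le_iSup₂ (f := fun P _ => D.puqObj P) P hP.1)
  obtain ⟨y, hy⟩ := lt_iSup_iff.1 hlt
  obtain ⟨hy, -⟩ := lt_iSup_iff.1 hy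
  obtain ⟨hxm, hxv⟩ := hx ⟨y, hy, EReal.coe_ne_bot _⟩
  obtain ⟨w, hw, hxw, hw1, hwz⟩ := exists_mem_adbSet hf hS hxm.1
    fun i => ups_eq_zero_of_lam_eq_zero hf hS hb hxm.1
  obtain ⟨hfr, hwfr⟩ := adbObj_le_frValue hf hw
  obtain ⟨hm, he⟩ := mem_ambiguitySet_of_mem_frSet hf hfr
  simp only [hw1] at hm he hwfr
  rw [discreteDist_eq hwz]
  have hge : maxValue D.ambiguitySet D.puqObj
      ≤ D.puqObj (∑ i, ENNReal.ofReal (x.lam i) • Measure.dirac (w.2 i).1) := by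
    rw [e4, e5, e6, ← hxv, he]
    exact hxw.trans hwfr
  have hle := le_iSup₂ (f := fun P (_ : P ∈ D.ambiguitySet) => D.puqObj P) _ hm
  refine ⟨⟨hm, ?_⟩, le_antisymm hle hge⟩
  rw [e4, e5, e6] at hge
  exact (hlt.trans_le hge).ne'

end Data
end UQ

theorem mainTheorem2 {d : ℕ} {I J L : Type*} [Fintype I] [Nonempty I] [Fintype J] [Fintype L]
    (D : UQ.Data d I J L)
    (hG : ∀ i, UQ.IsPCC (fun z => -D.g i z))
    (hH : ∀ j, UQ.IsPCC (D.h j))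
    (hC : ∀ l, UQ.IsPCC (D.c l))
    (hS : ∀ i, (D.effSupportPiece i).Nonempty) :
    ((∃ x, UQ.IsSlaterPointMax D.adbConstraints D.adbCvxObj x ∧ ∀ i, 0 < x.lam i) →
      D.SameValues ∧
      (∃ x, UQ.SolvesMin D.apwConstraints.set D.apwCvxObj x) ∧
      ∀ x, UQ.SolvesMin D.apwConstraints.set D.apwCvxObj x →
        UQ.SolvesMin D.duqSet D.duqObj (x.alpha, x.beta)) ∧
    ((∃ x, UQ.IsSlaterPointMin D.apwConstraints D.apwCvxObj x) →
      Bornology.IsBounded D.support →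
      D.SameValues ∧
      (∃ x, UQ.SolvesMax D.adbConstraints.set D.adbCvxObj x) ∧
      ∀ x, UQ.SolvesMax D.adbConstraints.set D.adbCvxObj x →
        UQ.SolvesMax D.ambiguitySet D.puqObj (D.discreteDist x)) := by
  have hf := UQ.Data.isPCC_block D hG hH hC
  constructor
  · rintro ⟨x, hx, hpos⟩
    obtain ⟨hsame, hsol⟩ := UQ.Data.strong_duality_of_isSlaterPoint_adb hf hS hx.1 hpos
    exact ⟨hsame, hsol, fun y hy => UQ.Data.solvesMin_duq_of_solvesMin_apw hf hsame hy⟩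
  · rintro ⟨x, hx⟩ hb
    obtain ⟨hsame, hsol⟩ := UQ.Data.strong_duality_of_isSlaterPoint_apw hf hS hb hx.1
    exact ⟨hsame, hsol, fun y hy => UQ.Data.solvesMax_puq_of_solvesMax_adb hf hS hb hsame hy⟩
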